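/- Let $L$ be a first-order language. A partial map $f:H\rightharpoonup H'$ between $L$-structures is a *partial embedding* if it is injective and preserves quantifier-free formulas in both directions. All classes of $L$-structures are closed under isomorphism, and the empty structure is allowed. A *quasiminimal excellent class* $\mathcal C$ is a class of $L$-structures together with a map $\mathrm{cl}_H:\mathcal P(H)\to\mathcal P(H)$ for each $H\in\mathcal C$ (classes are compared together with these maps), such that the empty map between any two members of $\mathcal C$ is a partial embedding, and for all $H,H'\in\mathcal C$: - (I.1) $\mathrm{cl}_H$ is a pregeometry in which closures of finite sets are countable; (I.2) if $X\subseteq H$, then $\mathrm{cl}_H(X)$ is a substructure and lies in $\mathcal C$; (I.3) if $f:H\rightharpoonup H'$ is a partial embedding defined on $X\cup\{y\}$ and $y\in\mathrm{cl}_H(X)$, then $f(y)\in\mathrm{cl}_{H'}(f(X))$. - (II) Let $G\subseteq H$ and $G'\subseteq H'$ each be countable and closed, or empty, and let $g:G\to G'$ be a bijective partial embedding. (II.1) If $x\in H\setminus\mathrm{cl}_H(G)$ and $x'\in H'\setminus\mathrm{cl}_{H'}(G')$, then $g\cup\{(x,x')\}$ is a partial embedding. (II.2) If $g\cup f$ is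 a partial embedding, $f$ has finite domain $X$, and $y\in\mathrm{cl}_H(X\cup G)$, then there is $y'\in H'$ such that $g\cup f\cup\{(y,y')\}$ is a partial embedding. - (III) Let $C=\bigcup_{i=1}^n\mathrm{cl}_H(B_i)$ be countable, where $B_1,\dots,B_n$ are subsets of one independent set, and let $g:H\rightharpoonup H'$ be a partial embedding with domain $C$ that maps closed subsets of $C$ to closed sets. For every finite $X\subseteq\mathrm{cl}_H(C)$ there is a finite $C_0\subseteq C$ such that, for every $f:H\rightharpoonup H'$ with domain $X$, if $f\cup g|_{C_0}$ is a partial embedding, then so is $f\cup g$. The dimension of $H$ is the cardinality of a basis for $\mathrm{cl}_H$. The class is *uncountably categorical* if for each uncountable cardinal $\kappa$ it has exactly one member of cardinality $\kappa$ up to isomorphism. It is *nondegenerate* if it has an infinite-dimensional member and is not a proper subclass of another quasiminimal excellent class in the language $L$. A *closed embedding* is an $L$-embedding with closed image. Let $\mathcal C$ be a quasiminimal excellent class of $L$-structures. 1. If $\mathcal C$ has a member of dimension $\aleph_0$, then there is a unique uncountably categorical quasiminimal excellent class $\mathcal C'$ of $L$-structures containing $\mathcal C$. 2. If $\mathcal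 C$ is nondegenerate, then (without any assumption of definability) $\mathcal C$ is uncountably categorical. Moreover, if $L$ is countable, then $\mathcal C$ is $L_{\omega_1,\omega}(Q)$-definable in the following form: there are quantifier-free $L_{\omega_1,\omega}$-formulas $\pi_n(x,y_1,\dots,y_n)$ ($n\in\mathbb N$) that define $x\in\mathrm{cl}_H(y_1,\dots,y_n)$ in every $H\in\mathcal C$, and Scott sentences $\sigma_n$ of the members of $\mathcal C$ of dimension $n$ ($n\in\mathbb N$) and $\sigma_\omega$ of the member of dimension $\aleph_0$, such that $\mathcal C$ consists exactly of the models of $$\Sigma=\Big[\bigvee_{n\le\omega}\sigma_n\Big]\wedge\Big[\bigwedge_{n\in\mathbb N}(\forall y_1,\dots,y_n)\,\neg(Qx)\,\pi_n(x,y_1,\dots,y_n)\Big],$$ with the closure operators defined by the $\pi_n$; here $Qx$ means "there are uncountably many $x$". For an arbitrary language $L$ there is a countable sublanguage $L^0$ such that the class $\mathcal C^0$ of $L^0$-reducts of members of $\mathcal C$ is a quasiminimal excellent class, the reduct map $\mathcal C\to\mathcal C^0$ is an isomorphism of categories (with closed embeddings as morphisms), and $\mathcal C^0$ is definable by a sentence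 of this form in $L^0$. -/

import Mathlib

open scoped FirstOrder Cardinal

universe u v w v' w'

namespace QMEC

/-! ### Closure operators on a set -/

/-- `cl` is a pregeometry on `M`: a closure operator of finite character with exchange. -/
structure IsPregeometry {M : Type u} (cl : Set M → Set M) : Prop where
  subset_cl : ∀ X, X ⊆ cl X
  mono : ∀ X Y, X ⊆ Y → cl X ⊆ cl Y
  idem : ∀ X, cl (cl X) = cl X
  finite_char : ∀ X a, a ∈ cl X → ∃ Y : Set M, Y.Finite ∧ Y ⊆ X ∧ a ∈ cl Y
  exchange : ∀ X a b, a ∈ cl (insert b X) → a ∉ cl X → b ∈ cl (insert a X)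

/-- `G` is closed for `cl`. -/
def IsCl {M : Type u} (cl : Set M → Set M) (G : Set M) : Prop := cl G = G

/-- `B` is independent for `cl`. -/
def Indep {M : Type u} (cl : Set M → Set M) (B : Set M) : Prop :=
  ∀ b ∈ B, b ∉ cl (B \ {b})

/-- `cl` has dimension `κ`: there is a basis (an independent spanning set) of cardinality `κ`. -/
def HasDim {M : Type u} (cl : Set M → Set M) (κ : Cardinal.{u}) : Prop :=
  ∃ B : Set M, Indep cl B ∧ cl B = Set.univ ∧ #B = κ

/-- `C` is a crown: the union of the closures of finitely many subsets of one independent set. -/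
def IsCrown {M : Type u} (cl : Set M → Set M) (C : Set M) : Prop :=
  ∃ B : Set M, Indep cl B ∧ ∃ (n : ℕ) (D : Fin n → Set M), (∀ i, D i ⊆ B) ∧ C = ⋃ i, cl (D i)

/-! ### Structures with a closure operator -/

/-- An `L`-structure `H` (possibly empty) with a function `cl` from its subsets to its subsets.
A class of `L`-structures with a function `cl_H` given for each member is a set of these. -/
structure ClStr (L : FirstOrder.Language.{v, w}) where
  carrier : Type u
  str : L.Structure carrier
  cl : Set carrier → Set carrier

instance {L : FirstOrder.Language.{v, w}} : CoeSort (ClStr.{u} L) (Type u) := ⟨ClStr.carrier⟩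

instance {L : FirstOrder.Language.{v, w}} (H : ClStr.{u} L) : L.Structure H.carrier := H.str

/-- A substructure of `H` with the restricted closure operator `Y ↦ cl_H(Y) ∩ S`. -/
def ClStr.sub {L : FirstOrder.Language.{v, w}} (H : ClStr.{u} L) (S : L.Substructure H) : ClStr.{u} L where
  carrier := S
  str := inferInstance
  cl := fun Y => {a | (a : H.carrier) ∈ H.cl ((fun y : S => (y : H.carrier)) '' Y)}

/-- The reduct of `H` along a language map, with the same closure operator. -/
def ClStr.reduct {L₀ : FirstOrder.Language.{v', w'}} {L : FirstOrder.Language.{v, w}} (φ : L₀ →ᴸ L)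
    (H : ClStr.{u} L) : ClStr.{u} L₀ where
  carrier := H.carrier
  str := φ.reduct H.carrier
  cl := H.cl

/-- An isomorphism of structures with closure operators. -/
def ClStr.Iso {L : FirstOrder.Language.{v, w}} (H K : ClStr.{u} L) : Prop :=
  ∃ e : H.carrier ≃[L] K.carrier, ∀ X : Set H.carrier, e '' (H.cl X) = K.cl (e '' X)

/-- The graph `r` of a partial embedding: quantifier-free formulas are preserved in both
directions. Applied to equations between variables this says that `r` is the graph of an injective
partial function. For `r = ∅` it says that the same quantifier-free sentences hold. -/
def PartialEmb {L : FirstOrder.Language.{v, w}} (H K : ClStr.{u} L) (r : SetRel H.carrier K.carrier) : Prop :=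
  ∀ (n : ℕ) (p : Fin n → H.carrier × K.carrier), (∀ i, p i ∈ r) →
    ∀ φ : L.Formula (Fin n), φ.IsQF →
      (φ.Realize (fun i => (p i).1) ↔ φ.Realize (fun i => (p i).2))

/-- A closed partial embedding: closed subsets of the domain have closed images. -/
def ClosedPartialEmb {L : FirstOrder.Language.{v, w}} (H K : ClStr.{u} L)
    (r : SetRel H.carrier K.carrier) : Prop :=
  PartialEmb H K r ∧ ∀ X : Set H.carrier, X ⊆ r.dom → IsCl H.cl X → IsCl K.cl (r.image X)

/-- A closed embedding of `H` into `K`, that is an `L`-embedding with closed image. -/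
def ClosedEmb {L : FirstOrder.Language.{v, w}} (H K : ClStr.{u} L) (f : H.carrier → K.carrier) : Prop :=
  (∃ e : H.carrier ↪[L] K.carrier, ⇑e = f) ∧ IsCl K.cl (Set.range f)

/-- `G` is a countable closed subset of `H`, or the empty set. -/
def CtblClosedOrEmpty {L : FirstOrder.Language.{v, w}} (H : ClStr.{u} L) (G : Set H.carrier) : Prop :=
  G = ∅ ∨ (G.Countable ∧ IsCl H.cl G)

/-! ### Quasiminimal excellent classes -/

/-- `C` is a quasiminimal excellent class (closed under isomorphism). -/
structure QME {L : FirstOrder.Language.{v, w}} (C : Set (ClStr.{u} L)) : Prop where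
  iso_closed : ∀ H ∈ C, ∀ K, H.Iso K → K ∈ C
  /-- The empty map counts as an isomorphism between empty subsets, so as a partial embedding. -/
  empty_map : ∀ H ∈ C, ∀ K ∈ C, PartialEmb H K ∅
  pregeometry : ∀ H ∈ C, IsPregeometry H.cl
  ccp : ∀ H ∈ C, ∀ X : Set H.carrier, X.Finite → (H.cl X).Countable
  closure_mem : ∀ H ∈ C, ∀ X : Set H.carrier,
    ∃ S : L.Substructure H.carrier, (S : Set H.carrier) = H.cl X ∧ H.sub S ∈ C
  closure_preserved : ∀ H ∈ C, ∀ K ∈ C, ∀ (X : Set H.carrier), ∀ y ∈ H.cl X,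
    ∀ f : SetRel H.carrier K.carrier, PartialEmb H K f → X ⊆ f.dom →
      ∀ z, (y, z) ∈ f → z ∈ K.cl (f.image X)
  /-- Uniqueness of the generic type over countable closed sets and over the empty set. -/
  homogeneity_generic : ∀ H ∈ C, ∀ K ∈ C, ∀ (G : Set H.carrier) (G' : Set K.carrier),
    CtblClosedOrEmpty H G → CtblClosedOrEmpty K G' →
    ∀ g : SetRel H.carrier K.carrier, PartialEmb H K g → g.dom = G → g.cod = G' →
      ∀ x x', x ∉ H.cl G → x' ∉ K.cl G' → PartialEmb H K (g ∪ {(x, x')})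
  /-- `ℵ₀`-homogeneity over countable closed sets and over the empty set. -/
  homogeneity_closure : ∀ H ∈ C, ∀ K ∈ C, ∀ (G : Set H.carrier) (G' : Set K.carrier),
    CtblClosedOrEmpty H G → CtblClosedOrEmpty K G' →
    ∀ g : SetRel H.carrier K.carrier, PartialEmb H K g → g.dom = G → g.cod = G' →
      ∀ f : SetRel H.carrier K.carrier, f.dom.Finite → PartialEmb H K (g ∪ f) →
        ∀ y ∈ H.cl (f.dom ∪ G), ∃ y', PartialEmb H K (g ∪ f ∪ {(y, y')})
  excellence : ∀ H ∈ C, ∀ K ∈ C, ∀ D : Set H.carrier, D.Countable → IsCrown H.cl D →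
    ∀ g : SetRel H.carrier K.carrier, ClosedPartialEmb H K g → g.dom = D →
      ∀ X : Set H.carrier, X.Finite → X ⊆ H.cl D →
        ∃ D₀ : Set H.carrier, D₀.Finite ∧ D₀ ⊆ D ∧
          ∀ f : SetRel H.carrier K.carrier, f.dom = X →
            PartialEmb H K (f ∪ {p ∈ g | p.1 ∈ D₀}) → PartialEmb H K (f ∪ g)

/-- For every uncountable cardinal there is, up to isomorphism, exactly one member of `C` of that
cardinality. -/
def UncountablyCategorical {L : FirstOrder.Language.{v, w}} (C : Set (ClStr.{u} L)) : Prop :=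
  ∀ κ : Cardinal.{u}, ℵ₀ < κ →
    (∃ H ∈ C, #H.carrier = κ) ∧
    ∀ H ∈ C, ∀ K ∈ C, #H.carrier = κ → #K.carrier = κ → Nonempty (H.carrier ≃[L] K.carrier)

/-- `C` is not degenerate: it has an infinite dimensional model and is not a proper subclass of
another quasiminimal excellent class. -/
def Nondegenerate {L : FirstOrder.Language.{v, w}} (C : Set (ClStr.{u} L)) : Prop :=
  (∃ H ∈ C, ∃ κ : Cardinal.{u}, ℵ₀ ≤ κ ∧ HasDim H.cl κ) ∧
  ¬ ∃ D : Set (ClStr.{u} L), QME D ∧ C ⊂ D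

/-! ### The logic with countable conjunctions and the quantifier "there exist uncountably many" -/

/-- Formulas of `L_{ω₁,ω}(Q)` with free variables `x_0, …, x_{n-1}`. -/
inductive LQ (L : FirstOrder.Language.{v, w}) : ℕ → Type (max v w)
  | falsum {n : ℕ} : LQ L n
  | equal {n : ℕ} (s t : L.Term (Fin n)) : LQ L n
  | rel {n k : ℕ} (R : L.Relations k) (t : Fin k → L.Term (Fin n)) : LQ L n
  | neg {n : ℕ} (φ : LQ L n) : LQ L n
  | conj {n : ℕ} (φ : ℕ → LQ L n) : LQ L n
  | all {n : ℕ} (φ : LQ L (n + 1)) : LQ L n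
  | unc {n : ℕ} (φ : LQ L (n + 1)) : LQ L n

namespace LQ

variable {L : FirstOrder.Language.{v, w}}

/-- Satisfaction; a quantifier in a formula with `n` free variables binds the variable `x_n`. -/
def Realize (M : Type u) [L.Structure M] : {n : ℕ} → LQ L n → (Fin n → M) → Prop
  | _, falsum, _ => False
  | _, equal s t, a => s.realize a = t.realize a
  | _, rel R t, a => FirstOrder.Language.Structure.RelMap R (fun i => (t i).realize a)
  | _, neg φ, a => ¬ φ.Realize M a
  | _, conj φ, a => ∀ i, (φ i).Realize M a
  | _, all φ, a => ∀ x : M, φ.Realize M (Fin.snoc a x)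
  | _, unc φ, a => ¬ {x : M | φ.Realize M (Fin.snoc a x)}.Countable

/-- The formula is in `L_{ω₁,ω}`: the quantifier `Q` does not occur. -/
def NoUnc : {n : ℕ} → LQ L n → Prop
  | _, falsum => True
  | _, equal _ _ => True
  | _, rel _ _ => True
  | _, neg φ => φ.NoUnc
  | _, conj φ => ∀ i, (φ i).NoUnc
  | _, all φ => φ.NoUnc
  | _, unc _ => False

/-- The formula is a quantifier-free formula of `L_{ω₁,ω}`. -/
def QF : {n : ℕ} → LQ L n → Prop
  | _, falsum => True
  | _, equal _ _ => True
  | _, rel _ _ => True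
  | _, neg φ => φ.QF
  | _, conj φ => ∀ i, (φ i).QF
  | _, all _ => False
  | _, unc _ => False

/-- `φ ∧ ψ` -/
def and {n : ℕ} (φ ψ : LQ L n) : LQ L n := conj (fun i => if i = 0 then φ else ψ)

/-- `⋁ᵢ φᵢ` -/
def disj {n : ℕ} (φ : ℕ → LQ L n) : LQ L n := neg (conj (fun i => neg (φ i)))

/-- `φ ∨ ψ` -/
def or {n : ℕ} (φ ψ : LQ L n) : LQ L n := neg (and (neg φ) (neg ψ))

/-- The universal closure of a formula. -/
def univClosure : {n : ℕ} → LQ L n → LQ L 0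
  | 0, φ => φ
  | _ + 1, φ => (all φ).univClosure

/-- `σ` is a Scott sentence of `M`: a sentence of `L_{ω₁,ω}` whose countable models are exactly the
countable structures isomorphic to `M`. -/
def IsScottSentence (σ : LQ L 0) (M : Type u) [L.Structure M] : Prop :=
  σ.NoUnc ∧ ∀ (N : Type u) [L.Structure N], Countable N →
    (σ.Realize N Fin.elim0 ↔ Nonempty (N ≃[L] M))

/-- The sentence `[σ_ω ∨ ⋁_n σ_n] ∧ ⋀_n ∀ y_0 … y_{n-1} ¬ Q x π_n(y_0, …, y_{n-1}, x)`. -/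
def scottForm (σω : LQ L 0) (σ : ℕ → LQ L 0) (π : ∀ n, LQ L (n + 1)) : LQ L 0 :=
  and (or σω (disj σ)) (conj (fun n => (neg (unc (π n))).univClosure))

end LQ

/-- The quasiminimal excellent class `C` is defined by a sentence of `L_{ω₁,ω}(Q)` of the specific
form `[⋁_{n ≤ ω} σ_n] ∧ ⋀_n ∀ y_0 … y_{n-1} ¬ Q x π_n(y_0, …, y_{n-1}, x)`, where `σ_n` is a Scott
sentence of the model of dimension `n` and the quantifier-free `L_{ω₁,ω}`-formula `π_n` defines the
closure of `n` points. -/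
def ScottDefinable {L : FirstOrder.Language.{v, w}} (C : Set (ClStr.{u} L)) : Prop :=
  ∃ (σω : LQ L 0) (σ : ℕ → LQ L 0) (π : ∀ n, LQ L (n + 1)),
    (∃ M ∈ C, HasDim M.cl ℵ₀ ∧ σω.IsScottSentence M.carrier) ∧
    (∀ n : ℕ, ∃ M ∈ C, HasDim M.cl n ∧ (σ n).IsScottSentence M.carrier) ∧
    (∀ n, (π n).QF) ∧
    (∀ H ∈ C, ∀ (n : ℕ) (b : Fin n → H.carrier) (a : H.carrier),
      a ∈ H.cl (Set.range b) ↔ (π n).Realize H.carrier (Fin.snoc b a)) ∧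
    ∀ H : ClStr.{u} L, H ∈ C ↔
      (LQ.scottForm σω σ π).Realize H.carrier Fin.elim0 ∧
      ∀ (X : Set H.carrier) (a : H.carrier), a ∈ H.cl X ↔
        ∃ (n : ℕ) (b : Fin n → H.carrier), (∀ i, b i ∈ X) ∧
          (π n).Realize H.carrier (Fin.snoc b a)

/-- The reduct map along `φ` is an isomorphism of categories from `C` (with closed embeddings) onto
the class of reducts of members of `C`: it is injective on objects, and it has the same closed
embeddings. -/
def ReductIso {L₀ : FirstOrder.Language.{v', w'}} {L : FirstOrder.Language.{v, w}} (φ : L₀ →ᴸ L)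
    (C : Set (ClStr.{u} L)) : Prop :=
  Set.InjOn (ClStr.reduct φ) C ∧
  ∀ H ∈ C, ∀ K ∈ C, ∀ f : H.carrier → K.carrier,
    ClosedEmb (H.reduct φ) (K.reduct φ) f ↔ ClosedEmb H K f

end QMEC

open QMEC

namespace QMEC

open FirstOrder Language

/-! ### Atomic types and partial embeddings -/

section PartialEmbeddings

variable {L : FirstOrder.Language.{v, w}}

/-! The main fact is categoricity in every dimension: a bijection between bases of two members
extends to an isomorphism (`QME.iso_of_bases`). For countable bases this is back-and-forth along
finite-dimensional closed sets. For an uncountable basis B, fix a countably infinite B₀ ⊆ B and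
consider partial embeddings glued from maps on the sets cl(B₀ ∪ X) with X ⊆ B finite. Zorn's lemma
gives a maximal one, r. If r fails to cover some X but covers all proper subsets of X, then finitely
many pieces of r form a map of a countable crown, and excellence extends it to cl(B₀ ∪ X). A single
extension f to cl(B₀ ∪ X) is compatible with all of r: a finite tuple can be moved into cl(B₀ ∪ X)
by a partial embedding that shifts the superfluous basis points into B₀ (`Homogeneous.exists_shift`,
`Homogeneous.sameAtomic_amalgam`).

For the enlargement of C, take the class `localClass C` of all structures whose finite-dimensional
closed subsets are copies of members of C. The axioms collected in `Homogeneous` concern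
finite-dimensional pieces only, so they pass to the local class, and they suffice for categoricity
in countable dimensions. If C has a member of dimension ℵ₀, countable-dimensional closed sets in the
local class are therefore copies of members of C, and the axioms about countable closed sets
transfer as well, excellence among them. The local class is closed under unions of chains, and its
infinite-dimensional members embed properly into themselves as closed substructures, so Zorn's lemma
produces members of every uncountable cardinality. Since dimension equals cardinality in uncountable
structures, the local class has all dimensions and is uncountably categorical. By categoricity a
class with all dimensions is maximal, and every quasiminimal excellent class above C lies inside the
local class. This gives uniqueness, and a nondegenerate C equals its local class.

For definability, every finite tuple in a member has the same atomic type as a tuple in the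
countable member M of dimension ℵ₀. Hence countably many atomic types describe the closure
operators, and back-and-forth conditions for atomic types give Scott sentences. A model of Σ matches
M or a finite-dimensional member on finite tuples; as its finite sets have countable closures,
back-and-forth identifies these closures with closed subsets of that member, so the model is in
`localClass C = C`. In an arbitrary language, countably many symbols already separate the atomic
types in M, hence in all members. -/

/-- The tuples `a` and `b` satisfy the same atomic formulas. -/
def SameAtomic (L : FirstOrder.Language.{v, w}) {M N : Type*} [L.Structure M] [L.Structure N]
    {ι : Type*} (a : ι → M) (b : ι → N) : Prop :=
  (∀ s t : L.Term ι, s.realize a = t.realize a ↔ s.realize b = t.realize b) ∧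
  ∀ (k : ℕ) (R : L.Relations k) (t : Fin k → L.Term ι),
    Structure.RelMap R (fun i => (t i).realize a) ↔ Structure.RelMap R (fun i => (t i).realize b)

namespace SameAtomic

variable {M N P : Type*} [L.Structure M] [L.Structure N] [L.Structure P] {ι κ : Type*}

theorem refl (a : ι → M) : SameAtomic L a a := ⟨fun _ _ => Iff.rfl, fun _ _ _ => Iff.rfl⟩

theorem symm {a : ι → M} {b : ι → N} (h : SameAtomic L a b) : SameAtomic L b a :=
  ⟨fun s t => (h.1 s t).symm, fun k R t => (h.2 k R t).symm⟩

theorem trans {a : ι → M} {b : ι → N} {c : ι → P} (h : SameAtomic L a b)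
    (h' : SameAtomic L b c) : SameAtomic L a c :=
  ⟨fun s t => (h.1 s t).trans (h'.1 s t), fun k R t => (h.2 k R t).trans (h'.2 k R t)⟩

theorem comp {a : ι → M} {b : ι → N} (h : SameAtomic L a b) (e : κ → ι) :
    SameAtomic L (a ∘ e) (b ∘ e) := by
  refine ⟨fun s t => ?_, fun k R t => ?_⟩
  · simpa only [Term.realize_relabel] using h.1 (s.relabel e) (t.relabel e)
  · simpa only [Term.realize_relabel] using h.2 k R (fun i => (t i).relabel e)

theorem of_embedding (f : M ↪[L] N) (a : ι → M) : SameAtomic L a (f ∘ a) := by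
  refine ⟨fun s t => ?_, fun k R t => ?_⟩
  · simp only [HomClass.realize_term, f.injective.eq_iff]
  · simp only [HomClass.realize_term]
    exact (f.map_rel R _).symm

/-- The number of bound variables is kept as `n` with an equation `n = 0`, so that induction on
`IsQF` applies; terms with extra variables in `Fin 0` are relabelled to terms in `ι`. -/
theorem realize_isQF {n : ℕ} {a : ι → M} {b : ι → N} (h : SameAtomic L a b)
    {φ : L.BoundedFormula ι n} (hφ : φ.IsQF) (hn : n = 0) (x : Fin n → M) (y : Fin n → N) :
    φ.Realize a x ↔ φ.Realize b y := by
  subst hn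
  have key : ∀ t : L.Term (ι ⊕ Fin 0), ∃ t' : L.Term ι,
      t.realize (Sum.elim a x) = t'.realize a ∧ t.realize (Sum.elim b y) = t'.realize b := by
    intro t
    refine ⟨t.relabel (Sum.elim id Fin.elim0), ?_, ?_⟩ <;> rw [Term.realize_relabel] <;>
    · congr 1
      funext i
      rcases i with i | i
      · rfl
      · exact i.elim0
  induction hφ with
  | falsum => exact Iff.rfl
  | of_isAtomic hat =>
    cases hat with
    | equal s t =>
      obtain ⟨s', hs, hs'⟩ := key s
      obtain ⟨t', ht, ht'⟩ := key t
      simp only [BoundedFormula.realize_bdEqual, hs, ht, hs', ht', h.1]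
    | rel R ts =>
      choose t' h1 h2 using fun i => key (ts i)
      simp only [BoundedFormula.realize_rel, h1, h2]
      exact h.2 _ R t'
  | imp _ _ h1 h2 => simp only [BoundedFormula.realize_imp, h1, h2]

theorem realize_formula {a : ι → M} {b : ι → N} (h : SameAtomic L a b)
    {φ : L.Formula ι} (hφ : φ.IsQF) : φ.Realize a ↔ φ.Realize b :=
  h.realize_isQF hφ rfl _ _

theorem of_formula {a : ι → M} {b : ι → N}
    (h : ∀ φ : L.Formula ι, φ.IsQF → (φ.Realize a ↔ φ.Realize b)) : SameAtomic L a b := by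
  refine ⟨fun s t => ?_, fun k R t => ?_⟩
  · simpa using h (s.equal t) (BoundedFormula.IsAtomic.equal _ _).isQF
  · simpa [Formula.realize_rel] using h (R.formula t) (BoundedFormula.IsAtomic.rel _ _).isQF

theorem eq_iff {a : ι → M} {b : ι → N} (h : SameAtomic L a b) (i j : ι) :
    a i = a j ↔ b i = b j := h.1 (Term.var i) (Term.var j)

end SameAtomic

theorem partialEmb_iff {H K : ClStr.{u} L} {r : SetRel H.carrier K.carrier} :
    PartialEmb H K r ↔ ∀ (n : ℕ) (p : Fin n → H.carrier × K.carrier), (∀ i, p i ∈ r) →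
      SameAtomic L (fun i => (p i).1) (fun i => (p i).2) :=
  ⟨fun h n p hp => .of_formula (h n p hp), fun h n p hp _ hφ => (h n p hp).realize_formula hφ⟩

namespace PartialEmb

variable {H K N : ClStr.{u} L} {r s : SetRel H.carrier K.carrier}

theorem sameAtomic {ι : Type*} [Finite ι] (h : PartialEmb H K r) {a : ι → H.carrier}
    {b : ι → K.carrier} (hp : ∀ i, (a i, b i) ∈ r) : SameAtomic L a b := by
  obtain ⟨n, ⟨e⟩⟩ := Finite.exists_equiv_fin ι
  have := (partialEmb_iff.1 h n (fun i => (a (e.symm i), b (e.symm i))) (fun i => hp _)).comp e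
  simpa [Function.comp_def] using this

theorem mono (h : PartialEmb H K s) (hr : r ⊆ s) : PartialEmb H K r :=
  fun n p hp => h n p (fun i => hr (hp i))

theorem inv (h : PartialEmb H K r) : PartialEmb K H r.inv := by
  refine partialEmb_iff.2 fun n p hp => ?_
  exact (h.sameAtomic (a := fun i => (p i).2) (b := fun i => (p i).1) hp).symm

theorem comp (h : PartialEmb H K r) {t : SetRel K.carrier N.carrier} (h' : PartialEmb K N t) :
    PartialEmb H N (r.comp t) := by
  refine partialEmb_iff.2 fun n p hp => ?_
  choose b hb hb' using hp
  exact (h.sameAtomic hb).trans (h'.sameAtomic hb')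

theorem right_unique (h : PartialEmb H K r) {x : H.carrier} {y z : K.carrier} (hy : (x, y) ∈ r)
    (hz : (x, z) ∈ r) : y = z := by
  have := h.sameAtomic (ι := Bool) (a := fun _ => x) (b := fun i => cond i y z)
    (by rintro (_ | _) <;> assumption)
  exact (this.eq_iff true false).1 rfl

theorem left_unique (h : PartialEmb H K r) {x z : H.carrier} {y : K.carrier} (hx : (x, y) ∈ r)
    (hz : (z, y) ∈ r) : x = z := h.inv.right_unique hx hz

/-- Being a partial embedding is a condition on finite tuples of pairs. All the unions below, along
sequences and along Zorn chains, rest on this. -/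
theorem of_finite_subsets (h : ∀ t : SetRel H.carrier K.carrier, t.Finite → t ⊆ r →
    PartialEmb H K t) : PartialEmb H K r := by
  intro n p hp
  exact h (Set.range p) (Set.finite_range p) (by rintro _ ⟨i, rfl⟩; exact hp i) n p
    (fun i => ⟨i, rfl⟩)

theorem sUnion {c : Set (SetRel H.carrier K.carrier)} (hc : DirectedOn (· ⊆ ·) c)
    (hne : c.Nonempty) (h : ∀ r ∈ c, PartialEmb H K r) : PartialEmb H K (⋃₀ c) := by
  refine of_finite_subsets fun t ht htc => ?_
  obtain ⟨r, hr, htr⟩ := DirectedOn.exists_mem_subset_of_finset_subset_biUnion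
    (s := ht.toFinset) (f := id) hne hc (by
      simpa [Set.sUnion_eq_biUnion] using htc)
  exact (h r hr).mono (by simpa using htr)

theorem iUnion_nat {c : ℕ → SetRel H.carrier K.carrier} (hc : Monotone c)
    (h : ∀ n, PartialEmb H K (c n)) : PartialEmb H K (⋃ n, c n) := by
  have := PartialEmb.sUnion (H := H) (K := K) (c := Set.range c)
    (by
      rintro _ ⟨i, rfl⟩ _ ⟨j, rfl⟩
      exact ⟨c (max i j), ⟨_, rfl⟩, hc (le_max_left _ _), hc (le_max_right _ _)⟩)
    ⟨_, 0, rfl⟩ (by rintro _ ⟨n, rfl⟩; exact h n)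
  rwa [Set.sUnion_range] at this

theorem id_rel (H : ClStr.{u} L) (S : Set H.carrier) :
    PartialEmb H H {p | p.1 ∈ S ∧ p.1 = p.2} := by
  refine partialEmb_iff.2 fun n p hp => ?_
  have : (fun i => (p i).2) = fun i => (p i).1 := funext fun i => ((hp i).2).symm
  rw [this]
  exact .refl _

/-- Partial embeddings can be computed in extensions of the two structures. -/
theorem map_iff {H₀ K₀ : ClStr.{u} L} (i : H₀.carrier ↪[L] H.carrier)
    (j : K₀.carrier ↪[L] K.carrier) {r : SetRel H₀.carrier K₀.carrier} :
    PartialEmb H K (Prod.map i j '' r) ↔ PartialEmb H₀ K₀ r := by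
  constructor
  · intro h
    refine partialEmb_iff.2 fun n p hp => ?_
    have h1 := h.sameAtomic (a := i ∘ fun k => (p k).1) (b := j ∘ fun k => (p k).2)
      (fun k => ⟨p k, hp k, rfl⟩)
    exact ((SameAtomic.of_embedding i _).trans h1).trans (SameAtomic.of_embedding j _).symm
  · intro h
    refine partialEmb_iff.2 fun n p hp => ?_
    choose q hq hq' using hp
    have h1 := h.sameAtomic (a := fun k => (q k).1) (b := fun k => (q k).2) hq
    have h2 := ((SameAtomic.of_embedding i _).symm.trans h1).trans (SameAtomic.of_embedding j _)
    have e1 : (fun k => (p k).1) = i ∘ fun k => (q k).1 := by funext k; simp [← hq']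
    have e2 : (fun k => (p k).2) = j ∘ fun k => (q k).2 := by funext k; simp [← hq']
    rw [e1, e2]
    exact h2

theorem graph (f : H.carrier ↪[L] K.carrier) : PartialEmb H K {p | f p.1 = p.2} := by
  refine partialEmb_iff.2 fun n p hp => ?_
  have : (fun i => (p i).2) = f ∘ fun i => (p i).1 := funext fun i => (hp i).symm
  rw [this]
  exact .of_embedding f _

/-- A partial embedding with full domain is an embedding. -/
theorem exists_embedding (h : PartialEmb H K r) (hd : r.dom = Set.univ) :
    ∃ f : H.carrier ↪[L] K.carrier, ∀ x, (x, f x) ∈ r := by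
  have : ∀ x, ∃ y, (x, y) ∈ r := fun x => by
    have : x ∈ r.dom := hd ▸ Set.mem_univ x
    exact this
  choose f hf using this
  refine ⟨⟨⟨f, fun x y hxy => h.left_unique (hf x) (hxy ▸ hf y)⟩, ?_, ?_⟩, hf⟩
  · intro n g x
    -- The tuple of arguments is extended by the value of the function at it, so that preservation
    -- of one equation expresses compatibility with the function symbol.
    have := h.sameAtomic (ι := Option (Fin n)) (a := fun o => o.elim (Structure.funMap g x) x)
      (b := fun o => o.elim (f (Structure.funMap g x)) (f ∘ x)) (by rintro (_ | i) <;> exact hf _)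
    exact (this.1 (Term.var none) (Term.func g fun i => Term.var (some i))).1 rfl
  · intro n R x
    have := h.sameAtomic (a := x) (b := f ∘ x) (fun i => hf _)
    exact (this.2 n R (fun i => Term.var i)).symm

theorem exists_equiv (h : PartialEmb H K r) (hd : r.dom = Set.univ) (hc : r.cod = Set.univ) :
    ∃ e : H.carrier ≃[L] K.carrier, ∀ x, (x, e x) ∈ r := by
  obtain ⟨f, hf⟩ := h.exists_embedding hd
  have hs : Function.Surjective f := fun y => by
    have : y ∈ r.cod := hc ▸ Set.mem_univ y
    obtain ⟨x, hx⟩ := this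
    exact ⟨x, h.right_unique (hf x) hx⟩
  refine ⟨⟨Equiv.ofBijective f ⟨f.injective, hs⟩, fun g x => f.map_fun g x,
    fun R x => f.map_rel R x⟩, hf⟩

end PartialEmb

end PartialEmbeddings


/-! ### Pregeometries -/

section Pregeometries

namespace IsPregeometry

variable {M : Type u} {cl : Set M → Set M} (h : IsPregeometry cl)
include h

theorem cl_subset {X Y : Set M} (hX : X ⊆ cl Y) : cl X ⊆ cl Y :=
  (h.mono _ _ hX).trans (h.idem Y).subset

theorem cl_subset_of_isCl {X Y : Set M} (hY : IsCl cl Y) (hX : X ⊆ Y) : cl X ⊆ Y :=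
  (h.mono _ _ hX).trans hY.subset

theorem isCl_of_subset {X : Set M} (hX : cl X ⊆ X) : IsCl cl X := hX.antisymm (h.subset_cl X)

theorem countable_cl (hf : ∀ X : Set M, X.Finite → (cl X).Countable) {X : Set M}
    (hX : X.Countable) : (cl X).Countable := by
  refine ((Set.countable_ofPred_finite_subset hX).biUnion
    (t := fun Y _ => cl Y) (fun Y hY => hf Y hY.1)).mono fun a ha => ?_
  obtain ⟨Y, hY, hYX, haY⟩ := h.finite_char X a ha
  exact Set.mem_biUnion (show Y ∈ {t | t.Finite ∧ t ⊆ X} from ⟨hY, hYX⟩) haY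

theorem exists_finite_support {X F : Set M} (hF : F.Finite) (hFX : F ⊆ cl X) :
    ∃ Y : Set M, Y.Finite ∧ Y ⊆ X ∧ F ⊆ cl Y := by
  induction F, hF using Set.Finite.induction_on with
  | empty => exact ⟨∅, Set.finite_empty, Set.empty_subset _, Set.empty_subset _⟩
  | @insert a F _ _ ih =>
    obtain ⟨Y, hY, hYX, hFY⟩ := ih ((Set.subset_insert _ _).trans hFX)
    obtain ⟨Z, hZ, hZX, haZ⟩ := h.finite_char X a (hFX (Set.mem_insert _ _))
    refine ⟨Y ∪ Z, hY.union hZ, Set.union_subset hYX hZX, Set.insert_subset ?_ ?_⟩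
    · exact h.mono _ _ Set.subset_union_right haZ
    · exact hFY.trans (h.mono _ _ Set.subset_union_left)

end IsPregeometry

theorem Indep.subset {M : Type u} {cl : Set M → Set M} (h : IsPregeometry cl) {B I : Set M}
    (hB : Indep cl B) (hI : I ⊆ B) : Indep cl I :=
  fun b hb hb' => hB b (hI hb) (h.mono _ _ (Set.sdiff_subset_sdiff_left hI) hb')

theorem Indep.notMem_cl {M : Type u} {cl : Set M → Set M} (h : IsPregeometry cl) {B I : Set M}
    (hB : Indep cl B) (hI : I ⊆ B) {b : M} (hb : b ∈ B) (hbI : b ∉ I) : b ∉ cl I :=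
  fun hb' => hB b hb (h.mono I (B \ {b}) (fun _ hx => ⟨hI hx, fun e => hbI (e ▸ hx)⟩) hb')

theorem Indep.insert {M : Type u} {cl : Set M → Set M} (h : IsPregeometry cl) {B : Set M}
    (hB : Indep cl B) {x : M} (hx : x ∉ cl B) : Indep cl (insert x B) := by
  have hxB : x ∉ B := fun hxB => hx (h.subset_cl _ hxB)
  rintro b (rfl | hb) hb'
  · refine hx (h.mono _ _ ?_ hb')
    rintro y ⟨rfl | hy, hy'⟩
    · exact (hy' rfl).elim
    · exact hy
  · have hbx : x ≠ b := fun e => hxB (e ▸ hb)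
    have e : Insert.insert x B \ {b} = Insert.insert x (B \ {b}) := by
      ext y
      simp only [Set.mem_sdiff, Set.mem_insert_iff, Set.mem_singleton_iff]
      constructor
      · rintro ⟨rfl | hy, hy'⟩
        · exact Or.inl rfl
        · exact Or.inr ⟨hy, hy'⟩
      · rintro (rfl | ⟨hy, hy'⟩)
        · exact ⟨Or.inl rfl, hbx⟩
        · exact ⟨Or.inr hy, hy'⟩
    rw [e] at hb'
    have := h.exchange _ _ _ hb' (hB b hb)
    rw [Set.insert_sdiff_singleton, Set.insert_eq_of_mem hb] at this
    exact hx this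

/-- Closures of subsets of an independent set meet only in the closure of the intersection. If a
point a of cl F really needed some t ∈ E \ F, exchange would put t in the closure of a, F and other
points of E, so independence of t would fail. -/
theorem Indep.cl_inter {M : Type u} {cl : Set M → Set M} (h : IsPregeometry cl) {B E F : Set M}
    (hB : Indep cl B) (hE : E ⊆ B) (hF : F ⊆ B) : cl E ∩ cl F ⊆ cl (E ∩ F) := by
  have key : ∀ T : Set M, T.Finite → T ⊆ B → (∀ t ∈ T, t ∉ F) → ∀ a,
      a ∈ cl (T ∪ (E ∩ F)) → a ∈ cl F → a ∈ cl (E ∩ F) := by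
    intro T hT
    induction T, hT using Set.Finite.induction_on with
    | empty => intro _ _ a ha _; simpa using ha
    | @insert t T htT _ ih =>
      intro hTB hTF a ha haF
      by_contra hcon
      have h1 : a ∉ cl (T ∪ (E ∩ F)) := fun h1 =>
        hcon (ih ((Set.subset_insert _ _).trans hTB)
          (fun s hs => hTF s (Set.mem_insert_of_mem _ hs)) a h1 haF)
      rw [Set.insert_union] at ha
      have h2 := h.exchange _ _ _ ha h1
      refine Indep.notMem_cl h hB (I := T ∪ F)
        (Set.union_subset ((Set.subset_insert _ _).trans hTB) hF)
        (hTB (Set.mem_insert _ _)) ?_ (h.cl_subset ?_ h2)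
      · rintro (h3 | h3)
        · exact htT h3
        · exact hTF t (Set.mem_insert _ _) h3
      · refine Set.insert_subset (h.mono _ _ Set.subset_union_right haF) ?_
        refine subset_trans ?_ (h.subset_cl _)
        exact Set.union_subset_union_right _ Set.inter_subset_right
  rintro a ⟨haE, haF⟩
  obtain ⟨Y, hY, hYE, haY⟩ := h.finite_char _ _ haE
  refine key (Y \ F) hY.sdiff (Set.sdiff_subset.trans (hYE.trans hE)) (fun t ht => ht.2) a
    (h.mono _ _ (fun y hy => ?_) haY) haF
  by_cases hyF : y ∈ F
  · exact Or.inr ⟨hYE hy, hyF⟩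
  · exact Or.inl ⟨hy, hyF⟩

/-- An independent subset of `X` extends to a basis of `cl X` inside `X`. -/
theorem Indep.exists_basis {M : Type u} {cl : Set M → Set M} (h : IsPregeometry cl)
    {I X : Set M} (hI : Indep cl I) (hIX : I ⊆ X) :
    ∃ B, I ⊆ B ∧ B ⊆ X ∧ Indep cl B ∧ cl B = cl X := by
  obtain ⟨B, hIB, hB⟩ := zorn_subset_nonempty {B | B ⊆ X ∧ Indep cl B} (by
    intro c hc hchain hne
    refine ⟨⋃₀ c, ⟨Set.sUnion_subset fun s hs => (hc hs).1, ?_⟩, fun s hs =>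
      Set.subset_sUnion_of_mem hs⟩
    rintro b ⟨s, hs, hbs⟩ hb
    obtain ⟨Y, hY, hYc, hbY⟩ := h.finite_char _ _ hb
    obtain ⟨t, ht, hYt⟩ := DirectedOn.exists_mem_subset_of_finset_subset_biUnion
      (s := hY.toFinset) (f := id) hne hchain.directedOn (by
        have : Y ⊆ ⋃₀ c := hYc.trans Set.sdiff_subset
        simpa [Set.sUnion_eq_biUnion] using this)
    have hYt : Y ⊆ t := by simpa using hYt
    obtain ⟨r, hr, hsr, htr⟩ := hchain.directedOn s hs t ht
    refine (hc hr).2 b (hsr hbs) (h.mono Y (r \ {b}) (fun y hy => ⟨htr (hYt hy), (hYc hy).2⟩) hbY))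
    I ⟨hIX, hI⟩
  refine ⟨B, hIB, hB.prop.1, hB.prop.2, (h.mono _ _ hB.prop.1).antisymm (h.cl_subset ?_)⟩
  intro x hx
  by_contra hxB
  have := hB.le_of_ge (y := Insert.insert x B)
    ⟨Set.insert_subset hx hB.prop.1, hB.prop.2.insert h hxB⟩ (Set.subset_insert _ _)
  exact hxB (h.subset_cl _ (this (Set.mem_insert _ _)))

theorem indep_empty {M : Type u} (cl : Set M → Set M) : Indep cl ∅ := fun _ hb => hb.elim

/-- Steinitz: an independent set in the closure of `n` points has at most `n` elements. -/
theorem Indep.card_le {M : Type u} {cl : Set M → Set M} (h : IsPregeometry cl) {I F : Finset M}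
    (hI : Indep cl (I : Set M)) (hIF : (I : Set M) ⊆ cl F) : I.card ≤ F.card := by
  classical
  -- Independence is relativized to a set `Z`, so that in the induction a point removed from `F` can
  -- be absorbed into `Z`.
  have key : ∀ F : Finset M, ∀ (Z : Set M) (I : Finset M),
      (∀ b ∈ I, b ∉ cl (Z ∪ ((I : Set M) \ {b}))) → (I : Set M) ⊆ cl (Z ∪ F) →
      I.card ≤ F.card := by
    intro F
    induction F using Finset.induction_on with
    | empty =>
      intro Z I hI hIF
      rcases I.eq_empty_or_nonempty with rfl | ⟨b, hb⟩
      · rfl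
      · refine (hI b hb (h.mono _ _ Set.subset_union_left ?_)).elim
        simpa using hIF hb
    | @insert f F hf ih =>
      intro Z I hI hIF
      rw [Finset.card_insert_of_notMem hf]
      have hset : Z ∪ ((Insert.insert f F : Finset M) : Set M) = Insert.insert f Z ∪ F := by
        rw [Finset.coe_insert, Set.union_insert, Set.insert_union]
      rw [hset] at hIF
      by_cases hI' : ∀ b ∈ I, b ∉ cl (Insert.insert f Z ∪ ((I : Set M) \ {b}))
      · exact (ih _ I hI' hIF).trans (Nat.le_succ _)
      · push Not at hI'
        obtain ⟨b, hb, hb'⟩ := hI'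
        rw [← Finset.card_erase_add_one hb]
        -- Adding `f` to `Z` makes `b` depend on the rest of `I`. Dropping `b` restores independence
        -- over `f`: any further dependence would, by exchange, put `f` in the closure of `Z` and `I
        -- \ {b}`, and then `b` as well.
        refine Nat.succ_le_succ (ih (Insert.insert f Z) (I.erase b) ?_ ?_)
        · intro c hc hc'
          have hcb : c ≠ b := Finset.ne_of_mem_erase hc
          have hcI : c ∈ I := Finset.mem_of_mem_erase hc
          rw [Set.insert_union] at hc' hb'
          have h1 : c ∉ cl (Z ∪ ((I.erase b : Finset M) : Set M) \ {c}) := fun h1 =>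
            hI c hcI (h.mono _ _ (Set.union_subset_union_right _ (by
              intro y hy
              exact ⟨Finset.mem_of_mem_erase hy.1, hy.2⟩)) h1)
          have h2 := h.exchange _ _ _ hc' h1
          refine hI b hb (h.cl_subset (Set.insert_subset ?_ (h.subset_cl _)) hb')
          refine h.mono _ _ (Set.insert_subset (Or.inr ⟨hcI, hcb⟩)
            (Set.union_subset_union_right _ ?_)) h2
          intro y hy
          exact ⟨Finset.mem_of_mem_erase hy.1, Finset.ne_of_mem_erase hy.1⟩
        · exact fun y hy => hIF (Finset.mem_of_mem_erase hy)
  exact key F ∅ I (fun b hb => by simpa using hI b hb) (by simpa using hIF)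

theorem mk_cl_le {M : Type u} {cl : Set M → Set M} (h : IsPregeometry cl)
    (hf : ∀ X : Set M, X.Finite → (cl X).Countable) (B : Set M) : #(cl B) ≤ max ℵ₀ #B := by
  have : cl B ⊆ ⋃ F : Finset B, cl (Subtype.val '' (F : Set B)) := by
    intro a ha
    obtain ⟨Y, hY, hYB, haY⟩ := h.finite_char _ _ ha
    lift Y to Set B using hYB
    have hY' : Y.Finite := Set.Finite.of_finite_image hY Subtype.val_injective.injOn
    exact Set.mem_iUnion.2 ⟨hY'.toFinset, by simpa using haY⟩
  refine (Cardinal.mk_le_mk_of_subset this).trans ((Cardinal.mk_iUnion_le _).trans ?_)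
  have h1 : #(Finset B) ≤ max ℵ₀ #B := by
    rcases finite_or_infinite B with hB | hB
    · exact (Cardinal.mk_lt_aleph0 (α := Finset B)).le.trans (le_max_left _ _)
    · rw [Cardinal.mk_finset_of_infinite]
      exact le_max_right _ _
  refine (mul_le_mul' h1 (ciSup_le' fun F => ?_)).trans
    (Cardinal.mul_le_max_of_aleph0_le_left (le_max_left _ _) |>.trans
      (max_le le_rfl (le_max_left ℵ₀ #B)))
  exact (Set.Countable.le_aleph0 (hf _ (F.finite_toSet.image _)))

/-- Closures of finite sets are countable, so a spanning set B gives at most max(ℵ₀, #B) points.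
This identifies dimension with cardinality in uncountable structures. -/
theorem mk_basis_eq {M : Type u} {cl : Set M → Set M} (h : IsPregeometry cl)
    (hf : ∀ X : Set M, X.Finite → (cl X).Countable) {B : Set M} (hB : cl B = Set.univ)
    (hM : ℵ₀ < #M) : #B = #M := by
  refine (Cardinal.mk_set_le B).antisymm ?_
  have := mk_cl_le h hf B
  rw [hB, Cardinal.mk_univ] at this
  rcases le_max_iff.1 this with h1 | h1
  · exact (hM.not_ge h1).elim
  · exact h1

end Pregeometries


/-! ### Back-and-forth -/

section BackAndForth

theorem SetRel.dom_union' {α β : Type*} (r s : SetRel α β) :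
    SetRel.dom (r ∪ s) = r.dom ∪ s.dom := by
  ext x; simp [SetRel.mem_dom, exists_or]

theorem SetRel.cod_union' {α β : Type*} (r s : SetRel α β) :
    SetRel.cod (r ∪ s) = r.cod ∪ s.cod := by
  ext x; simp [SetRel.mem_cod, exists_or]

theorem SetRel.dom_singleton {α β : Type*} (a : α) (b : β) :
    SetRel.dom {(a, b)} = {a} := by
  ext x; simp [SetRel.mem_dom]

theorem SetRel.cod_singleton {α β : Type*} (a : α) (b : β) :
    SetRel.cod {(a, b)} = {b} := by
  ext x; simp [SetRel.mem_cod]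

theorem SetRel.dom_finite {α β : Type*} {r : SetRel α β} (h : r.Finite) : r.dom.Finite :=
  (h.image Prod.fst).subset fun x ⟨y, hy⟩ => ⟨(x, y), hy, rfl⟩

theorem SetRel.cod_finite {α β : Type*} {r : SetRel α β} (h : r.Finite) : r.cod.Finite :=
  (h.image Prod.snd).subset fun x ⟨y, hy⟩ => ⟨(y, x), hy, rfl⟩

/-- Number the tasks, the points of `S` to enter the domain and the points of `T` to enter the
codomain, by an injection into ℕ; stage n performs the task with number n, if there is one. -/
theorem exists_back_and_forth {α β : Type*} {S : Set α} {T : Set β} (hS : S.Countable)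
    (hT : T.Countable) (P : SetRel α β → Prop) (c₀ : SetRel α β) (h₀ : P c₀)
    (forth : ∀ c, P c → ∀ x ∈ S, ∃ y, P (c ∪ {(x, y)}))
    (back : ∀ c, P c → ∀ y ∈ T, ∃ x, P (c ∪ {(x, y)})) :
    ∃ c : ℕ → SetRel α β, Monotone c ∧ c 0 = c₀ ∧ (∀ n, P (c n)) ∧
      S ⊆ SetRel.dom (⋃ n, c n) ∧ T ⊆ SetRel.cod (⋃ n, c n) := by
  have := hS.to_subtype
  have := hT.to_subtype
  obtain ⟨e, he⟩ := exists_injective_nat (S ⊕ T)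
  have step : ∀ (n : ℕ) (c : {c // P c}), ∃ c' : {c // P c}, c.1 ⊆ c'.1 ∧
      (∀ x : S, e (.inl x) = n → (x : α) ∈ SetRel.dom c'.1) ∧
      (∀ y : T, e (.inr y) = n → (y : β) ∈ SetRel.cod c'.1) := by
    intro n c
    by_cases hn : ∃ z, e z = n
    · obtain ⟨z, rfl⟩ := hn
      rcases z with x | y
      · obtain ⟨y, hy⟩ := forth c.1 c.2 x x.2
        refine ⟨⟨_, hy⟩, Set.subset_union_left, fun x' hx' => ?_, fun y' hy' => ?_⟩
        · obtain rfl : x' = x := by simpa using he hx'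
          exact ⟨y, Or.inr rfl⟩
        · have := he hy'
          simp at this
      · obtain ⟨x, hx⟩ := back c.1 c.2 y y.2
        refine ⟨⟨_, hx⟩, Set.subset_union_left, fun x' hx' => ?_, fun y' hy' => ?_⟩
        · have := he hx'
          simp at this
        · obtain rfl : y' = y := by simpa using he hy'
          exact ⟨x, Or.inr rfl⟩
    · push Not at hn
      exact ⟨c, subset_rfl, fun x hx => (hn _ hx).elim, fun y hy => (hn _ hy).elim⟩
  choose g hg hgS hgT using step
  let c : ℕ → {c // P c} := fun n => Nat.rec ⟨c₀, h₀⟩ g n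
  refine ⟨fun n => (c n).1, monotone_nat_of_le_succ fun n => hg n (c n), rfl,
    fun n => (c n).2, fun x hx => ?_, fun y hy => ?_⟩
  · obtain ⟨y, hy⟩ := hgS (e (.inl ⟨x, hx⟩)) (c _) ⟨x, hx⟩ rfl
    exact ⟨y, Set.mem_iUnion.2 ⟨e (.inl ⟨x, hx⟩) + 1, hy⟩⟩
  · obtain ⟨x, hx⟩ := hgT (e (.inr ⟨y, hy⟩)) (c _) ⟨y, hy⟩ rfl
    exact ⟨x, Set.mem_iUnion.2 ⟨e (.inr ⟨y, hy⟩) + 1, hx⟩⟩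

end BackAndForth

/-! ### Homogeneous classes -/

section Homogeneous

variable {L : FirstOrder.Language.{v, w}}

/-- `ℵ₀`-homogeneity over the partial embedding `g`. -/
def HomOver (H K : ClStr.{u} L) (g : SetRel H.carrier K.carrier) : Prop :=
  ∀ f : SetRel H.carrier K.carrier, f.dom.Finite → PartialEmb H K (g ∪ f) →
    ∀ y ∈ H.cl (f.dom ∪ g.dom), ∃ y', PartialEmb H K (g ∪ f ∪ {(y, y')})

/-- The axioms of a quasiminimal excellent class without excellence and with
`ℵ₀`-homogeneity over finite-dimensional closed sets and the empty set only. -/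
structure Homogeneous (C : Set (ClStr.{u} L)) : Prop where
  empty_map : ∀ H ∈ C, ∀ K ∈ C, PartialEmb H K ∅
  pregeometry : ∀ H ∈ C, IsPregeometry H.cl
  ccp : ∀ H ∈ C, ∀ X : Set H.carrier, X.Finite → (H.cl X).Countable
  closure_preserved : ∀ H ∈ C, ∀ K ∈ C, ∀ (X : Set H.carrier), ∀ y ∈ H.cl X,
    ∀ f : SetRel H.carrier K.carrier, PartialEmb H K f → X ⊆ f.dom →
      ∀ z, (y, z) ∈ f → z ∈ K.cl (f.image X)
  generic : ∀ H ∈ C, ∀ K ∈ C, ∀ (G : Set H.carrier) (G' : Set K.carrier),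
    CtblClosedOrEmpty H G → CtblClosedOrEmpty K G' →
    ∀ g : SetRel H.carrier K.carrier, PartialEmb H K g → g.dom = G → g.cod = G' →
      ∀ x x', x ∉ H.cl G → x' ∉ K.cl G' → PartialEmb H K (g ∪ {(x, x')})
  homOver_empty : ∀ H ∈ C, ∀ K ∈ C, HomOver H K ∅
  homOver_finite : ∀ H ∈ C, ∀ K ∈ C, ∀ g : SetRel H.carrier K.carrier, PartialEmb H K g →
    ∀ (A : Set H.carrier) (A' : Set K.carrier), A.Finite → A'.Finite → g.dom = H.cl A →
      g.cod = K.cl A' → HomOver H K g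

theorem QME.homOver {C : Set (ClStr.{u} L)} (hC : QME C) {H K : ClStr.{u} L} (hH : H ∈ C)
    (hK : K ∈ C) {g : SetRel H.carrier K.carrier} (hg : PartialEmb H K g)
    (h1 : CtblClosedOrEmpty H g.dom) (h2 : CtblClosedOrEmpty K g.cod) : HomOver H K g :=
  hC.homogeneity_closure H hH K hK _ _ h1 h2 g hg rfl rfl

theorem QME.homogeneous {C : Set (ClStr.{u} L)} (hC : QME C) : Homogeneous C where
  empty_map := hC.empty_map
  pregeometry := hC.pregeometry
  ccp := hC.ccp
  closure_preserved := hC.closure_preserved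
  generic := hC.homogeneity_generic
  homOver_empty H hH K hK := hC.homOver hH hK (hC.empty_map H hH K hK) (Or.inl (by simp))
    (Or.inl (by simp))
  homOver_finite H hH K hK g hg A A' hA hA' h1 h2 := by
    refine hC.homOver hH hK hg (Or.inr ?_) (Or.inr ?_)
    · rw [h1]; exact ⟨hC.ccp H hH A hA, (hC.pregeometry H hH).idem A⟩
    · rw [h2]; exact ⟨hC.ccp K hK A' hA', (hC.pregeometry K hK).idem A'⟩

namespace Homogeneous

variable {C : Set (ClStr.{u} L)} (hC : Homogeneous C) {H K : ClStr.{u} L} (hH : H ∈ C)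
  (hK : K ∈ C)
include hC hH

theorem countable_cl {X : Set H.carrier} (hX : X.Countable) : (H.cl X).Countable :=
  (hC.pregeometry H hH).countable_cl (hC.ccp H hH) hX

include hK

/-- This is the working form of axiom (I.3): the points of `X` need only have images in the closure
of `Y`. -/
theorem mem_cl_of_mem {r : SetRel H.carrier K.carrier} (hr : PartialEmb H K r)
    {X : Set H.carrier} {Y : Set K.carrier} (hX : ∀ x ∈ X, ∃ y ∈ K.cl Y, (x, y) ∈ r)
    {y : H.carrier} {z : K.carrier} (hy : y ∈ H.cl X) (hyz : (y, z) ∈ r) : z ∈ K.cl Y := by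
  refine (hC.pregeometry K hK).cl_subset ?_
    (hC.closure_preserved H hH K hK X y hy r hr (fun x hx => ?_) z hyz)
  · rintro b ⟨a, ha, hab⟩
    obtain ⟨c, hc, hac⟩ := hX a ha
    rwa [hr.right_unique hab hac]
  · obtain ⟨y, _, hy⟩ := hX x hx
    exact ⟨y, hy⟩

/-- Axiom (I.3) applied to `r` gives one inclusion and applied to its inverse the other. In
particular, total partial embeddings commute with the closure operators. -/
theorem image_cl {r : SetRel H.carrier K.carrier} (hr : PartialEmb H K r) {X : Set H.carrier}
    (h1 : H.cl X ⊆ r.dom) (h2 : K.cl (r.image X) ⊆ r.cod) :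
    r.image (H.cl X) = K.cl (r.image X) := by
  have hX : X ⊆ r.dom := ((hC.pregeometry H hH).subset_cl X).trans h1
  apply Set.Subset.antisymm
  · rintro z ⟨y, hy, hyz⟩
    exact hC.closure_preserved H hH K hK X y hy r hr hX z hyz
  · intro z hz
    obtain ⟨y, hyz⟩ := h2 hz
    refine ⟨y, ?_, hyz⟩
    refine hC.mem_cl_of_mem hK hH hr.inv (X := r.image X) ?_ hz hyz
    rintro b ⟨a, ha, hab⟩
    exact ⟨a, (hC.pregeometry H hH).subset_cl _ ha, hab⟩

theorem iso_of_total {r : SetRel H.carrier K.carrier} (hr : PartialEmb H K r)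
    (h1 : r.dom = Set.univ) (h2 : r.cod = Set.univ) : H.Iso K := by
  obtain ⟨e, he⟩ := hr.exists_equiv h1 h2
  have him : ∀ X, r.image X = e '' X := by
    intro X
    ext y
    constructor
    · rintro ⟨x, hx, hxy⟩
      exact ⟨x, hx, hr.right_unique (he x) hxy⟩
    · rintro ⟨x, hx, rfl⟩
      exact ⟨x, hx, he x⟩
  refine ⟨e, fun X => ?_⟩
  rw [← him, ← him]
  exact hC.image_cl hH hK hr (h1 ▸ Set.subset_univ _) (h2 ▸ Set.subset_univ _)

/-- Extension of a partial embedding to closures by back-and-forth. -/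
theorem exists_extension_of_forth {r : SetRel H.carrier K.carrier} (hr : PartialEmb H K r)
    (hd : r.dom.Countable) (hc : r.cod.Countable)
    (forth : ∀ f : SetRel H.carrier K.carrier, f.Finite → f.dom ⊆ H.cl r.dom →
      PartialEmb H K (r ∪ f) → ∀ y ∈ H.cl r.dom, ∃ y', PartialEmb H K (r ∪ f ∪ {(y, y')}))
    (back : ∀ f : SetRel K.carrier H.carrier, f.Finite → f.dom ⊆ K.cl r.cod →
      PartialEmb K H (r.inv ∪ f) → ∀ y ∈ K.cl r.cod,
        ∃ y', PartialEmb K H (r.inv ∪ f ∪ {(y, y')})) :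
    ∃ F : SetRel H.carrier K.carrier, r ⊆ F ∧ PartialEmb H K F ∧ F.dom = H.cl r.dom ∧
      F.cod = K.cl r.cod := by
  have pH := hC.pregeometry H hH
  have pK := hC.pregeometry K hK
  -- Finite additions `f` to `r` are built, with domain and codomain kept inside the two closures; a
  -- new point stays there by (I.3).
  obtain ⟨c, hmono, _, hP, hS, hT⟩ := exists_back_and_forth (hC.countable_cl hH hd)
    (hC.countable_cl hK hc)
    (fun f : SetRel H.carrier K.carrier => f.Finite ∧ f.dom ⊆ H.cl r.dom ∧ f.cod ⊆ K.cl r.cod ∧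
      PartialEmb H K (r ∪ f)) ∅
    ⟨Set.finite_empty, by simp, by simp, by simpa using hr⟩
    (by
      rintro f ⟨hf, hfd, hfc, hrf⟩ y hy
      obtain ⟨y', hy'⟩ := forth f hf hfd hrf y hy
      refine ⟨y', hf.union (Set.finite_singleton _), ?_, ?_, by rwa [← Set.union_assoc]⟩
      · rw [SetRel.dom_union', SetRel.dom_singleton]
        exact Set.union_subset hfd (Set.singleton_subset_iff.2 hy)
      · rw [SetRel.cod_union', SetRel.cod_singleton]
        refine Set.union_subset hfc (Set.singleton_subset_iff.2 ?_)
        refine hC.mem_cl_of_mem hH hK hy' (X := r.dom) ?_ hy (Or.inr rfl)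
        rintro x ⟨z, hz⟩
        exact ⟨z, pK.subset_cl _ ⟨x, hz⟩, Or.inl (Or.inl hz)⟩)
    (by
      rintro f ⟨hf, hfd, hfc, hrf⟩ y hy
      have hfinv : f.inv.Finite := (hf.image Prod.swap).subset fun p hp => ⟨p.swap, hp, by simp⟩
      obtain ⟨y', hy'⟩ := back f.inv hfinv hfc hrf.inv y hy
      refine ⟨y', hf.union (Set.finite_singleton _), ?_, ?_, ?_⟩
      · rw [SetRel.dom_union', SetRel.dom_singleton]
        refine Set.union_subset hfd (Set.singleton_subset_iff.2 ?_)
        refine hC.mem_cl_of_mem hK hH hy' (X := r.cod) ?_ hy (Or.inr rfl)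
        rintro x ⟨z, hz⟩
        exact ⟨z, pH.subset_cl _ ⟨x, hz⟩, Or.inl (Or.inl hz)⟩
      · rw [SetRel.cod_union', SetRel.cod_singleton]
        exact Set.union_subset hfc (Set.singleton_subset_iff.2 hy)
      · refine hy'.inv.mono ?_
        rintro ⟨a, b⟩ (h | h | h)
        · exact Or.inl (Or.inl h)
        · exact Or.inl (Or.inr h)
        · obtain ⟨rfl, rfl⟩ := Prod.mk.inj h
          exact Or.inr rfl)
  refine ⟨⋃ n, r ∪ c n, fun p hp => Set.mem_iUnion.2 ⟨0, Or.inl hp⟩,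
    PartialEmb.iUnion_nat (fun i j hij => Set.union_subset_union_right _ (hmono hij))
      (fun n => (hP n).2.2.2), ?_, ?_⟩
  · apply Set.Subset.antisymm
    · rintro x ⟨y, hy⟩
      obtain ⟨n, hn | hn⟩ := Set.mem_iUnion.1 hy
      · exact pH.subset_cl _ ⟨y, hn⟩
      · exact (hP n).2.1 ⟨y, hn⟩
    · intro x hx
      obtain ⟨y, hy⟩ := hS hx
      obtain ⟨n, hn⟩ := Set.mem_iUnion.1 hy
      exact ⟨y, Set.mem_iUnion.2 ⟨n, Or.inr hn⟩⟩
  · apply Set.Subset.antisymm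
    · rintro x ⟨y, hy⟩
      obtain ⟨n, hn | hn⟩ := Set.mem_iUnion.1 hy
      · exact pK.subset_cl _ ⟨y, hn⟩
      · exact (hP n).2.2.1 ⟨y, hn⟩
    · intro x hx
      obtain ⟨y, hy⟩ := hT hx
      obtain ⟨n, hn⟩ := Set.mem_iUnion.1 hy
      exact ⟨y, Set.mem_iUnion.2 ⟨n, Or.inr hn⟩⟩

theorem exists_extension {g f : SetRel H.carrier K.carrier} (hgf : PartialEmb H K (g ∪ f))
    (hd : g.dom.Countable) (hc : g.cod.Countable) (hf : f.Finite)
    (h1 : HomOver H K g) (h2 : HomOver K H g.inv) :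
    ∃ F : SetRel H.carrier K.carrier, g ∪ f ⊆ F ∧ PartialEmb H K F ∧
      F.dom = H.cl (g.dom ∪ f.dom) ∧ F.cod = K.cl (g.cod ∪ f.cod) := by
  rw [← SetRel.dom_union', ← SetRel.cod_union']
  have aux : ∀ {H K : ClStr.{u} L} (_ : H ∈ C) {g f : SetRel H.carrier K.carrier},
      f.Finite → HomOver H K g → ∀ f' : SetRel H.carrier K.carrier, f'.Finite →
      PartialEmb H K (g ∪ f ∪ f') → ∀ y ∈ H.cl (SetRel.dom (g ∪ f)),
      ∃ y', PartialEmb H K (g ∪ f ∪ f' ∪ {(y, y')}) := by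
    intro H K hH g f hf h1 f' hf' hr y hy
    rw [Set.union_assoc] at hr ⊢
    refine h1 (f ∪ f') (SetRel.dom_finite (hf.union hf')) hr y
      ((hC.pregeometry H hH).mono _ _ ?_ hy)
    rw [SetRel.dom_union', SetRel.dom_union']
    rintro x (hx | hx)
    · exact Or.inr hx
    · exact Or.inl (Or.inl hx)
  refine hC.exists_extension_of_forth hH hK hgf ?_ ?_ ?_ ?_
  · rw [SetRel.dom_union']; exact hd.union (SetRel.dom_finite hf).countable
  · rw [SetRel.cod_union']; exact hc.union (SetRel.cod_finite hf).countable
  · exact fun f' hf' _ => aux hH hf h1 f' hf'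
  · have hfinv : f.inv.Finite := (hf.image Prod.swap).subset fun p hp => ⟨p.swap, hp, by simp⟩
    exact fun f' hf' _ => aux hK hfinv h2 f' hf'

theorem exists_extension_finite {f : SetRel H.carrier K.carrier} (hf : f.Finite)
    (h : PartialEmb H K f) :
    ∃ F : SetRel H.carrier K.carrier, f ⊆ F ∧ PartialEmb H K F ∧
      F.dom = H.cl f.dom ∧ F.cod = K.cl f.cod := by
  simpa using hC.exists_extension hH hK (g := ∅) (f := f) (by simpa using h) (by simp) (by simp)
    hf (hC.homOver_empty H hH K hK) (hC.homOver_empty K hK H hH)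

/-- Generic points have a unique type over countable closed sets, so (x, x') can be added to `g`;
homogeneity over `g` then carries the map to the enlarged closures. -/
theorem exists_extension_generic {g : SetRel H.carrier K.carrier} (hg : PartialEmb H K g)
    {A : Set H.carrier} {A' : Set K.carrier} (hA : A.Countable) (hA' : A'.Countable)
    (hd : g.dom = H.cl A) (hc : g.cod = K.cl A')
    (h1 : HomOver H K g) (h2 : HomOver K H g.inv) {x : H.carrier} {x' : K.carrier}
    (hx : x ∉ H.cl A) (hx' : x' ∉ K.cl A') :
    ∃ F : SetRel H.carrier K.carrier, g ⊆ F ∧ (x, x') ∈ F ∧ PartialEmb H K F ∧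
      F.dom = H.cl (insert x A) ∧ F.cod = K.cl (insert x' A') := by
  have pH := hC.pregeometry H hH
  have pK := hC.pregeometry K hK
  have hdc : g.dom.Countable := hd ▸ hC.countable_cl hH hA
  have hcc : g.cod.Countable := hc ▸ hC.countable_cl hK hA'
  have h3 : PartialEmb H K (g ∪ {(x, x')}) := by
    refine hC.generic H hH K hK g.dom g.cod (Or.inr ⟨hdc, ?_⟩) (Or.inr ⟨hcc, ?_⟩) g hg rfl rfl
      x x' ?_ ?_
    · rw [hd]; exact pH.idem _
    · rw [hc]; exact pK.idem _
    · rwa [hd, pH.idem]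
    · rwa [hc, pK.idem]
  obtain ⟨F, hF, hFe, hFd, hFc⟩ := hC.exists_extension hH hK h3 hdc hcc
    (Set.finite_singleton _) h1 h2
  refine ⟨F, fun p hp => hF (Or.inl hp), hF (Or.inr rfl), hFe, ?_, ?_⟩
  · rw [hFd, SetRel.dom_singleton, hd]
    apply Set.Subset.antisymm
    · refine pH.cl_subset (Set.union_subset (pH.mono _ _ (Set.subset_insert _ _)) ?_)
      exact Set.singleton_subset_iff.2 (pH.subset_cl _ (Set.mem_insert _ _))
    · refine pH.mono _ _ (Set.insert_subset (Or.inr rfl) ?_)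
      exact (pH.subset_cl _).trans Set.subset_union_left
  · rw [hFc, SetRel.cod_singleton, hc]
    apply Set.Subset.antisymm
    · refine pK.cl_subset (Set.union_subset (pK.mono _ _ (Set.subset_insert _ _)) ?_)
      exact Set.singleton_subset_iff.2 (pK.subset_cl _ (Set.mem_insert _ _))
    · refine pK.mono _ _ (Set.insert_subset (Or.inr rfl) ?_)
      exact (pK.subset_cl _).trans Set.subset_union_left

/-- Extension along a bijection of finite independent sets. -/
theorem exists_extension_indep {g : SetRel H.carrier K.carrier} (hg : PartialEmb H K g)
    {A T : Set H.carrier} {A' : Set K.carrier} (hA : A.Finite) (hA' : A'.Finite) (hT : T.Finite)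
    (hd : g.dom = H.cl A) (hc : g.cod = K.cl A') {B : Set H.carrier} {B' : Set K.carrier}
    (hB : Indep H.cl B) (hB' : Indep K.cl B') (hAB : A ⊆ B) (hTB : T ⊆ B) (hAT : Disjoint A T)
    (θ : H.carrier → K.carrier) (hθ : Set.InjOn θ T) (hA'B : A' ⊆ B') (hθB : θ '' T ⊆ B')
    (hAT' : Disjoint A' (θ '' T)) :
    ∃ F : SetRel H.carrier K.carrier, g ⊆ F ∧ PartialEmb H K F ∧ F.dom = H.cl (A ∪ T) ∧
      F.cod = K.cl (A' ∪ θ '' T) ∧ ∀ t ∈ T, (t, θ t) ∈ F := by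
  have pH := hC.pregeometry H hH
  have pK := hC.pregeometry K hK
  induction T, hT using Set.Finite.induction_on with
  | empty => exact ⟨g, subset_rfl, hg, by simpa using hd, by simpa using hc, by simp⟩
  | @insert t T ht hT ih =>
    rw [Set.image_insert_eq] at hθB hAT' ⊢
    obtain ⟨F, hgF, hF, hFd, hFc, hFt⟩ := ih ((Set.subset_insert _ _).trans hTB)
      (hAT.mono_right (Set.subset_insert _ _)) (hθ.mono (Set.subset_insert _ _))
      ((Set.subset_insert _ _).trans hθB) (hAT'.mono_right (Set.subset_insert _ _))
    have f1 : (A ∪ T).Finite := hA.union hT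
    have f2 : (A' ∪ θ '' T).Finite := hA'.union (hT.image θ)
    -- By independence the next point t, and likewise θ t, is generic over the finite-dimensional
    -- closed set already treated.
    obtain ⟨F', hFF', htF', hF', hF'd, hF'c⟩ := hC.exists_extension_generic hH hK hF
      f1.countable f2.countable hFd hFc (hC.homOver_finite H hH K hK F hF _ _ f1 f2 hFd hFc)
      (hC.homOver_finite K hK H hH F.inv hF.inv _ _ f2 f1 hFc hFd) (x := t) (x' := θ t)
      (hB.notMem_cl pH (Set.union_subset hAB ((Set.subset_insert _ _).trans hTB))
        (hTB (Set.mem_insert _ _)) (by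
          rintro (h | h)
          · exact Set.disjoint_left.1 hAT h (Set.mem_insert _ _)
          · exact ht h))
      (hB'.notMem_cl pK (Set.union_subset hA'B ((Set.subset_insert _ _).trans hθB))
        (hθB (Set.mem_insert _ _)) (by
          rintro (h | ⟨s, hs, hst⟩)
          · exact Set.disjoint_left.1 hAT' h (Set.mem_insert _ _)
          · exact ht (hθ (Set.mem_insert_of_mem _ hs) (Set.mem_insert _ _) hst ▸ hs)))
    refine ⟨F', hgF.trans hFF', hF', by rw [hF'd, Set.union_insert],
      by rw [hF'c, Set.union_insert], ?_⟩
    rintro s (rfl | hs)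
    · exact htF'
    · exact hFF' (hFt s hs)

/-- A bijection of countable independent sets extends to their closures. -/
theorem exists_extension_countable_indep {B : Set H.carrier} (hB : Indep H.cl B)
    (hBc : B.Countable) (ψ : H.carrier → K.carrier) (hψ : Set.InjOn ψ B)
    (hB' : Indep K.cl (ψ '' B)) :
    ∃ F : SetRel H.carrier K.carrier, PartialEmb H K F ∧ F.dom = H.cl B ∧
      F.cod = K.cl (ψ '' B) ∧ ∀ b ∈ B, (b, ψ b) ∈ F := by
  have pH := hC.pregeometry H hH
  have pK := hC.pregeometry K hK
  have := hBc.to_subtype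
  obtain ⟨e, he⟩ := exists_injective_nat B
  -- `B` is exhausted by finite sets `A n`, because `Homogeneous` gives homogeneity over
  -- finite-dimensional closed sets only. By finite character the union of the maps on the closures
  -- of the `A n` reaches all of the closure of `B`.
  let A : ℕ → Set H.carrier := fun n => Subtype.val '' {b : B | e b < n}
  have hAB : ∀ n, A n ⊆ B := fun n => by rintro _ ⟨b, _, rfl⟩; exact b.2
  have hAfin : ∀ n, (A n).Finite := fun n =>
    (Set.Finite.of_finite_image ((Set.finite_lt_nat n).subset (by rintro _ ⟨b, hb, rfl⟩; exact hb))
      he.injOn).image _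
  let Q : ℕ → SetRel H.carrier K.carrier → Prop := fun n F => PartialEmb H K F ∧
    F.dom = H.cl (A n) ∧ F.cod = K.cl (ψ '' A n) ∧ ∀ b ∈ A n, (b, ψ b) ∈ F
  have h0 : ∃ F, Q 0 F := by
    obtain ⟨F, _, hF, hFd, hFc⟩ := hC.exists_extension_finite hH hK Set.finite_empty
      (hC.empty_map H hH K hK)
    have hA0 : A 0 = ∅ := by simp [A]
    exact ⟨F, hF, by simpa [hA0] using hFd, by simpa [hA0] using hFc, by simp [hA0]⟩
  have step : ∀ n (F : {F // Q n F}), ∃ F' : {F // Q (n + 1) F}, F.1 ⊆ F'.1 := by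
    rintro n ⟨F, hF, hFd, hFc, hFb⟩
    let T : Set H.carrier := A (n + 1) \ A n
    have hT : T ⊆ B := Set.sdiff_subset.trans (hAB _)
    have hmono : A n ⊆ A (n + 1) := by
      rintro _ ⟨b, hb, rfl⟩
      exact ⟨b, Nat.lt_succ_of_lt hb, rfl⟩
    have hu : A n ∪ T = A (n + 1) := Set.union_sdiff_cancel hmono
    obtain ⟨F', hFF', hF', hF'd, hF'c, hF't⟩ := hC.exists_extension_indep hH hK hF (hAfin n)
      ((hAfin n).image ψ) (hAfin _).sdiff hFd hFc hB hB' (hAB n) hT Set.disjoint_sdiff_right ψ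
      (hψ.mono hT) (Set.image_mono (hAB n)) (Set.image_mono hT) (by
        rw [Set.disjoint_left]
        rintro _ ⟨a, ha, rfl⟩ ⟨t, ht, hta⟩
        exact ht.2 (hψ (hT ht) (hAB n ha) hta ▸ ha))
    change SetRel.dom F' = H.cl (A n ∪ T) at hF'd
    change SetRel.cod F' = K.cl (ψ '' A n ∪ ψ '' T) at hF'c
    rw [← Set.image_union] at hF'c
    rw [hu] at hF'c hF'd
    refine ⟨⟨F', hF', hF'd, hF'c, fun b hb => ?_⟩, hFF'⟩
    by_cases hbn : b ∈ A n
    · exact hFF' (hFb b hbn)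
    · exact hF't b ⟨hb, hbn⟩
  obtain ⟨F₀, hF₀⟩ := h0
  choose g hg using step
  let c : ∀ n, {F // Q n F} := fun n => Nat.rec ⟨F₀, hF₀⟩ g n
  have hmono : Monotone fun n => (c n).1 := monotone_nat_of_le_succ fun n => hg n (c n)
  have hsupp : ∀ Y : Set H.carrier, Y.Finite → Y ⊆ B → ∃ n, Y ⊆ A n := by
    intro Y hY hYB
    lift Y to Set B using hYB
    have hY' : Y.Finite := Set.Finite.of_finite_image hY Subtype.val_injective.injOn
    obtain ⟨n, hn⟩ := (hY'.image e).bddAbove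
    refine ⟨n + 1, ?_⟩
    rintro _ ⟨b, hb, rfl⟩
    exact ⟨b, Nat.lt_succ_of_le (hn ⟨b, hb, rfl⟩), rfl⟩
  refine ⟨⋃ n, (c n).1, PartialEmb.iUnion_nat hmono fun n => (c n).2.1, ?_, ?_, ?_⟩
  · apply Set.Subset.antisymm
    · rintro x ⟨y, hy⟩
      obtain ⟨n, hn⟩ := Set.mem_iUnion.1 hy
      have : x ∈ SetRel.dom (c n).1 := ⟨y, hn⟩
      rw [(c n).2.2.1] at this
      exact pH.mono _ _ (hAB n) this
    · intro x hx
      obtain ⟨Y, hY, hYB, hxY⟩ := pH.finite_char _ _ hx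
      obtain ⟨n, hn⟩ := hsupp Y hY hYB
      have : x ∈ SetRel.dom (c n).1 := by rw [(c n).2.2.1]; exact pH.mono _ _ hn hxY
      obtain ⟨y, hy⟩ := this
      exact ⟨y, Set.mem_iUnion.2 ⟨n, hy⟩⟩
  · apply Set.Subset.antisymm
    · rintro x ⟨y, hy⟩
      obtain ⟨n, hn⟩ := Set.mem_iUnion.1 hy
      have : x ∈ SetRel.cod (c n).1 := ⟨y, hn⟩
      rw [(c n).2.2.2.1] at this
      exact pK.mono _ _ (Set.image_mono (hAB n)) this
    · intro x hx
      obtain ⟨Y, hY, hYB, hxY⟩ := pK.finite_char _ _ hx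
      obtain ⟨Z, hZB, rfl⟩ := Set.subset_image_iff.1 hYB
      have hZ : Z.Finite := Set.Finite.of_finite_image hY (hψ.mono hZB)
      obtain ⟨n, hn⟩ := hsupp Z hZ hZB
      have : x ∈ SetRel.cod (c n).1 := by
        rw [(c n).2.2.2.1]; exact pK.mono _ _ (Set.image_mono hn) hxY
      obtain ⟨y, hy⟩ := this
      exact ⟨y, Set.mem_iUnion.2 ⟨n, hy⟩⟩
  · intro b hb
    obtain ⟨n, hn⟩ := hsupp {b} (Set.finite_singleton _) (Set.singleton_subset_iff.2 hb)
    exact Set.mem_iUnion.2 ⟨n, (c n).2.2.2.2 b (hn rfl)⟩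

theorem iso_of_countable_bases {B : Set H.carrier} (hB : Indep H.cl B)
    (hBs : H.cl B = Set.univ) (hBc : B.Countable) (ψ : H.carrier → K.carrier)
    (hψ : Set.InjOn ψ B) (hB' : Indep K.cl (ψ '' B)) (hBs' : K.cl (ψ '' B) = Set.univ) :
    H.Iso K := by
  obtain ⟨F, hF, hFd, hFc, _⟩ := hC.exists_extension_countable_indep hH hK hB hBc ψ hψ hB'
  exact hC.iso_of_total hH hK hF (hFd.trans hBs) (hFc.trans hBs')

end Homogeneous

/-- Every finite independent set of `H` is matched in size by an independent set of `K`. -/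
def DimLE (H K : ClStr.{u} L) : Prop :=
  ∀ I : Finset H.carrier, Indep H.cl (I : Set H.carrier) →
    ∃ J : Finset K.carrier, Indep K.cl (J : Set K.carrier) ∧ J.card = I.card

theorem dimLE_of_hasDim_infinite {H K : ClStr.{u} L} (pK : IsPregeometry K.cl) {κ : Cardinal.{u}}
    (hκ : ℵ₀ ≤ κ) (hK : HasDim K.cl κ) : DimLE H K := by
  intro I _
  obtain ⟨B, hB, _, rfl⟩ := hK
  have : B.Infinite := by rwa [← Set.infinite_coe_iff, Cardinal.infinite_iff]
  obtain ⟨J, hJ, hJc⟩ := this.exists_subset_card_eq I.card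
  exact ⟨J, hB.subset pK hJ, hJc⟩

theorem dimLE_of_hasDim_nat {H K : ClStr.{u} L} (pH : IsPregeometry H.cl)
    (pK : IsPregeometry K.cl) {n : ℕ} (hH : HasDim H.cl n) (hK : HasDim K.cl n) : DimLE H K := by
  intro I hI
  obtain ⟨B, hB, hBs, hBn⟩ := hH
  obtain ⟨B', hB', _, hBn'⟩ := hK
  have hfin : B.Finite := Cardinal.lt_aleph0_iff_set_finite.1 (hBn ▸ Cardinal.natCast_lt_aleph0)
  have hfin' : B'.Finite :=
    Cardinal.lt_aleph0_iff_set_finite.1 (hBn' ▸ Cardinal.natCast_lt_aleph0)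
  lift B to Finset H.carrier using hfin
  lift B' to Finset K.carrier using hfin'
  have h1 : B.card = n := by exact_mod_cast (Cardinal.mk_coe_finset (s := B)).symm.trans hBn
  have h2 : B'.card = n := by exact_mod_cast (Cardinal.mk_coe_finset (s := B')).symm.trans hBn'
  have : I.card ≤ B'.card := by
    rw [h2, ← h1]
    exact hI.card_le pH (hBs ▸ Set.subset_univ _)
  obtain ⟨J, hJ, hJc⟩ := Finset.exists_subset_card_eq this
  exact ⟨J, hB'.subset pK (by exact_mod_cast hJ), hJc⟩

/-- One step of a back-and-forth between members of suitable dimensions. -/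
theorem Homogeneous.exists_forth {C : Set (ClStr.{u} L)} (hC : Homogeneous C) {H K : ClStr.{u} L}
    (hH : H ∈ C) (hK : K ∈ C) (hdim : DimLE H K) {r : SetRel H.carrier K.carrier}
    (hr : r.Finite) (h : PartialEmb H K r) (y : H.carrier) :
    ∃ y', PartialEmb H K (r ∪ {(y, y')}) := by
  classical
  have pH := hC.pregeometry H hH
  have pK := hC.pregeometry K hK
  by_cases hy : y ∈ H.cl r.dom
  · obtain ⟨y', hy'⟩ := hC.homOver_empty H hH K hK r (SetRel.dom_finite hr) (by simpa using h) y
      (by simpa using hy)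
    exact ⟨y', by simpa using hy'⟩
  -- The remaining case has `y` generic over the closure of the domain. It suffices to find a
  -- generic point over the closure of the codomain.
  obtain ⟨F, hrF, hF, hFd, hFc⟩ := hC.exists_extension_finite hH hK hr h
  obtain ⟨I, _, hId, hI, hIc⟩ := (indep_empty H.cl).exists_basis pH (Set.empty_subset r.dom)
  have hIfin : I.Finite := (SetRel.dom_finite hr).subset hId
  lift I to Finset H.carrier using hIfin
  have hyI : y ∉ H.cl (I : Set H.carrier) := hIc ▸ hy
  have hyI' : y ∉ I := fun h => hyI (pH.subset_cl _ h)
  have hins := hI.insert pH hyI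
  rw [← Finset.coe_insert] at hins
  obtain ⟨J, hJ, hJc⟩ := hdim _ hins
  have hsub : (I : Set H.carrier) ⊆ F.dom := hFd ▸ hId.trans (pH.subset_cl _)
  have hJne : 0 < J.card := by
    rw [hJc]; exact Finset.card_pos.2 (Finset.insert_nonempty _ _)
  obtain ⟨j, _⟩ := Finset.card_pos.1 hJne
  have : Nonempty K.carrier := ⟨j⟩
  choose! φ hφ using fun (x : H.carrier) (hx : x ∈ (I : Set H.carrier)) => hsub hx
  have hcod : K.cl r.cod ⊆ K.cl (I.image φ : Finset K.carrier) := by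
    refine pK.cl_subset ?_
    rintro z ⟨x, hxz⟩
    have hx : x ∈ H.cl (I : Set H.carrier) := hIc ▸ pH.subset_cl _ ⟨z, hxz⟩
    refine hC.mem_cl_of_mem hH hK hF (fun x hx => ⟨φ x, pK.subset_cl _ ?_, hφ x hx⟩) hx
      (hrF hxz)
    exact Finset.mem_coe.2 (Finset.mem_image_of_mem φ hx)
  -- The closure of the codomain is spanned by the at most |I| points `φ '' I`, whereas `J` has |I|
  -- + 1 independent points.
  have : ∃ y' ∈ J, y' ∉ K.cl r.cod := by
    by_contra hcon
    push Not at hcon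
    have h1 : J.card ≤ (I.image φ).card := hJ.card_le pK fun z hz => hcod (hcon z hz)
    have h2 : (I.image φ).card ≤ I.card := Finset.card_image_le
    rw [hJc, Finset.card_insert_of_notMem hyI'] at h1
    omega
  obtain ⟨y', _, hy'⟩ := this
  refine ⟨y', (hC.generic H hH K hK F.dom F.cod (Or.inr ⟨?_, ?_⟩) (Or.inr ⟨?_, ?_⟩) F hF rfl rfl
    y y' ?_ ?_).mono (Set.union_subset_union_left _ hrF)⟩
  · rw [hFd]; exact hC.ccp H hH _ (SetRel.dom_finite hr)
  · rw [hFd]; exact pH.idem _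
  · rw [hFc]; exact hC.ccp K hK _ (SetRel.cod_finite hr)
  · rw [hFc]; exact pK.idem _
  · rwa [hFd, pH.idem]
  · rwa [hFc, pK.idem]

end Homogeneous


/-! ### Maps of crowns -/

section Crowns

variable {L : FirstOrder.Language.{v, w}}

/-- `g` is a partial embedding defined on the crown `⋃ i, cl (D i)` that maps each `cl (D i)` to a
closed set. -/
structure CrownMap (H K : ClStr.{u} L) {ι : Type} (B : Set H.carrier) (D : ι → Set H.carrier)
    (g : SetRel H.carrier K.carrier) : Prop where
  indep : Indep H.cl B
  subset : ∀ i, D i ⊆ B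
  partialEmb : PartialEmb H K g
  dom_eq : g.dom = ⋃ i, H.cl (D i)
  isCl_image : ∀ i, IsCl K.cl (g.image (H.cl (D i)))

namespace CrownMap

variable {C : Set (ClStr.{u} L)} {H K : ClStr.{u} L} (hH : H ∈ C) (hK : K ∈ C) {ι : Type}
  {B : Set H.carrier} {D : ι → Set H.carrier} {g : SetRel H.carrier K.carrier}
  (hg : CrownMap H K B D g)
include hH hK hg

/-- Closed images of the finitely or infinitely many pieces cl(D i) already force closed images of
all closed W in the domain. A point z in the closure of g(W) is pulled back by homogeneity to some y
∈ W; independence locates y in the closure of finitely many points of one D i, whose images together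
with z show that z lies in the closed set g(cl(D i)). -/
theorem closedPartialEmb (hC : Homogeneous C) : ClosedPartialEmb H K g := by
  classical
  have pH := hC.pregeometry H hH
  have pK := hC.pregeometry K hK
  refine ⟨hg.partialEmb, fun W hWg hW => pK.isCl_of_subset ?_⟩
  intro z hz
  obtain ⟨Y, hY, hYW, hzY⟩ := pK.finite_char _ _ hz
  have hUd : (⋃ i, D i) ⊆ g.dom := by
    rw [hg.dom_eq]; exact Set.iUnion_mono fun i => pH.subset_cl _
  obtain ⟨s, hs, hsg, hsY, hsW⟩ : ∃ s : SetRel H.carrier K.carrier, s.Finite ∧ s ⊆ g ∧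
      Y = s.cod ∧ s.dom ⊆ W := by
    choose φ hφW hφ using fun y : Y => hYW y.2
    have := hY.to_subtype
    refine ⟨Set.range fun y : Y => (φ y, (y : K.carrier)), Set.finite_range _, ?_, ?_, ?_⟩
    · rintro _ ⟨y, rfl⟩; exact hφ y
    · ext y
      simp [SetRel.mem_cod]
    · rintro _ ⟨_, y, hy⟩
      obtain ⟨rfl, _⟩ := Prod.mk.inj hy
      exact hφW y
  obtain ⟨e, he, heD, hse⟩ := pH.exists_finite_support (X := ⋃ i, D i) (SetRel.dom_finite hs)
    (by
      refine (hsW.trans hWg).trans ?_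
      rw [hg.dom_eq]
      exact Set.iUnion_subset fun i => pH.mono _ _ (Set.subset_iUnion D i))
  -- The partial map through which z is pulled back must also know the images of the basis points
  -- `e` supporting `s`; this is what lets closure of D i ∩ e be pushed forward later.
  obtain ⟨t, ht, htg, hte⟩ : ∃ t : SetRel H.carrier K.carrier, t.Finite ∧ t ⊆ g ∧ t.dom = e := by
    choose φ hφ using fun x : e => hUd (heD x.2)
    have := he.to_subtype
    refine ⟨Set.range fun x : e => ((x : H.carrier), φ x), Set.finite_range _, ?_, ?_⟩
    · rintro _ ⟨x, rfl⟩; exact hφ x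
    · ext y
      simp [SetRel.mem_dom]
  have hst : PartialEmb H K (s ∪ t) := hg.partialEmb.mono (Set.union_subset hsg htg)
  obtain ⟨y, hy⟩ := hC.homOver_empty K hK H hH (SetRel.inv (s ∪ t))
    (SetRel.cod_finite (hs.union ht)) (by simpa using hst.inv) z (by
      refine pK.mono _ _ ?_ hzY
      rw [hsY]
      exact Set.subset_union_of_subset_left (SetRel.cod_mono Set.subset_union_left) _)
  have hy' := hy.inv
  have hsub : s ∪ t ⊆ SetRel.inv (∅ ∪ (s ∪ t).inv ∪ {(z, y)}) := fun p hp => Or.inl (Or.inr hp)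
  have hyz : (y, z) ∈ SetRel.inv (∅ ∪ (s ∪ t).inv ∪ {(z, y)}) := Or.inr rfl
  have hyW' : y ∈ H.cl s.dom := by
    refine hC.mem_cl_of_mem hK hH hy (X := Y) ?_ hzY hyz
    rintro x hx
    rw [hsY] at hx
    obtain ⟨a, ha⟩ := hx
    exact ⟨a, pH.subset_cl _ ⟨x, ha⟩, hsub (Or.inl ha)⟩
  have hyW : y ∈ W := pH.cl_subset_of_isCl hW hsW hyW'
  have hye : y ∈ H.cl e := pH.cl_subset hse hyW'
  obtain ⟨i, hi⟩ : ∃ i, y ∈ H.cl (D i) := by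
    have := hWg hyW
    rw [hg.dom_eq] at this
    exact Set.mem_iUnion.1 this
  -- Both `D i` and `e` lie in the independent set `B`, so y is in the closure of D i ∩ e.
  have hyi := hg.indep.cl_inter pH (hg.subset i) (heD.trans (Set.iUnion_subset hg.subset))
    ⟨hi, hye⟩
  have hzi : z ∈ K.cl (g.image (H.cl (D i))) := by
    refine hC.mem_cl_of_mem hH hK hy' ?_ hyi hyz
    rintro x ⟨hxi, hxe⟩
    rw [← hte] at hxe
    obtain ⟨x', hx'⟩ := hxe
    exact ⟨x', pK.subset_cl _ ⟨x, pH.subset_cl _ hxi, htg hx'⟩, hsub (Or.inr hx')⟩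
  rw [hg.isCl_image i] at hzi
  obtain ⟨x, _, hxz⟩ := hzi
  refine ⟨x, ?_, hxz⟩
  rw [← hW]
  refine hC.mem_cl_of_mem hK hH hg.partialEmb.inv ?_ hz hxz
  rintro b ⟨a, ha, hab⟩
  exact ⟨a, pH.subset_cl _ ha, hab⟩

theorem image_cl (hC : Homogeneous C) (i : ι) :
    g.image (H.cl (D i)) = K.cl (g.image (D i)) := by
  have pH := hC.pregeometry H hH
  have pK := hC.pregeometry K hK
  have hd : H.cl (D i) ⊆ g.dom := by
    rw [hg.dom_eq]; exact Set.subset_iUnion (fun i => H.cl (D i)) i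
  refine hC.image_cl hH hK hg.partialEmb hd ?_
  refine (pK.cl_subset_of_isCl (hg.isCl_image i)
    (SetRel.image_subset_image (pH.subset_cl _))).trans ?_
  rintro y ⟨x, _, hx⟩
  exact ⟨x, hx⟩

/-- Partial embeddings reflect closure, so images of independent points are independent, and the
image of a crown is a crown. The back direction of a back-and-forth over crowns is then the forth
direction for the inverse. -/
theorem inv (hC : Homogeneous C) :
    CrownMap K H (g.image (⋃ i, D i)) (fun i => g.image (D i)) g.inv where
  indep := by
    have pH := hC.pregeometry H hH
    rintro y ⟨x, hx, hxy⟩ hy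
    have hUB : (⋃ i, D i) ⊆ B := Set.iUnion_subset hg.subset
    refine hg.indep x (hUB hx) ?_
    refine hC.mem_cl_of_mem hK hH hg.partialEmb.inv ?_ hy hxy
    rintro z ⟨⟨a, ha, haz⟩, hzy⟩
    refine ⟨a, pH.subset_cl _ ⟨hUB ha, ?_⟩, haz⟩
    rintro rfl
    exact hzy (hg.partialEmb.right_unique haz hxy)
  subset i := SetRel.image_subset_image (Set.subset_iUnion D i)
  partialEmb := hg.partialEmb.inv
  dom_eq := by
    simp only [← hg.image_cl hH hK hC, ← SetRel.image_iUnion, ← hg.dom_eq]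
    ext y
    exact ⟨fun ⟨x, hx⟩ => ⟨x, ⟨y, hx⟩, hx⟩, fun ⟨x, _, hx⟩ => ⟨x, hx⟩⟩
  isCl_image i := by
    have pH := hC.pregeometry H hH
    have : g.inv.image (K.cl (g.image (D i))) = H.cl (D i) := by
      rw [← hg.image_cl hH hK hC]
      ext x
      constructor
      · rintro ⟨y, ⟨x', hx', hxy'⟩, hxy⟩
        have : x = x' := hg.partialEmb.left_unique hxy hxy'
        rwa [this]
      · intro hx
        have : x ∈ g.dom := by rw [hg.dom_eq]; exact Set.mem_iUnion.2 ⟨i, hx⟩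
        obtain ⟨y, hy⟩ := this
        exact ⟨y, ⟨x, hx, hy⟩, hy⟩
    rw [this]
    exact pH.idem _

/-- Excellence reduces homogeneity over the infinite map g to homogeneity over the empty map: a
finite part of g decides the type over g of the finite set consisting of y and the domain of f. -/
theorem exists_forth (hC : QME C) [Finite ι] (hD : ∀ i, (D i).Countable)
    (f : SetRel H.carrier K.carrier) (hf : f.Finite) (hfd : f.dom ⊆ H.cl g.dom)
    (hgf : PartialEmb H K (g ∪ f)) (y : H.carrier) (hy : y ∈ H.cl g.dom) :
    ∃ y', PartialEmb H K (g ∪ f ∪ {(y, y')}) := by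
  have pH := hC.pregeometry H hH
  have hdc : g.dom.Countable := by
    rw [hg.dom_eq]
    exact Set.countable_iUnion fun i => hC.homogeneous.countable_cl hH (hD i)
  have hcrown : IsCrown H.cl g.dom := by
    obtain ⟨n, ⟨e⟩⟩ := Finite.exists_equiv_fin ι
    refine ⟨B, hg.indep, n, D ∘ e.symm, fun i => hg.subset _, ?_⟩
    rw [hg.dom_eq]
    exact (e.symm.iSup_comp (g := fun i => H.cl (D i))).symm
  obtain ⟨D₀, hD₀, hD₀g, hD₀e⟩ := hC.excellence H hH K hK g.dom hdc hcrown g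
    (hg.closedPartialEmb hH hK hC.homogeneous) rfl (insert y f.dom)
    ((SetRel.dom_finite hf).insert y) (Set.insert_subset hy hfd)
  -- Besides the set `D₀` from excellence, a finite `D₁` with y ∈ cl(D₁) is kept, since homogeneity
  -- applies only to points in the closure of the domain.
  obtain ⟨D₁, hD₁, hD₁g, hyD₁⟩ := pH.finite_char _ _ hy
  let s : SetRel H.carrier K.carrier := {p ∈ g | p.1 ∈ D₀ ∪ D₁}
  have hsd : s.dom ⊆ D₀ ∪ D₁ := fun x ⟨_, hx⟩ => hx.2
  have hsg : s ⊆ g := fun p hp => hp.1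
  have hfs : PartialEmb H K (f ∪ s) :=
    hgf.mono (Set.union_subset Set.subset_union_right (hsg.trans Set.subset_union_left))
  obtain ⟨y', hy'⟩ := hC.homogeneous.homOver_empty H hH K hK (f ∪ s) (by
      rw [SetRel.dom_union']
      exact (SetRel.dom_finite hf).union ((hD₀.union hD₁).subset hsd)) (by simpa using hfs) y (by
      refine pH.mono _ _ (fun x hx => Or.inl ?_) hyD₁
      obtain ⟨z, hz⟩ := hD₁g hx
      exact ⟨z, Or.inr ⟨hz, Or.inr hx⟩⟩)
  refine ⟨y', (hD₀e (f ∪ {(y, y')}) ?_ (hy'.mono ?_)).mono ?_⟩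
  · rw [SetRel.dom_union', SetRel.dom_singleton, Set.union_singleton]
  · rintro p ((hp | hp) | hp)
    · exact Or.inl (Or.inr (Or.inl hp))
    · exact Or.inr hp
    · exact Or.inl (Or.inr (Or.inr ⟨hp.1, Or.inl hp.2⟩))
  · rintro p ((hp | hp) | hp)
    · exact Or.inr hp
    · exact Or.inl (Or.inl hp)
    · exact Or.inl (Or.inr hp)

/-- Excellence: a map of countable crowns extends to their closures. -/
theorem exists_extension (hC : QME C) [Finite ι] (hD : ∀ i, (D i).Countable) :
    ∃ F : SetRel H.carrier K.carrier, g ⊆ F ∧ PartialEmb H K F ∧ F.dom = H.cl g.dom ∧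
      F.cod = K.cl g.cod := by
  have hinv := hg.inv hH hK hC.homogeneous
  have hD' : ∀ i, (g.image (D i)).Countable := by
    intro i
    have : ∀ x : D i, {y | ((x : H.carrier), y) ∈ g}.Subsingleton :=
      fun x y hy z hz => hg.partialEmb.right_unique hy hz
    have h2 := (hD i).to_subtype
    refine (Set.countable_iUnion fun x => (this x).countable).mono ?_
    rintro y ⟨x, hx, hxy⟩
    exact Set.mem_iUnion.2 ⟨⟨x, hx⟩, hxy⟩
  refine hC.homogeneous.exists_extension_of_forth hH hK hg.partialEmb ?_ ?_
    (hg.exists_forth hH hK hC hD) (hinv.exists_forth hK hH hC hD')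
  · rw [hg.dom_eq]
    exact Set.countable_iUnion fun i => hC.homogeneous.countable_cl hH (hD i)
  · change g.inv.dom.Countable
    rw [hinv.dom_eq]
    exact Set.countable_iUnion fun i => hC.homogeneous.countable_cl hK (hD' i)

end CrownMap

/-! ### Amalgamation of partial embeddings -/

/-- The tuple depends on a finite part E of the basis. Fix cl(E ∩ Y) pointwise and move E \ Y
injectively into B₀ \ E, which is possible because B₀ is infinite. As B₀ lies in Y and in every Z i,
points of cl(Z i) land in cl(Y ∩ Z i). -/
theorem Homogeneous.exists_shift {C : Set (ClStr.{u} L)} (hC : Homogeneous C) {H : ClStr.{u} L}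
    (hH : H ∈ C) {B B₀ Y : Set H.carrier} (hB : Indep H.cl B) (hB₀ : B₀.Infinite) (hYB : Y ⊆ B)
    (hB₀Y : B₀ ⊆ Y) {A : Set H.carrier} (hA : A.Finite) (hAY : A ⊆ H.cl Y) {ι : Type} [Finite ι]
    (Z : ι → Set H.carrier) (hZB : ∀ i, Z i ⊆ B) (hB₀Z : ∀ i, B₀ ⊆ Z i) (d : ι → H.carrier)
    (hd : ∀ i, d i ∈ H.cl (Z i)) :
    ∃ σ : SetRel H.carrier H.carrier, PartialEmb H H σ ∧ (∀ a ∈ A, (a, a) ∈ σ) ∧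
      ∀ i, ∃ c ∈ H.cl (Y ∩ Z i), (d i, c) ∈ σ := by
  have pH := hC.pregeometry H hH
  obtain ⟨E₁, hE₁, hE₁Y, hAE₁⟩ := pH.exists_finite_support hA hAY
  choose E₂ hE₂ hE₂Z hdE₂ using fun i => pH.finite_char _ _ (hd i)
  let E : Set H.carrier := E₁ ∪ ⋃ i, E₂ i
  have hE : E.Finite := hE₁.union (Set.finite_iUnion hE₂)
  have hEB : E ⊆ B := Set.union_subset (hE₁Y.trans hYB)
    (Set.iUnion_subset fun i => (hE₂Z i).trans (hZB i))
  have hinf : (B₀ \ E).Infinite := hB₀.sdiff hE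
  have hne : Nonempty H.carrier := ⟨hB₀.nonempty.some⟩
  obtain ⟨θ, hθB, hθ⟩ := (hE.sdiff (t := Y)).exists_injOn_of_encard_le (t := B₀ \ E)
    (by rw [hinf.encard_eq]; exact le_top)
  have hθB' : ∀ t ∈ E \ Y, θ t ∈ B₀ \ E := fun t ht => hθB ht
  have hEY : (E ∩ Y).Finite := hE.inter_of_left _
  have hid : SetRel.dom {p : H.carrier × H.carrier | p.1 ∈ H.cl (E ∩ Y) ∧ p.1 = p.2} =
      H.cl (E ∩ Y) := by
    ext x; simp [SetRel.mem_dom]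
  have hid' : SetRel.cod {p : H.carrier × H.carrier | p.1 ∈ H.cl (E ∩ Y) ∧ p.1 = p.2} =
      H.cl (E ∩ Y) := by
    ext x; simp [SetRel.mem_cod]
  obtain ⟨σ, hidσ, hσ, hσd, _, hσθ⟩ := hC.exists_extension_indep hH hH
    (PartialEmb.id_rel H (H.cl (E ∩ Y))) hEY hEY (T := E \ Y) hE.sdiff hid hid' hB hB
    (Set.inter_subset_left.trans hEB) (Set.sdiff_subset.trans hEB)
    (Set.disjoint_left.2 fun x hx hx' => hx'.2 hx.2) θ hθ
    (Set.inter_subset_left.trans hEB) (by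
      rintro _ ⟨t, ht, rfl⟩
      exact hYB (hB₀Y (hθB' t ht).1))
    (by
      rw [Set.disjoint_left]
      rintro _ hx ⟨t, ht, rfl⟩
      exact (hθB' t ht).2 hx.1)
  rw [Set.inter_union_sdiff] at hσd
  have hself : ∀ x ∈ H.cl (E ∩ Y), (x, x) ∈ σ := fun x hx => hidσ ⟨hx, rfl⟩
  refine ⟨σ, hσ, fun a ha => hself a ?_, fun i => ?_⟩
  · exact pH.mono E₁ (E ∩ Y) (fun x hx => ⟨Or.inl hx, hE₁Y hx⟩) (hAE₁ ha)
  · have hEi : E₂ i ⊆ E := Set.subset_union_of_subset_right (Set.subset_iUnion E₂ i) _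
    have : d i ∈ σ.dom := hσd ▸ pH.mono _ _ hEi (hdE₂ i)
    obtain ⟨c, hc⟩ := this
    refine ⟨c, hC.mem_cl_of_mem hH hH hσ (fun x hx => ?_) (hdE₂ i) hc, hc⟩
    by_cases hxY : x ∈ Y
    · exact ⟨x, pH.subset_cl _ ⟨hxY, hE₂Z i hx⟩, hself x (pH.subset_cl _ ⟨hEi hx, hxY⟩)⟩
    · have := (hθB' x ⟨hEi hx, hxY⟩).1
      exact ⟨θ x, pH.subset_cl _ ⟨hB₀Y this, hB₀Z i this⟩, hσθ x ⟨hEi hx, hxY⟩⟩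

/-- With σ from `exists_shift`, the composite of σ, f, F⁻¹, σ⁻¹ and F is a partial embedding that
sends each (p i).1 to (p i).2. On points over cl Y it acts as f, because σ fixes the relevant
points; on points over cl Z it acts as F, because f and F agree on cl(Y ∩ Z), where σ puts them. -/
theorem Homogeneous.sameAtomic_amalgam {C : Set (ClStr.{u} L)} (hC : Homogeneous C)
    {H K : ClStr.{u} L} (hH : H ∈ C) {B B₀ Y : Set H.carrier} (hB : Indep H.cl B)
    (hB₀ : B₀.Infinite) (hYB : Y ⊆ B) (hB₀Y : B₀ ⊆ Y) {f F : SetRel H.carrier K.carrier}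
    (hf : PartialEmb H K f) (hF : PartialEmb H K F) {n : ℕ} (p : Fin n → H.carrier × K.carrier)
    (hp : ∀ i, (p i ∈ f ∧ (p i).1 ∈ H.cl Y ∧ ∃ x ∈ H.cl Y, (x, (p i).2) ∈ F) ∨
      (p i ∈ F ∧ ∃ Z, Z ⊆ B ∧ B₀ ⊆ Z ∧ (p i).1 ∈ H.cl Z ∧
        ∀ c ∈ H.cl (Y ∩ Z), ∃ c', (c, c') ∈ f ∧ (c, c') ∈ F)) :
    SameAtomic L (fun i => (p i).1) (fun i => (p i).2) := by
  let J : Type := {i // p i ∈ F ∧ ∃ Z, Z ⊆ B ∧ B₀ ⊆ Z ∧ (p i).1 ∈ H.cl Z ∧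
        ∀ c ∈ H.cl (Y ∩ Z), ∃ c', (c, c') ∈ f ∧ (c, c') ∈ F}
  let I : Type := {i // p i ∈ f ∧ (p i).1 ∈ H.cl Y ∧ ∃ x ∈ H.cl Y, (x, (p i).2) ∈ F}
  choose Z hZB hB₀Z hZ hZf using fun j : J => j.2.2
  choose q hqY hq using fun i : I => i.2.2.2
  obtain ⟨σ, hσ, hσA, hσZ⟩ := hC.exists_shift hH hB hB₀ hYB hB₀Y
    (A := Set.range (fun i : I => (p i).1) ∪ Set.range q)
    ((Set.finite_range _).union (Set.finite_range _))
    (Set.union_subset (by rintro _ ⟨i, rfl⟩; exact i.2.2.1) (by rintro _ ⟨i, rfl⟩; exact hqY i))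
    Z hZB hB₀Z (fun j => (p j).1) hZ
  have key : ∀ i, ∃ m m' x, ((p i).1, m) ∈ σ ∧ (m, m') ∈ f.comp F.inv ∧ (m', x) ∈ σ.inv ∧
      (x, (p i).2) ∈ F := by
    intro i
    rcases hp i with h | h
    · exact ⟨(p i).1, q ⟨i, h⟩, q ⟨i, h⟩, hσA _ (Or.inl ⟨⟨i, h⟩, rfl⟩),
        ⟨(p i).2, h.1, hq ⟨i, h⟩⟩, hσA _ (Or.inr ⟨⟨i, h⟩, rfl⟩), hq ⟨i, h⟩⟩
    · obtain ⟨c, hc, hdc⟩ := hσZ ⟨i, h⟩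
      obtain ⟨c', hc1, hc2⟩ := hZf ⟨i, h⟩ c hc
      exact ⟨c, c, (p i).1, hdc, ⟨c', hc1, hc2⟩, hdc, h.1⟩
  choose m m' x h1 h2 h3 h4 using key
  exact (((hσ.sameAtomic h1).trans ((hf.comp hF.inv).sameAtomic h2)).trans
    (hσ.inv.sameAtomic h3)).trans (hF.sameAtomic h4)

end Crowns


/-! ### Categoricity in every dimension -/

section Categoricity

variable {L : FirstOrder.Language.{v, w}}

/-- The relation `r` extends the bijection `ψ` on `B₀ ∪ X` to the closures. -/
structure ExtendsOn {H K : ClStr.{u} L} (ψ : H.carrier → K.carrier) (B B₀ : Set H.carrier)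
    (r : SetRel H.carrier K.carrier) (X : Set H.carrier) : Prop where
  finite : X.Finite
  subset : X ⊆ B
  mem : ∀ b ∈ B₀ ∪ X, (b, ψ b) ∈ r
  dom : H.cl (B₀ ∪ X) ⊆ r.dom
  cod : K.cl (ψ '' (B₀ ∪ X)) ⊆ r.cod

namespace ExtendsOn

variable {C : Set (ClStr.{u} L)} {H K : ClStr.{u} L} {ψ : H.carrier → K.carrier}
  {B B₀ : Set H.carrier} {r s : SetRel H.carrier K.carrier} {X Y : Set H.carrier}

theorem mono (h : ExtendsOn ψ B B₀ r X) (hrs : r ⊆ s) : ExtendsOn ψ B B₀ s X :=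
  ⟨h.finite, h.subset, fun b hb => hrs (h.mem b hb), h.dom.trans (SetRel.dom_mono hrs),
    h.cod.trans (SetRel.cod_mono hrs)⟩

theorem anti (hC : Homogeneous C) (hH : H ∈ C) (hK : K ∈ C) (h : ExtendsOn ψ B B₀ r X)
    (hYX : Y ⊆ X) : ExtendsOn ψ B B₀ r Y :=
  ⟨h.finite.subset hYX, hYX.trans h.subset,
    fun b hb => h.mem b (Set.union_subset_union_right _ hYX hb),
    ((hC.pregeometry H hH).mono _ _ (Set.union_subset_union_right _ hYX)).trans h.dom,
    ((hC.pregeometry K hK).mono _ _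
      (Set.image_mono (Set.union_subset_union_right _ hYX))).trans h.cod⟩

theorem image (hr : PartialEmb H K r) (h : ExtendsOn ψ B B₀ r X) :
    r.image (B₀ ∪ X) = ψ '' (B₀ ∪ X) := by
  ext y
  constructor
  · rintro ⟨x, hx, hxy⟩
    exact ⟨x, hx, hr.right_unique (h.mem x hx) hxy⟩
  · rintro ⟨x, hx, rfl⟩
    exact ⟨x, hx, h.mem x hx⟩

theorem image_cl (hC : Homogeneous C) (hH : H ∈ C) (hK : K ∈ C) (hr : PartialEmb H K r)
    (h : ExtendsOn ψ B B₀ r X) : r.image (H.cl (B₀ ∪ X)) = K.cl (ψ '' (B₀ ∪ X)) := by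
  rw [← h.image hr]
  exact hC.image_cl hH hK hr h.dom (by rw [h.image hr]; exact h.cod)

end ExtendsOn

/-- One step of the construction: if `r` extends `ψ` on all proper subsets of `X`, then suitable
countable parts of `r` extend to `X`. -/
theorem QME.exists_extendsOn {C : Set (ClStr.{u} L)} (hC : QME C) {H K : ClStr.{u} L}
    (hH : H ∈ C) (hK : K ∈ C) {B B₀ : Set H.carrier} (hB : Indep H.cl B) (hB₀B : B₀ ⊆ B)
    (hB₀ : B₀.Countable) {ψ : H.carrier → K.carrier} (hψ : Set.InjOn ψ B)
    (hB' : Indep K.cl (ψ '' B)) {r : SetRel H.carrier K.carrier} (hr : PartialEmb H K r)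
    {X : Set H.carrier} (hXf : X.Finite) (hXB : X ⊆ B) (hX : ∀ Y, Y ⊂ X → ExtendsOn ψ B B₀ r Y)
    (hXr : ¬ ExtendsOn ψ B B₀ r X) {κ : Type} [Finite κ] (Z : κ → Set H.carrier)
    (hZ : ∀ k, ExtendsOn ψ B B₀ r (Z k)) :
    ∃ F, PartialEmb H K F ∧ ExtendsOn ψ B B₀ F X ∧
      (∀ p ∈ r, ∀ k, p.1 ∈ H.cl (B₀ ∪ Z k) → p ∈ F) ∧
      ∀ p ∈ r, ∀ Y, Y ⊂ X → p.1 ∈ H.cl (B₀ ∪ Y) → p ∈ F := by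
  have hCh := hC.homogeneous
  have pH := hC.pregeometry H hH
  have pK := hC.pregeometry K hK
  rcases X.eq_empty_or_nonempty with rfl | hXne
  · obtain ⟨F, hF, hFd, hFc, hFψ⟩ := hCh.exists_extension_countable_indep hH hK
      (hB.subset pH hB₀B) hB₀ ψ (hψ.mono hB₀B) (hB'.subset pK (Set.image_mono hB₀B))
    refine ⟨F, hF, ⟨hXf, hXB, by simpa using hFψ, by simp [hFd], by simp [hFc]⟩,
      fun p _ k _ => ?_, fun p _ Y hY => ?_⟩
    -- For X = ∅ there is nothing to preserve: any Z k covered by r would make r cover ∅ as well.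
    · exact (hXr ((hZ k).anti hCh hH hK (Set.empty_subset _))).elim
    · exact (hY.2 (Set.empty_subset _)).elim
  obtain ⟨m, ⟨e⟩⟩ := hXf.to_subtype.exists_equiv_fin
  -- The crown has two kinds of pieces: over the prescribed sets Z k, and over X with one point
  -- removed, which together account for all proper subsets of X.
  let W : κ ⊕ Fin m → Set H.carrier := Sum.elim Z fun i => X \ {(e.symm i : H.carrier)}
  have hW : ∀ i, ExtendsOn ψ B B₀ r (W i) := by
    rintro (k | i)
    · exact hZ k
    · refine hX _ ⟨Set.sdiff_subset, fun h => ?_⟩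
      exact (h (e.symm i).2).2 rfl
  let D : κ ⊕ Fin m → Set H.carrier := fun i => B₀ ∪ W i
  have hDc : ∀ i, (D i).Countable := fun i => hB₀.union (hW i).finite.countable
  have hDB : ∀ i, D i ⊆ B := fun i => Set.union_subset hB₀B (hW i).subset
  let g : SetRel H.carrier K.carrier := {p ∈ r | p.1 ∈ ⋃ i, H.cl (D i)}
  have hgr : g ⊆ r := fun p hp => hp.1
  have hgD : ∀ i, g.image (H.cl (D i)) = K.cl (ψ '' D i) := by
    intro i
    rw [← (hW i).image_cl hCh hH hK hr]
    ext y
    exact ⟨fun ⟨x, hx, hxy⟩ => ⟨x, hx, hgr hxy⟩,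
      fun ⟨x, hx, hxy⟩ => ⟨x, hx, hxy, Set.mem_iUnion.2 ⟨i, hx⟩⟩⟩
  have hg : CrownMap H K B D g := by
    refine ⟨hB, hDB, hr.mono hgr, ?_, fun i => ?_⟩
    · ext x
      constructor
      · rintro ⟨y, hy⟩; exact hy.2
      · intro hx
        obtain ⟨i, hi⟩ := Set.mem_iUnion.1 hx
        obtain ⟨y, hy⟩ := (hW i).dom hi
        exact ⟨y, hy, hx⟩
    · rw [hgD]
      exact pK.idem _
  obtain ⟨F₁, hgF₁, hF₁, hF₁d, hF₁c⟩ := hg.exists_extension hH hK hC hDc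
  have hrF₁ : ∀ p ∈ r, ∀ i, p.1 ∈ H.cl (D i) → p ∈ F₁ :=
    fun p hp i hi => hgF₁ ⟨hp, Set.mem_iUnion.2 ⟨i, hi⟩⟩
  have hrF₂ : ∀ p ∈ r, ∀ Y, Y ⊂ X → p.1 ∈ H.cl (B₀ ∪ Y) → p ∈ F₁ := by
    intro p hp Y hY hpY
    obtain ⟨x, hx, hxY⟩ := Set.exists_of_ssubset hY
    refine hrF₁ p hp (Sum.inr (e ⟨x, hx⟩)) (pH.mono _ _ (Set.union_subset_union_right _ ?_) hpY)
    intro y hy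
    exact ⟨hY.1 hy, fun h => hxY (by
      rw [Set.mem_singleton_iff, e.symm_apply_apply] at h; subst h; exact hy)⟩
  have hψF₁ : ∀ i, ∀ b ∈ D i, (b, ψ b) ∈ F₁ := fun i b hb =>
    hrF₁ _ ((hW i).mem b hb) i (pH.subset_cl _ hb)
  have hF₁d' : F₁.dom = H.cl (⋃ i, D i) := by
    rw [hF₁d, hg.dom_eq]
    apply Set.Subset.antisymm
    · exact pH.cl_subset (Set.iUnion_subset fun i => pH.mono _ _ (Set.subset_iUnion D i))
    · exact pH.mono _ _ (Set.iUnion_mono fun i => pH.subset_cl _)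
  have hgc : g.cod = ⋃ i, K.cl (ψ '' D i) := by
    simp only [← hgD, ← SetRel.image_iUnion]
    rw [SetRel.image_eq_cod_of_dom_subset]
    rw [hg.dom_eq]
  have hF₁c' : F₁.cod = K.cl (ψ '' ⋃ i, D i) := by
    rw [hF₁c, hgc, Set.image_iUnion]
    apply Set.Subset.antisymm
    · exact pK.cl_subset (Set.iUnion_subset fun i =>
        pK.mono _ _ (Set.subset_iUnion (fun i => ψ '' D i) i))
    · exact pK.mono _ _ (Set.iUnion_mono fun i => pK.subset_cl _)
  have hB₀D : B₀ ⊆ ⋃ i, D i := by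
    obtain ⟨x, hx⟩ := hXne
    exact fun b hb => Set.mem_iUnion.2 ⟨Sum.inr (e ⟨x, hx⟩), Or.inl hb⟩
  -- The crown can miss a point x of X only if X = {x}, since otherwise x survives the removal of
  -- another point. Such an x is generic over the closure of the crown and is sent to ψ x.
  by_cases hXD : X ⊆ ⋃ i, D i
  · refine ⟨F₁, hF₁, ⟨hXf, hXB, fun b hb => ?_, ?_, ?_⟩, fun p hp k => hrF₁ p hp (Sum.inl k),
      hrF₂⟩
    · obtain ⟨i, hi⟩ := Set.mem_iUnion.1 (Set.union_subset hB₀D hXD hb)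
      exact hψF₁ i b hi
    · rw [hF₁d']; exact pH.mono _ _ (Set.union_subset hB₀D hXD)
    · rw [hF₁c']; exact pK.mono _ _ (Set.image_mono (Set.union_subset hB₀D hXD))
  · obtain ⟨x, hx, hxD⟩ := Set.not_subset.1 hXD
    have hUB : (⋃ i, D i) ⊆ B := Set.iUnion_subset hDB
    have hUc : (⋃ i, D i).Countable := Set.countable_iUnion hDc
    have hcl1 : CtblClosedOrEmpty H F₁.dom :=
      Or.inr ⟨hF₁d' ▸ hCh.countable_cl hH hUc, hF₁d' ▸ pH.idem _⟩
    have hcl2 : CtblClosedOrEmpty K F₁.cod :=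
      Or.inr ⟨hF₁c' ▸ hCh.countable_cl hK (hUc.image ψ), hF₁c' ▸ pK.idem _⟩
    obtain ⟨F, hF₁F, hxF, hF, hFd, hFc⟩ := hCh.exists_extension_generic hH hK hF₁ hUc
      (hUc.image ψ) hF₁d' hF₁c' (hC.homOver hH hK hF₁ hcl1 hcl2)
      (hC.homOver hK hH hF₁.inv hcl2 hcl1) (x := x) (x' := ψ x)
      (hB.notMem_cl pH hUB (hXB hx) hxD)
      (hB'.notMem_cl pK (Set.image_mono hUB) ⟨x, hXB hx, rfl⟩ (by
        rintro ⟨y, hy, hyx⟩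
        exact hxD (hψ (hUB hy) (hXB hx) hyx ▸ hy)))
    have hXx : X ⊆ insert x (⋃ i, D i) := by
      intro y hy
      by_cases hyx : y = x
      · exact Or.inl hyx
      · refine (hxD (Set.mem_iUnion.2 ⟨Sum.inr (e ⟨y, hy⟩), Or.inr ⟨hx, ?_⟩⟩)).elim
        rw [e.symm_apply_apply]
        exact fun h => hyx (Set.mem_singleton_iff.1 h).symm
    have hBX : B₀ ∪ X ⊆ insert x (⋃ i, D i) :=
      Set.union_subset (hB₀D.trans (Set.subset_insert _ _)) hXx
    refine ⟨F, hF, ⟨hXf, hXB, fun b hb => ?_, ?_, ?_⟩,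
      fun p hp k hk => hF₁F (hrF₁ p hp (Sum.inl k) hk), fun p hp Y hY h => hF₁F (hrF₂ p hp Y hY h)⟩
    · rcases hBX hb with rfl | hb
      · exact hxF
      · obtain ⟨i, hi⟩ := Set.mem_iUnion.1 hb
        exact hF₁F (hψF₁ i b hi)
    · rw [hFd]; exact pH.mono _ _ hBX
    · rw [hFc, ← Set.image_insert_eq]; exact pK.mono _ _ (Set.image_mono hBX)

/-- The system of partial embeddings that are unions of extensions of `ψ` has a member that extends
`ψ` on all finite sets. -/
theorem QME.exists_extendsOn_all {C : Set (ClStr.{u} L)} (hC : QME C) {H K : ClStr.{u} L}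
    (hH : H ∈ C) (hK : K ∈ C) {B B₀ : Set H.carrier} (hB : Indep H.cl B) (hB₀B : B₀ ⊆ B)
    (hB₀ : B₀.Countable) (hB₀i : B₀.Infinite) {ψ : H.carrier → K.carrier} (hψ : Set.InjOn ψ B)
    (hB' : Indep K.cl (ψ '' B)) :
    ∃ r, PartialEmb H K r ∧ ∀ X : Set H.carrier, X.Finite → X ⊆ B → ExtendsOn ψ B B₀ r X := by
  have hCh := hC.homogeneous
  have pH := hC.pregeometry H hH
  -- Admissible relations are unions of full pieces: every pair lies over some cl(B₀ ∪ X) that the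
  -- relation covers together with its image.
  obtain ⟨r, hr⟩ := zorn_subset {r : SetRel H.carrier K.carrier | PartialEmb H K r ∧
      ∀ p ∈ r, ∃ X, ExtendsOn ψ B B₀ r X ∧ p.1 ∈ H.cl (B₀ ∪ X)} (by
    intro c hc hchain
    rcases c.eq_empty_or_nonempty with rfl | hne
    · exact ⟨∅, ⟨hC.empty_map H hH K hK, by simp⟩, by simp⟩
    · refine ⟨⋃₀ c, ⟨PartialEmb.sUnion hchain.directedOn hne fun r hr => (hc hr).1, ?_⟩,
        fun s hs => Set.subset_sUnion_of_mem hs⟩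
      rintro p ⟨s, hs, hps⟩
      obtain ⟨X, hX, hpX⟩ := (hc hs).2 p hps
      exact ⟨X, hX.mono (Set.subset_sUnion_of_mem hs), hpX⟩)
  obtain ⟨hre, hrX⟩ := hr.prop
  have main : ∀ X : Finset H.carrier, (X : Set H.carrier) ⊆ B → ExtendsOn ψ B B₀ r X := by
    intro X
    induction X using Finset.strongInduction with
    | H X ih =>
    intro hXB
    by_contra hXr
    have hX : ∀ Y : Set H.carrier, Y ⊂ X → ExtendsOn ψ B B₀ r Y := by
      intro Y hY
      lift Y to Finset H.carrier using X.finite_toSet.subset hY.1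
      exact ih Y (by exact_mod_cast hY) (hY.1.trans hXB)
    -- This candidate map on cl(B₀ ∪ X) is chosen once, with no prescribed sets Z k; it agrees with
    -- r over all proper subsets of X.
    obtain ⟨f₀, hf₀, hf₀X, _, hf₀r⟩ := hC.exists_extendsOn hH hK hB hB₀B hB₀ hψ hB' hre
      X.finite_toSet hXB hX hXr (κ := Empty) (fun k => k.elim) (fun k => k.elim)
    let f : SetRel H.carrier K.carrier := {p ∈ f₀ | p.1 ∈ H.cl (B₀ ∪ X)}
    have hff₀ : f ⊆ f₀ := fun p hp => hp.1
    have hfX : ExtendsOn ψ B B₀ f X := by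
      refine ⟨X.finite_toSet, hXB, fun b hb => ⟨hf₀X.mem b hb, pH.subset_cl _ hb⟩, ?_, ?_⟩
      · intro x hx
        obtain ⟨y, hy⟩ := hf₀X.dom hx
        exact ⟨y, hy, hx⟩
      · rw [← hf₀X.image_cl hCh hH hK hf₀]
        rintro y ⟨x, hx, hxy⟩
        exact ⟨x, hxy, hx⟩
    have hfr : r ∪ f ∈ {r : SetRel H.carrier K.carrier | PartialEmb H K r ∧
        ∀ p ∈ r, ∃ X, ExtendsOn ψ B B₀ r X ∧ p.1 ∈ H.cl (B₀ ∪ X)} := by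
      refine ⟨partialEmb_iff.2 fun n p hp => ?_, ?_⟩
      · let J : Type := {j // p j ∈ r}
        choose Z hZ hpZ using fun j : J => hrX _ j.2
        -- Only now, for one finite tuple, are finitely many pieces Z of r involved, and a second
        -- extension F contains r on all of them. It need not agree with f over X, which is why the
        -- amalgamation lemma is needed.
        obtain ⟨F, hF, hFX, hFZ, hFr⟩ := hC.exists_extendsOn hH hK hB hB₀B hB₀ hψ hB' hre
          X.finite_toSet hXB hX hXr Z hZ
        refine hCh.sameAtomic_amalgam hH hB hB₀i (Y := B₀ ∪ X) (Set.union_subset hB₀B hXB)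
          Set.subset_union_left (hf₀.mono hff₀) hF p fun i => ?_
        rcases hp i with h | h
        · refine Or.inr ⟨hFZ _ h ⟨i, h⟩ (hpZ ⟨i, h⟩), B₀ ∪ Z ⟨i, h⟩,
            Set.union_subset hB₀B (hZ _).subset, Set.subset_union_left, hpZ _, fun c hc => ?_⟩
          rw [← Set.union_inter_distrib_left] at hc
          -- If X were contained in Z, then r would already cover X. Over the proper subset X ∩ Z
          -- both f and F agree with r, hence with each other.
          have hss : (X : Set H.carrier) ∩ Z ⟨i, h⟩ ⊂ X :=
            ⟨Set.inter_subset_left, fun hle =>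
              hXr ((hZ _).anti hCh hH hK (hle.trans Set.inter_subset_right))⟩
          obtain ⟨c', hc'⟩ := (hX _ hss).dom hc
          exact ⟨c', ⟨hf₀r _ hc' _ hss hc, pH.mono _ _
            (Set.union_subset_union_right _ Set.inter_subset_left) hc⟩, hFr _ hc' _ hss hc⟩
        · refine Or.inl ⟨h, h.2, ?_⟩
          have h1 : (p i).2 ∈ f₀.image (H.cl (B₀ ∪ X)) := ⟨_, h.2, h.1⟩
          rw [hf₀X.image_cl hCh hH hK hf₀, ← hFX.image_cl hCh hH hK hF] at h1
          exact h1
      · rintro p (h | h)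
        · obtain ⟨Z, hZ, hpZ⟩ := hrX p h
          exact ⟨Z, hZ.mono Set.subset_union_left, hpZ⟩
        · exact ⟨X, hfX.mono Set.subset_union_right, h.2⟩
    exact hXr (hfX.mono ((Set.subset_union_right).trans (hr.le_of_ge hfr Set.subset_union_left)))
  refine ⟨r, hre, fun X hXf hXB => ?_⟩
  lift X to Finset H.carrier using hXf
  exact main X hXB

theorem QME.iso_of_bases {C : Set (ClStr.{u} L)} (hC : QME C) {H K : ClStr.{u} L}
    (hH : H ∈ C) (hK : K ∈ C) {B : Set H.carrier} (hB : Indep H.cl B)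
    (hBs : H.cl B = Set.univ) {ψ : H.carrier → K.carrier} (hψ : Set.InjOn ψ B)
    (hB' : Indep K.cl (ψ '' B)) (hBs' : K.cl (ψ '' B) = Set.univ) : H.Iso K := by
  have hCh := hC.homogeneous
  have pH := hC.pregeometry H hH
  have pK := hC.pregeometry K hK
  by_cases hBc : B.Countable
  · exact hCh.iso_of_countable_bases hH hK hB hBs hBc ψ hψ hB' hBs'
  have hBi : B.Infinite := fun h => hBc h.countable
  obtain ⟨B₀, hB₀B, hB₀, hB₀i⟩ := hBi.exists_subset_countable_infinite
  obtain ⟨r, hr, hrX⟩ := hC.exists_extendsOn_all hH hK hB hB₀B hB₀ hB₀i hψ hB'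
  refine hCh.iso_of_total hH hK hr (Set.eq_univ_of_forall fun x => ?_)
    (Set.eq_univ_of_forall fun y => ?_)
  · obtain ⟨X, hX, hXB, hxX⟩ := pH.finite_char B x (hBs ▸ Set.mem_univ x)
    exact (hrX X hX hXB).dom (pH.mono _ _ Set.subset_union_right hxX)
  · obtain ⟨Y, hY, hYB, hyY⟩ := pK.finite_char (ψ '' B) y (hBs' ▸ Set.mem_univ y)
    obtain ⟨X, hXB, rfl⟩ := Set.subset_image_iff.1 hYB
    have hX : X.Finite := Set.Finite.of_finite_image hY (hψ.mono hXB)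
    exact (hrX X hX hXB).cod (pK.mono _ _ (Set.image_mono Set.subset_union_right) hyY)

theorem exists_injOn_image_eq {α β : Type u} [Nonempty β] {A : Set α} {B : Set β}
    (h : #A = #B) : ∃ ψ : α → β, Set.InjOn ψ A ∧ ψ '' A = B := by
  classical
  obtain ⟨e⟩ := Cardinal.eq.1 h
  refine ⟨fun a => if ha : a ∈ A then e ⟨a, ha⟩ else Classical.arbitrary β, ?_, ?_⟩
  · intro x hx y hy hxy
    simp only [hx, hy, dif_pos] at hxy
    simpa using e.injective (Subtype.ext hxy)
  · ext y
    constructor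
    · rintro ⟨x, hx, rfl⟩
      simp [hx]
    · intro hy
      exact ⟨e.symm ⟨y, hy⟩, by simp⟩

/-- A total function ψ on the carrier of H need not exist when K is empty; then both bases are empty
and the empty map is extended to the closures. -/
theorem Homogeneous.iso_of_isEmpty {C : Set (ClStr.{u} L)} (hC : Homogeneous C)
    {H K : ClStr.{u} L} (hH : H ∈ C) (hK : K ∈ C) {B : Set H.carrier} {B' : Set K.carrier}
    (hBs : H.cl B = Set.univ) (hBs' : K.cl B' = Set.univ) (hBB' : #B = #B')
    [hKe : IsEmpty K.carrier] : H.Iso K := by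
  have hB' : B' = ∅ := Set.eq_empty_of_forall_notMem fun a ha => hKe.false a
  have hB : B = ∅ := by
    rw [hB', Cardinal.mk_eq_zero (∅ : Set K.carrier), Cardinal.mk_set_eq_zero_iff] at hBB'
    exact hBB'
  subst hB hB'
  obtain ⟨F, _, hF, hFd, hFc⟩ := hC.exists_extension_finite hH hK Set.finite_empty
    (hC.empty_map H hH K hK)
  exact hC.iso_of_total hH hK hF (by simpa [hBs] using hFd) (by simpa [hBs'] using hFc)

/-- Categoricity in countable dimensions. -/
theorem Homogeneous.iso_of_hasDim {C : Set (ClStr.{u} L)} (hC : Homogeneous C)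
    {H K : ClStr.{u} L} (hH : H ∈ C) (hK : K ∈ C) {κ : Cardinal.{u}} (hκ : κ ≤ ℵ₀)
    (h1 : HasDim H.cl κ) (h2 : HasDim K.cl κ) : H.Iso K := by
  obtain ⟨B, hB, hBs, hBκ⟩ := h1
  obtain ⟨B', hB', hBs', hBκ'⟩ := h2
  rcases isEmpty_or_nonempty K.carrier with hKe | hKe
  · exact hC.iso_of_isEmpty hH hK hBs hBs' (hBκ.trans hBκ'.symm)
  obtain ⟨ψ, hψ, rfl⟩ := exists_injOn_image_eq (hBκ.trans hBκ'.symm)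
  exact hC.iso_of_countable_bases hH hK hB hBs (by rwa [← hBκ, Cardinal.le_aleph0_iff_set_countable] at hκ)
    ψ hψ hB' hBs'

/-- Categoricity in every dimension. -/
theorem QME.iso_of_hasDim {C : Set (ClStr.{u} L)} (hC : QME C) {H K : ClStr.{u} L} (hH : H ∈ C)
    (hK : K ∈ C) {κ : Cardinal.{u}} (h1 : HasDim H.cl κ) (h2 : HasDim K.cl κ) : H.Iso K := by
  obtain ⟨B, hB, hBs, hBκ⟩ := h1
  obtain ⟨B', hB', hBs', hBκ'⟩ := h2
  rcases isEmpty_or_nonempty K.carrier with hKe | hKe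
  · exact hC.homogeneous.iso_of_isEmpty hH hK hBs hBs' (hBκ.trans hBκ'.symm)
  obtain ⟨ψ, hψ, rfl⟩ := exists_injOn_image_eq (hBκ.trans hBκ'.symm)
  exact hC.iso_of_bases hH hK hB hBs hψ hB' hBs'

end Categoricity


/-! ### Embeddings that commute with the closure operators -/

section ClosureEmbeddings

variable {L : FirstOrder.Language.{v, w}}

/-- An embedding onto a closed subset that identifies the closure operators. -/
def ClEmb (N H : ClStr.{u} L) (i : N.carrier ↪[L] H.carrier) : Prop :=
  ∀ Y : Set N.carrier, i '' N.cl Y = H.cl (i '' Y)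

/-- The closure of `X` in `H` is a copy of a member of `C`. -/
def Covered (C : Set (ClStr.{u} L)) (H : ClStr.{u} L) (X : Set H.carrier) : Prop :=
  ∃ N ∈ C, ∃ i : N.carrier ↪[L] H.carrier, ClEmb N H i ∧ Set.range i = H.cl X

theorem ClEmb.comp {N H K : ClStr.{u} L} {i : N.carrier ↪[L] H.carrier}
    {j : H.carrier ↪[L] K.carrier} (hj : ClEmb H K j) (hi : ClEmb N H i) :
    ClEmb N K (j.comp i) := by
  intro Y
  have : ∀ Z, (j.comp i) '' Z = j '' (i '' Z) := fun Z => by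
    rw [Set.image_image]; rfl
  rw [this, this, hi, hj]

theorem ClEmb.mem_cl_iff {N H : ClStr.{u} L} {i : N.carrier ↪[L] H.carrier} (hi : ClEmb N H i)
    {Y : Set N.carrier} {y : N.carrier} : i y ∈ H.cl (i '' Y) ↔ y ∈ N.cl Y := by
  rw [← hi]
  exact i.injective.mem_set_image

theorem ClEmb.isCl_preimage {N H : ClStr.{u} L} {i : N.carrier ↪[L] H.carrier}
    (hi : ClEmb N H i) {G : Set H.carrier} (hG : IsCl H.cl G) (hGi : G ⊆ Set.range i) :
    IsCl N.cl (i ⁻¹' G) := by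
  refine i.injective.image_injective ?_
  rw [hi, Set.image_preimage_eq_of_subset hGi]
  exact hG

theorem ClEmb.isCl_image {N H : ClStr.{u} L} {i : N.carrier ↪[L] H.carrier}
    (hi : ClEmb N H i) {G : Set N.carrier} (hG : IsCl N.cl G) : IsCl H.cl (i '' G) := by
  change H.cl (i '' G) = i '' G
  rw [← hi, hG]

theorem ClEmb.ctblClosedOrEmpty_preimage {N H : ClStr.{u} L} {i : N.carrier ↪[L] H.carrier}
    (hi : ClEmb N H i) {G : Set H.carrier} (hG : CtblClosedOrEmpty H G)
    (hGi : G ⊆ Set.range i) : CtblClosedOrEmpty N (i ⁻¹' G) := by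
  rcases hG with rfl | ⟨hc, hG⟩
  · exact Or.inl rfl
  · exact Or.inr ⟨hc.preimage_of_injOn i.injective.injOn, hi.isCl_preimage hG hGi⟩

theorem ClEmb.isPregeometry {N H : ClStr.{u} L} {i : N.carrier ↪[L] H.carrier}
    (hi : ClEmb N H i) (pH : IsPregeometry H.cl) : IsPregeometry N.cl where
  subset_cl X x hx := hi.mem_cl_iff.1 (pH.subset_cl _ ⟨x, hx, rfl⟩)
  mono X Y hXY x hx := hi.mem_cl_iff.1 (pH.mono _ _ (Set.image_mono hXY) (hi.mem_cl_iff.2 hx))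
  idem X := by
    refine i.injective.image_injective ?_
    rw [hi, hi, pH.idem]
  finite_char X a ha := by
    obtain ⟨Y, hY, hYX, haY⟩ := pH.finite_char _ _ (hi.mem_cl_iff.2 ha)
    obtain ⟨Z, hZ, rfl⟩ := Set.subset_image_iff.1 hYX
    exact ⟨Z, Set.Finite.of_finite_image hY i.injective.injOn, hZ, hi.mem_cl_iff.1 haY⟩
  exchange X a b ha ha' := by
    rw [← hi.mem_cl_iff, Set.image_insert_eq] at ha ⊢
    rw [← hi.mem_cl_iff] at ha'
    exact pH.exchange _ _ _ ha ha'

theorem ClEmb.hasDim {N H : ClStr.{u} L} {i : N.carrier ↪[L] H.carrier} (hi : ClEmb N H i)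
    (pH : IsPregeometry H.cl) {A : Set H.carrier} (hA : Indep H.cl A)
    (hAi : Set.range i = H.cl A) : HasDim N.cl #A := by
  have hAr : A ⊆ Set.range i := hAi ▸ pH.subset_cl A
  refine ⟨i ⁻¹' A, ?_, ?_, Cardinal.mk_preimage_of_injective_of_subset_range i A i.injective hAr⟩
  · intro b hb hb'
    refine hA (i b) hb (pH.mono _ _ ?_ (hi.mem_cl_iff.2 hb'))
    rintro _ ⟨c, ⟨hc, hcb⟩, rfl⟩
    exact ⟨hc, fun h => hcb (i.injective h)⟩
  · refine i.injective.image_injective ?_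
    rw [hi, Set.image_preimage_eq_of_subset hAr, ← hAi, Set.image_univ]

theorem ClStr.Iso.exists_clEmb {H K : ClStr.{u} L} (h : H.Iso K) :
    ∃ e : H.carrier ↪[L] K.carrier, ClEmb H K e ∧ Function.Surjective e := by
  obtain ⟨e, he⟩ := h
  exact ⟨e.toEmbedding, he, e.surjective⟩

theorem ClStr.Iso.symm {H K : ClStr.{u} L} (h : H.Iso K) : K.Iso H := by
  obtain ⟨e, he⟩ := h
  refine ⟨e.symm, fun X => ?_⟩
  refine e.injective.image_injective ?_
  have h1 : ∀ Y : Set K.carrier, e '' (e.symm '' Y) = Y := fun Y => by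
    simp [Set.image_image]
  rw [he, h1, h1]

/-- The inclusion of a substructure. -/
def ClStr.subEmb (H : ClStr.{u} L) (S : L.Substructure H.carrier) :
    (H.sub S).carrier ↪[L] H.carrier := S.subtype

theorem ClStr.range_subEmb (H : ClStr.{u} L) (S : L.Substructure H.carrier) :
    Set.range (H.subEmb S) = S := Subtype.range_coe

theorem clEmb_sub {H : ClStr.{u} L} (pH : IsPregeometry H.cl) {S : L.Substructure H.carrier}
    (hS : IsCl H.cl (S : Set H.carrier)) : ClEmb (H.sub S) H (H.subEmb S) := by
  intro Y
  ext x
  constructor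
  · rintro ⟨y, hy, rfl⟩
    exact hy
  · intro hx
    have : x ∈ (S : Set H.carrier) := by
      refine pH.cl_subset_of_isCl hS ?_ hx
      rintro _ ⟨y, _, rfl⟩
      exact y.2
    exact ⟨⟨x, this⟩, hx, rfl⟩

/-- An embedding with values in a substructure factors through it. -/
theorem ClEmb.exists_factor {N H : ClStr.{u} L} {i : N.carrier ↪[L] H.carrier}
    (hi : ClEmb N H i) {S : L.Substructure H.carrier} (hiS : Set.range i ⊆ S) :
    ∃ j : N.carrier ↪[L] (H.sub S).carrier, ClEmb N (H.sub S) j ∧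
      ∀ x, H.subEmb S (j x) = i x := by
  have h' : ∀ c, i c ∈ S := fun c => hiS ⟨c, rfl⟩
  let j : N.carrier ↪[L] (H.sub S).carrier := i.codRestrict S h'
  have hj : ∀ x, H.subEmb S (j x) = i x := fun x => i.codRestrict_apply S x (h := h')
  refine ⟨j, fun Y => ?_, hj⟩
  have him : H.subEmb S '' (j '' Y) = i '' Y := by
    rw [Set.image_image]; exact Set.image_congr fun x _ => hj x
  ext x
  change _ ↔ H.subEmb S x ∈ H.cl (H.subEmb S '' (j '' Y))
  rw [him, ← hi]
  constructor
  · rintro ⟨y, hy, rfl⟩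
    exact ⟨y, hy, (hj y).symm⟩
  · rintro ⟨y, hy, hyx⟩
    exact ⟨y, hy, (H.subEmb S).injective ((hj y).trans hyx)⟩

/-- Axiom (I.2) in an isomorphism-invariant form, in which "is in C" is replaced by "is the range of
a closure-preserving embedding of a member". -/
theorem QME.covered {C : Set (ClStr.{u} L)} (hC : QME C) {H : ClStr.{u} L} (hH : H ∈ C)
    (X : Set H.carrier) : Covered C H X := by
  obtain ⟨S, hS, hSC⟩ := hC.closure_mem H hH X
  have pH := hC.pregeometry H hH
  refine ⟨_, hSC, H.subEmb S, clEmb_sub pH (by rw [hS]; exact pH.idem X), ?_⟩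
  rw [← hS, H.range_subEmb]

theorem Covered.congr {C : Set (ClStr.{u} L)} {H : ClStr.{u} L} {X Y : Set H.carrier}
    (h : Covered C H X) (hXY : H.cl X = H.cl Y) : Covered C H Y := by
  obtain ⟨N, hN, i, hi, hr⟩ := h
  exact ⟨N, hN, i, hi, hr.trans hXY⟩

theorem PartialEmb.preimage {H K N N' : ClStr.{u} L} {r : SetRel H.carrier K.carrier}
    (h : PartialEmb H K r) (i : N.carrier ↪[L] H.carrier) (j : N'.carrier ↪[L] K.carrier) :
    PartialEmb N N' (Prod.map i j ⁻¹' r) :=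
  (PartialEmb.map_iff i j).1 (h.mono (Set.image_preimage_subset _ _))

theorem image_preimage_prodMap {α β γ δ : Type*} (i : α → β) (j : γ → δ) {r : SetRel β δ}
    (hd : r.dom ⊆ Set.range i) (hc : r.cod ⊆ Set.range j) :
    Prod.map i j '' (Prod.map i j ⁻¹' r) = r := by
  refine Set.image_preimage_eq_of_subset ?_
  rintro ⟨x, y⟩ hxy
  obtain ⟨a, rfl⟩ := hd ⟨y, hxy⟩
  obtain ⟨b, rfl⟩ := hc ⟨_, hxy⟩
  exact ⟨(a, b), rfl⟩

theorem dom_preimage_prodMap {α β γ δ : Type*} (i : α → β) (j : γ → δ) {r : SetRel β δ}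
    (hc : r.cod ⊆ Set.range j) : SetRel.dom (Prod.map i j ⁻¹' r) = i ⁻¹' r.dom := by
  ext x
  constructor
  · rintro ⟨y, hy⟩; exact ⟨j y, hy⟩
  · rintro ⟨y, hy⟩
    obtain ⟨b, rfl⟩ := hc ⟨_, hy⟩
    exact ⟨b, hy⟩

theorem cod_preimage_prodMap {α β γ δ : Type*} (i : α → β) (j : γ → δ) {r : SetRel β δ}
    (hd : r.dom ⊆ Set.range i) : SetRel.cod (Prod.map i j ⁻¹' r) = j ⁻¹' r.cod :=
  dom_preimage_prodMap j i (r := r.inv) hd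

theorem PartialEmb.finite_of_dom {H K : ClStr.{u} L} {r : SetRel H.carrier K.carrier}
    (h : PartialEmb H K r) (hd : r.dom.Finite) : r.Finite := by
  choose φ hφ using fun x : r.dom => x.2
  have := hd.to_subtype
  refine (Set.finite_range fun x : r.dom => ((x : H.carrier), φ x)).subset ?_
  rintro ⟨x, y⟩ hxy
  exact ⟨⟨x, y, hxy⟩, Prod.ext rfl (h.right_unique (hφ ⟨x, y, hxy⟩) hxy)⟩

/-- Homogeneity can be tested in covers by members of a quasiminimal excellent class. -/
theorem homOver_of_covered {C : Set (ClStr.{u} L)} (hC : QME C) {H K : ClStr.{u} L}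
    (pH : IsPregeometry H.cl) (pK : IsPregeometry K.cl) {g : SetRel H.carrier K.carrier}
    (h1 : CtblClosedOrEmpty H g.dom) (h2 : CtblClosedOrEmpty K g.cod)
    (hH : ∀ T : Set H.carrier, T.Finite → Covered C H (g.dom ∪ T))
    (hK : ∀ T : Set K.carrier, T.Finite → Covered C K (g.cod ∪ T)) : HomOver H K g := by
  intro f hf hgf y hy
  -- The codomain of f is finite too, so both structures have covers containing g and f; the
  -- extension problem is solved there and mapped back.
  have hff : f.Finite := (hgf.mono Set.subset_union_right).finite_of_dom hf
  obtain ⟨N, hN, i, hi, hir⟩ := hH f.dom hf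
  obtain ⟨N', hN', j, hj, hjr⟩ := hK f.cod (SetRel.cod_finite hff)
  have hgd : g.dom ⊆ Set.range i := hir ▸ Set.subset_union_left.trans (pH.subset_cl _)
  have hfd : f.dom ⊆ Set.range i := hir ▸ Set.subset_union_right.trans (pH.subset_cl _)
  have hgc : g.cod ⊆ Set.range j := hjr ▸ Set.subset_union_left.trans (pK.subset_cl _)
  have hfc : f.cod ⊆ Set.range j := hjr ▸ Set.subset_union_right.trans (pK.subset_cl _)
  have hyi : y ∈ Set.range i := by rwa [hir, Set.union_comm]
  obtain ⟨y₀, rfl⟩ := hyi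
  let g₀ : SetRel N.carrier N'.carrier := Prod.map i j ⁻¹' g
  let f₀ : SetRel N.carrier N'.carrier := Prod.map i j ⁻¹' f
  have hg₀d : g₀.dom = i ⁻¹' g.dom := dom_preimage_prodMap i j hgc
  have hf₀d : f₀.dom = i ⁻¹' f.dom := dom_preimage_prodMap i j hfc
  have hg₀c : g₀.cod = j ⁻¹' g.cod := cod_preimage_prodMap i j hgd
  have hg₀f₀ : PartialEmb N N' (g₀ ∪ f₀) := hgf.preimage i j
  obtain ⟨y', hy'⟩ := hC.homOver hN hN' (hg₀f₀.mono Set.subset_union_left)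
    (hg₀d ▸ hi.ctblClosedOrEmpty_preimage h1 hgd) (hg₀c ▸ hj.ctblClosedOrEmpty_preimage h2 hgc)
    f₀ (hf₀d ▸ hf.preimage i.injective.injOn) hg₀f₀ y₀ (by
      rw [← hi.mem_cl_iff, hf₀d, hg₀d, Set.image_union, Set.image_preimage_eq_of_subset hfd,
        Set.image_preimage_eq_of_subset hgd]
      exact hy)
  refine ⟨j y', ?_⟩
  have := (PartialEmb.map_iff (H := H) (K := K) i j).2 hy'
  rwa [Set.image_union, Set.image_union, image_preimage_prodMap i j hgd hgc,
    image_preimage_prodMap i j hfd hfc, Set.image_singleton] at this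

theorem generic_of_covered {C : Set (ClStr.{u} L)} (hC : QME C) {H K : ClStr.{u} L}
    (pH : IsPregeometry H.cl) (pK : IsPregeometry K.cl) {g : SetRel H.carrier K.carrier}
    (hg : PartialEmb H K g) (h1 : CtblClosedOrEmpty H g.dom) (h2 : CtblClosedOrEmpty K g.cod)
    {x : H.carrier} {x' : K.carrier} (hH : Covered C H (insert x g.dom))
    (hK : Covered C K (insert x' g.cod)) (hx : x ∉ H.cl g.dom) (hx' : x' ∉ K.cl g.cod) :
    PartialEmb H K (g ∪ {(x, x')}) := by
  obtain ⟨N, hN, i, hi, hir⟩ := hH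
  obtain ⟨N', hN', j, hj, hjr⟩ := hK
  have hgd : g.dom ⊆ Set.range i := hir ▸ (Set.subset_insert _ _).trans (pH.subset_cl _)
  have hgc : g.cod ⊆ Set.range j := hjr ▸ (Set.subset_insert _ _).trans (pK.subset_cl _)
  have hxi : x ∈ Set.range i := hir ▸ pH.subset_cl _ (Set.mem_insert _ _)
  have hxj : x' ∈ Set.range j := hjr ▸ pK.subset_cl _ (Set.mem_insert _ _)
  obtain ⟨x, rfl⟩ := hxi
  obtain ⟨x', rfl⟩ := hxj
  have hd := dom_preimage_prodMap i j hgc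
  have hc := cod_preimage_prodMap i j hgd
  have h3 := hC.homogeneity_generic N hN N' hN' _ _ (hi.ctblClosedOrEmpty_preimage h1 hgd)
    (hj.ctblClosedOrEmpty_preimage h2 hgc) (Prod.map i j ⁻¹' g) (hg.preimage i j) hd hc x x'
    (by rwa [← hi.mem_cl_iff, Set.image_preimage_eq_of_subset hgd])
    (by rwa [← hj.mem_cl_iff, Set.image_preimage_eq_of_subset hgc])
  have := (PartialEmb.map_iff (H := H) (K := K) i j).2 h3
  rwa [Set.image_union, image_preimage_prodMap i j hgd hgc, Set.image_singleton] at this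

end ClosureEmbeddings

/-! ### Structures whose finite-dimensional parts are in the class -/

section LocalClass

variable {L : FirstOrder.Language.{v, w}}

/-- The class of structures all of whose finite-dimensional closed subsets are in `C`. -/
def localClass (C : Set (ClStr.{u} L)) : Set (ClStr.{u} L) :=
  {H | IsPregeometry H.cl ∧ ∀ X : Set H.carrier, X.Finite → Covered C H X}

variable {C : Set (ClStr.{u} L)} (hC : QME C)
include hC

theorem QME.subset_localClass : C ⊆ localClass C :=
  fun H hH => ⟨hC.pregeometry H hH, fun X _ => hC.covered hH X⟩

/-- By finite character only finitely many pairs of f matter, and both sides of a finite relation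
lie in covers by members of C. -/
theorem localClass_closure_preserved {H K : ClStr.{u} L} (hH : H ∈ localClass C)
    (hK : K ∈ localClass C) (X : Set H.carrier) (y : H.carrier) (hy : y ∈ H.cl X)
    (f : SetRel H.carrier K.carrier) (hf : PartialEmb H K f) (hX : X ⊆ f.dom) (z : K.carrier)
    (hyz : (y, z) ∈ f) : z ∈ K.cl (f.image X) := by
  obtain ⟨pH, cH⟩ := hH
  obtain ⟨pK, cK⟩ := hK
  obtain ⟨Y, hY, hYX, hyY⟩ := pH.finite_char _ _ hy
  choose φ hφ using fun x : Y => hX (hYX x.2)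
  have := hY.to_subtype
  let s : SetRel H.carrier K.carrier := insert (y, z) (Set.range fun x : Y => ((x : H.carrier), φ x))
  have hsf : s ⊆ f := by
    rintro p (rfl | ⟨x, rfl⟩)
    · exact hyz
    · exact hφ x
  have hs : s.Finite := (Set.finite_range _).insert _
  obtain ⟨N, hN, i, hi, hir⟩ := cH Y hY
  obtain ⟨N', hN', j, hj, hjr⟩ := cK s.cod (SetRel.cod_finite hs)
  have hYi : Y ⊆ Set.range i := hir ▸ pH.subset_cl Y
  have hsc : s.cod ⊆ Set.range j := hjr ▸ pK.subset_cl _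
  have hyi : y ∈ Set.range i := hir ▸ hyY
  have hzj : z ∈ Set.range j := hsc ⟨y, Or.inl rfl⟩
  obtain ⟨y, rfl⟩ := hyi
  obtain ⟨z, rfl⟩ := hzj
  have h1 := hC.closure_preserved N hN N' hN' (i ⁻¹' Y) y
    (by rwa [← hi.mem_cl_iff, Set.image_preimage_eq_of_subset hYi]) (Prod.map i j ⁻¹' s)
    ((hf.mono hsf).preimage i j) (by
      rw [dom_preimage_prodMap i j hsc]
      intro x hx
      exact ⟨_, Or.inr ⟨⟨i x, hx⟩, rfl⟩⟩) z (Or.inl rfl)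
  rw [← hj.mem_cl_iff] at h1
  refine pK.mono _ _ ?_ h1
  rintro _ ⟨b, ⟨a, ha, hab⟩, rfl⟩
  exact ⟨i a, hYX ha, hsf hab⟩

/-- The local class is homogeneous. -/
theorem QME.homogeneous_localClass : Homogeneous (localClass C) where
  empty_map := by
    rintro H ⟨_, hH⟩ K ⟨_, hK⟩
    obtain ⟨N, hN, i, _⟩ := hH ∅ Set.finite_empty
    obtain ⟨N', hN', j, _⟩ := hK ∅ Set.finite_empty
    simpa using (PartialEmb.map_iff (H := H) (K := K) i j).2 (hC.empty_map N hN N' hN')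
  pregeometry H hH := hH.1
  ccp := by
    rintro H ⟨pH, hH⟩ X hX
    obtain ⟨N, hN, i, hi, hir⟩ := hH X hX
    have hXi : X ⊆ Set.range i := hir ▸ pH.subset_cl X
    rw [← Set.image_preimage_eq_of_subset hXi, ← hi]
    exact (hC.ccp N hN _ (hX.preimage i.injective.injOn)).image i
  closure_preserved H hH K hK := localClass_closure_preserved hC hH hK
  generic := by
    rintro H hH K hK G G' h1 h2 g hg rfl rfl x x' hx hx'
    have pH := hH.1
    have pK := hK.1
    -- The empty relation is treated separately, because its domain ∅ need not be closed.
    by_cases hge : g = ∅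
    · subst hge
      refine generic_of_covered hC pH pK hg h1 h2 ?_ ?_ hx hx'
      · exact hH.2 _ (by simp)
      · exact hK.2 _ (by simp)
    replace h1 : g.dom.Countable ∧ IsCl H.cl g.dom := h1.resolve_left (by simpa using hge)
    replace h2 : g.cod.Countable ∧ IsCl K.cl g.cod := h2.resolve_left (by simpa using hge)
    -- The set `g.dom` may be infinite-dimensional, where nothing is known yet. A finite part of g ∪
    -- {(x, x')} uses only g on the closure of a finite set A, over which x and x' are still
    -- generic.
    refine PartialEmb.of_finite_subsets fun t ht htg => ?_
    have htf : (t ∩ g).Finite := ht.inter_of_left _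
    let A : Set H.carrier := SetRel.dom (t ∩ g)
    have hA : A.Finite := SetRel.dom_finite htf
    have hAg : A ⊆ g.dom := SetRel.dom_mono Set.inter_subset_right
    have hclA : H.cl A ⊆ g.dom := pH.cl_subset_of_isCl h1.2 hAg
    let g₁ : SetRel H.carrier K.carrier := {p ∈ g | p.1 ∈ H.cl A}
    have hg₁g : g₁ ⊆ g := fun p hp => hp.1
    have hg₁d : g₁.dom = H.cl A := by
      ext a
      constructor
      · rintro ⟨b, hb⟩; exact hb.2
      · intro ha
        obtain ⟨b, hb⟩ := hclA ha
        exact ⟨b, hb, ha⟩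
    have hgA : g.image A ⊆ g.cod := fun b ⟨a, _, hab⟩ => ⟨a, hab⟩
    have hclA' : K.cl (g.image A) ⊆ g.cod := pK.cl_subset_of_isCl h2.2 hgA
    have hg₁c : g₁.cod = K.cl (g.image A) := by
      ext b
      constructor
      · rintro ⟨a, hab, ha⟩
        exact localClass_closure_preserved hC hH hK A a ha g hg hAg b hab
      · intro hb
        obtain ⟨a, hab⟩ := hclA' hb
        refine ⟨a, hab, ?_⟩
        have := localClass_closure_preserved hC hK hH _ b hb g.inv hg.inv hgA a hab
        refine pH.mono _ _ ?_ this
        rintro c ⟨d, ⟨c', hc', hcd'⟩, hcd⟩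
        have : c = c' := hg.left_unique hcd hcd'
        rwa [this]
    have hA' : (g.image A).Finite := by
      have : g.image A = SetRel.cod {p ∈ g | p.1 ∈ A} := by
        ext b
        exact ⟨fun ⟨a, ha, hab⟩ => ⟨a, hab, ha⟩, fun ⟨a, hab, ha⟩ => ⟨a, ha, hab⟩⟩
      rw [this]
      refine SetRel.cod_finite ((hg.mono fun p hp => hp.1).finite_of_dom (hA.subset ?_))
      rintro a ⟨b, _, ha⟩
      exact ha
    have h3 : PartialEmb H K (g₁ ∪ {(x, x')}) := by
      refine generic_of_covered hC pH pK (hg.mono hg₁g) (Or.inr ⟨?_, ?_⟩) (Or.inr ⟨?_, ?_⟩) ?_ ?_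
        ?_ ?_
      · exact h1.1.mono (SetRel.dom_mono hg₁g)
      · rw [hg₁d]; exact pH.idem _
      · exact h2.1.mono (SetRel.cod_mono hg₁g)
      · rw [hg₁c]; exact pK.idem _
      · refine (hH.2 (insert x A) (hA.insert x)).congr ?_
        rw [hg₁d]
        apply Set.Subset.antisymm
        · exact pH.mono _ _ (Set.insert_subset_insert (pH.subset_cl _))
        · refine pH.cl_subset (Set.insert_subset (pH.subset_cl _ (Set.mem_insert _ _)) ?_)
          exact pH.mono _ _ (Set.subset_insert _ _)
      · refine (hK.2 (insert x' (g.image A)) (hA'.insert x')).congr ?_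
        rw [hg₁c]
        apply Set.Subset.antisymm
        · exact pK.mono _ _ (Set.insert_subset_insert (pK.subset_cl _))
        · refine pK.cl_subset (Set.insert_subset (pK.subset_cl _ (Set.mem_insert _ _)) ?_)
          exact pK.mono _ _ (Set.subset_insert _ _)
      · exact fun h => hx (pH.mono _ _ (SetRel.dom_mono hg₁g) h)
      · exact fun h => hx' (pK.mono _ _ (SetRel.cod_mono hg₁g) h)
    refine h3.mono ?_
    rintro ⟨a, b⟩ hp
    rcases htg hp with h | h
    · exact Or.inl ⟨h, pH.subset_cl _ ⟨b, hp, h⟩⟩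
    · exact Or.inr h
  homOver_empty H hH K hK :=
    homOver_of_covered hC hH.1 hK.1 (Or.inl (by simp)) (Or.inl (by simp))
      (fun T hT => hH.2 _ (by simpa using hT)) (fun T hT => hK.2 _ (by simpa using hT))
  homOver_finite := by
    have ccp : ∀ H ∈ localClass C, ∀ X : Set H.carrier, X.Finite → (H.cl X).Countable := by
      rintro H ⟨pH, hH⟩ X hX
      obtain ⟨N, hN, i, hi, hir⟩ := hH X hX
      have hXi : X ⊆ Set.range i := hir ▸ pH.subset_cl X
      rw [← Set.image_preimage_eq_of_subset hXi, ← hi]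
      exact (hC.ccp N hN _ (hX.preimage i.injective.injOn)).image i
    have aux : ∀ H ∈ localClass C, ∀ A T : Set H.carrier, A.Finite → T.Finite →
        Covered C H (H.cl A ∪ T) := by
      rintro H ⟨pH, hH⟩ A T hA hT
      refine (hH (A ∪ T) (hA.union hT)).congr ?_
      apply Set.Subset.antisymm
      · exact pH.mono _ _ (Set.union_subset_union_left _ (pH.subset_cl _))
      · exact pH.cl_subset (Set.union_subset (pH.mono _ _ Set.subset_union_left)
          (Set.subset_union_right.trans (pH.subset_cl _)))
    intro H hH K hK g hg A A' hA hA' hd hc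
    refine homOver_of_covered hC hH.1 hK.1 (Or.inr ⟨?_, ?_⟩) (Or.inr ⟨?_, ?_⟩) ?_ ?_
    · rw [hd]; exact ccp H hH A hA
    · rw [hd]; exact hH.1.idem A
    · rw [hc]; exact ccp K hK A' hA'
    · rw [hc]; exact hK.1.idem A'
    · intro T hT; rw [hd]; exact aux H hH A T hA hT
    · intro T hT; rw [hc]; exact aux K hK A' T hA' hT

omit hC in
theorem localClass_iso_closed {H K : ClStr.{u} L} (hH : H ∈ localClass C) (h : H.Iso K) :
    K ∈ localClass C := by
  obtain ⟨e, he, hes⟩ := h.exists_clEmb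
  obtain ⟨e', he', _⟩ := h.symm.exists_clEmb
  refine ⟨he'.isPregeometry hH.1, fun X hX => ?_⟩
  obtain ⟨N, hN, i, hi, hir⟩ := hH.2 (e ⁻¹' X) (hX.preimage e.injective.injOn)
  refine ⟨N, hN, e.comp i, he.comp hi, ?_⟩
  have : Set.range (e.comp i) = e '' Set.range i := by
    rw [← Set.range_comp]; rfl
  rw [this, hir, he, Set.image_preimage_eq _ hes]

omit hC in
theorem localClass_closure_mem {H : ClStr.{u} L} (hH : H ∈ localClass C) (X : Set H.carrier) :
    ∃ S : L.Substructure H.carrier, (S : Set H.carrier) = H.cl X ∧ H.sub S ∈ localClass C := by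
  obtain ⟨pH, cH⟩ := hH
  let S : L.Substructure H.carrier := ⟨H.cl X, by
    intro n f x hx
    obtain ⟨A, hA, hAX, hxA⟩ := pH.exists_finite_support (Set.finite_range x)
      (X := X) (by rintro _ ⟨k, rfl⟩; exact hx k)
    obtain ⟨N, hN, i, hi, hir⟩ := cH A hA
    choose x₀ hx₀ using fun k => (hir ▸ hxA ⟨k, rfl⟩ : x k ∈ Set.range i)
    obtain rfl : i ∘ x₀ = x := funext hx₀
    rw [← i.map_fun]
    exact pH.mono _ _ hAX (hir ▸ ⟨_, rfl⟩)⟩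
  have hS : (S : Set H.carrier) = H.cl X := rfl
  have hScl : IsCl H.cl (S : Set H.carrier) := pH.idem X
  have hemb := clEmb_sub pH hScl
  refine ⟨S, hS, hemb.isPregeometry pH, fun Y hY => ?_⟩
  obtain ⟨N, hN, i, hi, hir⟩ := cH ((H.subEmb S) '' Y) (hY.image _)
  have hiS : Set.range i ⊆ S := by
    rw [hir]
    refine pH.cl_subset_of_isCl hScl ?_
    rintro _ ⟨y, _, rfl⟩
    exact y.2
  obtain ⟨j, hj, hji⟩ := hi.exists_factor hiS
  refine ⟨N, hN, j, hj, ?_⟩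
  refine (H.subEmb S).injective.image_injective ?_
  rw [hemb, ← hir, ← Set.range_comp]
  exact congrArg Set.range (funext hji)

theorem QME.exists_hasDim {H : ClStr.{u} L} (hH : H ∈ C) {A : Set H.carrier}
    (hA : Indep H.cl A) : ∃ N ∈ C, HasDim N.cl #A := by
  obtain ⟨N, hN, i, hi, hir⟩ := hC.covered hH A
  exact ⟨N, hN, hi.hasDim (hC.pregeometry H hH) hA hir⟩

theorem QME.exists_hasDim_of_le {H : ClStr.{u} L} (hH : H ∈ C) {κ μ : Cardinal.{u}}
    (h : HasDim H.cl κ) (hμ : μ ≤ κ) : ∃ N ∈ C, HasDim N.cl μ := by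
  obtain ⟨B, hB, _, rfl⟩ := h
  obtain ⟨A, hAB, rfl⟩ := Cardinal.le_mk_iff_exists_subset.1 hμ
  exact hC.exists_hasDim hH (hB.subset (hC.pregeometry H hH) hAB)

/-- The closure of a countable set has countable dimension, and C has a member of that dimension
below M. Categoricity in countable dimensions, which holds in the whole local class by
`homogeneous_localClass`, makes them isomorphic. -/
theorem localClass_covered_countable {M : ClStr.{u} L} (hM : M ∈ C) (hMd : HasDim M.cl ℵ₀)
    {H : ClStr.{u} L} (hH : H ∈ localClass C) {X : Set H.carrier} (hX : X.Countable) :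
    Covered C H X := by
  have pH := hH.1
  obtain ⟨S, hS, hSC⟩ := localClass_closure_mem hH X
  have hemb := clEmb_sub pH (S := S) (by rw [hS]; exact pH.idem X)
  obtain ⟨A, _, hAX, hA, hAc⟩ := (indep_empty H.cl).exists_basis pH (Set.empty_subset X)
  have hr : Set.range (H.subEmb S) = H.cl X := by rw [← hS, H.range_subEmb]
  have hdim : HasDim (H.sub S).cl #A := hemb.hasDim pH hA (hr.trans hAc.symm)
  have hAℵ : #A ≤ ℵ₀ := (hX.mono hAX).le_aleph0
  obtain ⟨N, hN, hNd⟩ := hC.exists_hasDim_of_le hM hMd hAℵ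
  obtain ⟨e, he, hes⟩ := (hC.homogeneous_localClass.iso_of_hasDim (hC.subset_localClass hN) hSC
    hAℵ hNd hdim).exists_clEmb
  refine ⟨N, hN, (H.subEmb S).comp e, hemb.comp he, ?_⟩
  have : Set.range ((H.subEmb S).comp e) = (H.subEmb S) '' Set.range e := by
    rw [← Set.range_comp]; rfl
  rw [this, hes.range_eq, Set.image_univ, hr]

end LocalClass


/-! ### Excellence of the local class -/

section LocalClassExcellence

variable {L : FirstOrder.Language.{v, w}} {C : Set (ClStr.{u} L)}

/-- The crown, its image and their closures are countable, so they are covered by members of C,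
where excellence is available. -/
theorem localClass_excellence (hC : QME C) {M : ClStr.{u} L} (hM : M ∈ C)
    (hMd : HasDim M.cl ℵ₀) {H K : ClStr.{u} L} (hH : H ∈ localClass C) (hK : K ∈ localClass C)
    {D : Set H.carrier} (hD : D.Countable) (hcrown : IsCrown H.cl D)
    {g : SetRel H.carrier K.carrier} (hg : ClosedPartialEmb H K g) (hgD : g.dom = D)
    {X : Set H.carrier} (hX : X.Finite) (hXD : X ⊆ H.cl D) :
    ∃ D₀ : Set H.carrier, D₀.Finite ∧ D₀ ⊆ D ∧
      ∀ f : SetRel H.carrier K.carrier, f.dom = X →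
        PartialEmb H K (f ∪ {p ∈ g | p.1 ∈ D₀}) → PartialEmb H K (f ∪ g) := by
  have pH := hH.1
  have pK := hK.1
  subst hgD
  have hgc : g.cod.Countable := by
    choose φ hφ using fun x : g.dom => x.2
    have := hD.to_subtype
    refine (Set.countable_range φ).mono ?_
    rintro y ⟨x, hxy⟩
    exact ⟨⟨x, y, hxy⟩, hg.1.right_unique (hφ _) hxy⟩
  obtain ⟨N, hN, i, hi, hir⟩ := localClass_covered_countable hC hM hMd hH hD
  obtain ⟨N', hN', j, hj, hjr⟩ := localClass_covered_countable hC hM hMd hK hgc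
  have hdi : g.dom ⊆ Set.range i := hir ▸ pH.subset_cl _
  have hcj : g.cod ⊆ Set.range j := hjr ▸ pK.subset_cl _
  let g₀ : SetRel N.carrier N'.carrier := Prod.map i j ⁻¹' g
  have hg₀d : g₀.dom = i ⁻¹' g.dom := dom_preimage_prodMap i j hcj
  have hg₀ : ClosedPartialEmb N N' g₀ := by
    refine ⟨hg.1.preimage i j, fun Y hY hYc => ?_⟩
    have h1 : i '' Y ⊆ g.dom := by
      rintro _ ⟨y, hy, rfl⟩
      have := hY hy
      rwa [hg₀d] at this
    have h2 := hg.2 (i '' Y) h1 (hi.isCl_image hYc)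
    have h3 : g₀.image Y = j ⁻¹' (g.image (i '' Y)) := by
      ext z
      constructor
      · rintro ⟨y, hy, hyz⟩
        exact ⟨i y, ⟨y, hy, rfl⟩, hyz⟩
      · rintro ⟨_, ⟨y, hy, rfl⟩, hyz⟩
        exact ⟨y, hy, hyz⟩
    rw [h3]
    refine hj.isCl_preimage h2 (subset_trans ?_ hcj)
    rintro z ⟨y, _, hyz⟩
    exact ⟨y, hyz⟩
  have hcrown₀ : IsCrown N.cl g₀.dom := by
    obtain ⟨B, hB, n, E, hEB, hDE⟩ := hcrown
    have hEi : ∀ k, E k ⊆ Set.range i := fun k =>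
      ((pH.subset_cl _).trans (Set.subset_iUnion (fun k => H.cl (E k)) k)).trans (hDE ▸ hdi)
    refine ⟨⋃ k, i ⁻¹' E k, ?_, n, fun k => i ⁻¹' E k, fun k =>
      Set.subset_iUnion (fun k => i ⁻¹' E k) k, ?_⟩
    · intro b hb hb'
      have hsub : ∀ c ∈ ⋃ k, i ⁻¹' E k, i c ∈ B := by
        intro c hc
        obtain ⟨k, hk⟩ := Set.mem_iUnion.1 hc
        exact hEB k hk
      refine hB (i b) (hsub b hb) (pH.mono _ _ ?_ (hi.mem_cl_iff.2 hb'))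
      rintro _ ⟨c, ⟨hc, hcb⟩, rfl⟩
      exact ⟨hsub c hc, fun h => hcb (i.injective h)⟩
    · rw [hg₀d, hDE, Set.preimage_iUnion]
      refine Set.iUnion_congr fun k => ?_
      rw [← Set.image_preimage_eq_of_subset (hEi k), ← hi,
        Set.preimage_image_eq _ i.injective]
  have hXi : X ⊆ Set.range i := hir ▸ hXD
  obtain ⟨D₀, hD₀, hD₀g, hD₀e⟩ := hC.excellence N hN N' hN' g₀.dom
    (hg₀d ▸ hD.preimage_of_injOn i.injective.injOn) hcrown₀ g₀ hg₀ rfl (i ⁻¹' X)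
    (hX.preimage i.injective.injOn) (by
      intro x hx
      rw [← hi.mem_cl_iff, hg₀d, Set.image_preimage_eq_of_subset hdi]
      exact hXD hx)
  -- The set `D₁` supports X, so an f compatible with g on `D₁` takes its values in the closure of
  -- `g.cod`, hence in the cover of the target.
  obtain ⟨D₁, hD₁, hD₁g, hXD₁⟩ := pH.exists_finite_support hX hXD
  refine ⟨i '' D₀ ∪ D₁, (hD₀.image i).union hD₁, Set.union_subset ?_ hD₁g, fun f hf hfg => ?_⟩
  · rintro _ ⟨x, hx, rfl⟩
    have := hD₀g hx
    rwa [hg₀d] at this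
  have hfc : f.cod ⊆ Set.range j := by
    rintro y ⟨x, hxy⟩
    have hx : x ∈ H.cl D₁ := hXD₁ (hf ▸ ⟨y, hxy⟩)
    rw [hjr]
    refine hC.homogeneous_localClass.mem_cl_of_mem hH hK hfg (fun z hz => ?_) hx (Or.inl hxy)
    obtain ⟨z', hz'⟩ := hD₁g hz
    exact ⟨z', pK.subset_cl _ ⟨z, hz'⟩, Or.inr ⟨hz', Or.inr hz⟩⟩
  have h1 := hD₀e (Prod.map i j ⁻¹' f) (by rw [dom_preimage_prodMap i j hfc, hf])
    ((hfg.preimage i j).mono (by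
      rintro p (hp | hp)
      · exact Or.inl hp
      · exact Or.inr ⟨hp.1, Or.inl ⟨_, hp.2, rfl⟩⟩))
  have := (PartialEmb.map_iff (H := H) (K := K) i j).2 h1
  rwa [Set.image_union, image_preimage_prodMap i j (hf ▸ hXi) hfc,
    image_preimage_prodMap i j hdi hcj] at this

/-- If `C` has a member of dimension `ℵ₀`, its local class is quasiminimal excellent. -/
theorem QME.localClass (hC : QME C) {M : ClStr.{u} L} (hM : M ∈ C) (hMd : HasDim M.cl ℵ₀) :
    QME (localClass C) where
  iso_closed H hH K h := localClass_iso_closed hH h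
  empty_map := hC.homogeneous_localClass.empty_map
  pregeometry := hC.homogeneous_localClass.pregeometry
  ccp := hC.homogeneous_localClass.ccp
  closure_mem H hH X := localClass_closure_mem hH X
  closure_preserved := hC.homogeneous_localClass.closure_preserved
  homogeneity_generic := hC.homogeneous_localClass.generic
  homogeneity_closure := by
    have aux : ∀ H ∈ QMEC.localClass C, ∀ G T : Set H.carrier, CtblClosedOrEmpty H G →
        T.Finite → Covered C H (G ∪ T) := by
      rintro H hH G T (rfl | hG) hT
      · exact localClass_covered_countable hC hM hMd hH (by simpa using hT.countable)
      · exact localClass_covered_countable hC hM hMd hH (hG.1.union hT.countable)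
    rintro H hH K hK G G' h1 h2 g _ rfl rfl
    exact homOver_of_covered hC hH.1 hK.1 h1 h2 (fun T => aux H hH _ T h1)
      (fun T => aux K hK _ T h2)
  excellence H hH K hK _ hD hcrown _ hg hgD _ hX hXD :=
    localClass_excellence hC hM hMd hH hK hD hcrown hg hgD hX hXD

end LocalClassExcellence

/-! ### Directed unions -/

section Unions

/-- A finitary closure operator is a pregeometry if its finite parts are. -/
theorem IsPregeometry.of_local {V : Type u} {cl : Set V → Set V}
    (mono : ∀ X Y, X ⊆ Y → cl X ⊆ cl Y)
    (fin : ∀ X a, a ∈ cl X → ∃ Y : Set V, Y.Finite ∧ Y ⊆ X ∧ a ∈ cl Y)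
    (loc : ∀ F : Set V, F.Finite → ∃ (N : Type u) (clN : Set N → Set N) (φ : F → N),
      IsPregeometry clN ∧ ∀ (X : Set F) (y : F), (y : V) ∈ cl (Subtype.val '' X) ↔
        φ y ∈ clN (φ '' X)) : IsPregeometry cl := by
  -- Each axiom is checked on one finite set F containing all points involved, where closure is read
  -- off from a pregeometry.
  have loc' : ∀ F : Set V, F.Finite → ∃ (N : Type u) (clN : Set N → Set N) (φ : F → N),
      IsPregeometry clN ∧ ∀ (X : Set V) (_ : X ⊆ F) (y : V) (hy : y ∈ F), y ∈ cl X ↔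
        φ ⟨y, hy⟩ ∈ clN (φ '' {x | (x : V) ∈ X}) := by
    intro F hF
    obtain ⟨N, clN, φ, hN, h⟩ := loc F hF
    refine ⟨N, clN, φ, hN, fun X hX y hy => ?_⟩
    rw [← h]
    have : Subtype.val '' {x : F | (x : V) ∈ X} = X := by
      ext x
      exact ⟨by rintro ⟨x, hx, rfl⟩; exact hx, fun hx => ⟨⟨x, hX hx⟩, hx, rfl⟩⟩
    rw [this]
  refine ⟨fun X a ha => ?_, mono, fun X => ?_, fin, fun X a b ha ha' => ?_⟩
  · obtain ⟨N, clN, φ, hN, h⟩ := loc' {a} (Set.finite_singleton a)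
    refine mono {a} X (Set.singleton_subset_iff.2 ha) ((h {a} subset_rfl a rfl).2 ?_)
    exact hN.subset_cl _ ⟨⟨a, rfl⟩, rfl, rfl⟩
  · have sub : ∀ X, X ⊆ cl X := by
      intro X a ha
      obtain ⟨N, clN, φ, hN, h⟩ := loc' {a} (Set.finite_singleton a)
      refine mono {a} X (Set.singleton_subset_iff.2 ha) ((h {a} subset_rfl a rfl).2 ?_)
      exact hN.subset_cl _ ⟨⟨a, rfl⟩, rfl, rfl⟩
    refine Set.Subset.antisymm (fun a ha => ?_) (sub _)
    obtain ⟨Y, hY, hYX, haY⟩ := fin _ _ ha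
    choose Z hZ hZX hYZ using fun y : Y => fin _ _ (hYX y.2)
    have := hY.to_subtype
    have hZf : (⋃ y, Z y).Finite := Set.finite_iUnion hZ
    refine mono _ _ (Set.iUnion_subset hZX) ?_
    obtain ⟨N, clN, φ, hN, h⟩ := loc' (insert a ((⋃ y, Z y) ∪ Y)) ((hZf.union hY).insert a)
    have hsZ : (⋃ y, Z y) ⊆ insert a ((⋃ y, Z y) ∪ Y) :=
      Set.subset_union_left.trans (Set.subset_insert _ _)
    have hsY : Y ⊆ insert a ((⋃ y, Z y) ∪ Y) :=
      Set.subset_union_right.trans (Set.subset_insert _ _)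
    rw [h _ hsZ a (Set.mem_insert _ _)]
    rw [h _ hsY a (Set.mem_insert _ _)] at haY
    refine hN.cl_subset ?_ haY
    rintro _ ⟨y, hy, rfl⟩
    rw [← h _ hsZ y y.2]
    exact mono _ _ (Set.subset_iUnion Z ⟨y, hy⟩) (hYZ ⟨y, hy⟩)
  · obtain ⟨Y, hY, hYX, haY⟩ := fin _ _ ha
    have hZX : Y \ {b} ⊆ X := fun y hy => (hYX hy.1).resolve_left hy.2
    have hYZ : Y ⊆ insert b (Y \ {b}) := fun y hy => by
      by_cases h : y = b
      · exact Or.inl h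
      · exact Or.inr ⟨hy, h⟩
    have haZ := mono _ _ hYZ haY
    have haZ' : a ∉ cl (Y \ {b}) := fun h => ha' (mono _ _ hZX h)
    refine mono _ _ (Set.insert_subset_insert hZX) ?_
    generalize hZ : Y \ {b} = Z at *
    have hZf : Z.Finite := hZ ▸ hY.sdiff
    obtain ⟨N, clN, φ, hN, h⟩ := loc' (insert a (insert b Z)) ((hZf.insert b).insert a)
    have ha0 : a ∈ insert a (insert b Z) := Or.inl rfl
    have hb0 : b ∈ insert a (insert b Z) := Or.inr (Or.inl rfl)
    have hZ0 : Z ⊆ insert a (insert b Z) := fun z hz => Or.inr (Or.inr hz)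
    have hins : ∀ (c : V) (hc : c ∈ insert a (insert b Z)),
        φ '' {x | (x : V) ∈ insert c Z} = insert (φ ⟨c, hc⟩) (φ '' {x | (x : V) ∈ Z}) := by
      intro c hc
      rw [← Set.image_insert_eq]
      congr 1
      ext x
      simp [Subtype.ext_iff]
    rw [h _ (Set.subset_insert _ _) a ha0, hins b hb0] at haZ
    rw [h _ hZ0 a ha0] at haZ'
    rw [h _ (Set.insert_subset ha0 hZ0) b hb0, hins a ha0]
    exact hN.exchange _ _ _ haZ haZ'

variable {L : FirstOrder.Language.{v, w}}

/-- A structure with an injection of its universe into `U`. -/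
structure PlacedStr (L : FirstOrder.Language.{v, w}) (U : Type u) where
  toClStr : ClStr.{u} L
  place : toClStr.carrier → U
  place_injective : Function.Injective place

/-- `p` is a closed substructure of `q`, up to an isomorphism that commutes with the places. -/
def PlacedStr.LE {U : Type u} (p q : PlacedStr.{u} L U) : Prop :=
  ∃ e : p.toClStr.carrier ↪[L] q.toClStr.carrier, ClEmb p.toClStr q.toClStr e ∧
    ∀ x, q.place (e x) = p.place x

namespace PlacedStr

variable {U : Type u}

theorem LE.refl (p : PlacedStr.{u} L U) : p.LE p :=
  ⟨Embedding.refl L _, fun Y => by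
    have h : ∀ Z, (Embedding.refl L p.toClStr.carrier) '' Z = Z := fun Z => Set.image_id Z
    rw [h, h], fun _ => rfl⟩

theorem LE.trans {p q r : PlacedStr.{u} L U} (h : p.LE q) (h' : q.LE r) : p.LE r := by
  obtain ⟨e, he, hep⟩ := h
  obtain ⟨e', he', hep'⟩ := h'
  exact ⟨e'.comp e, he'.comp he, fun x => (hep' _).trans (hep x)⟩

/-- The union of a nonempty chain of structures placed in `U`. -/
theorem exists_union (c : Set (PlacedStr.{u} L U)) (hc : ∀ p ∈ c, ∀ q ∈ c, p.LE q ∨ q.LE p)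
    (hne : c.Nonempty) (hp : ∀ p ∈ c, IsPregeometry p.toClStr.cl) :
    ∃ m : PlacedStr.{u} L U, IsPregeometry m.toClStr.cl ∧ (∀ p ∈ c, p.LE m) ∧
      ∀ F : Set m.toClStr.carrier, F.Finite → ∃ p ∈ c,
        ∃ e : p.toClStr.carrier ↪[L] m.toClStr.carrier, ClEmb p.toClStr m.toClStr e ∧
          F ⊆ Set.range e := by
  classical
  let V : Type u := {x : U // ∃ p ∈ c, x ∈ Set.range p.place}
  let ι : ∀ p : c, p.1.toClStr.carrier → V := fun p x => ⟨p.1.place x, p.1, p.2, x, rfl⟩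
  have hι : ∀ p : c, Function.Injective (ι p) := fun p x y h =>
    p.1.place_injective (congrArg Subtype.val h)
  have hle : ∀ p q : c, (∃ e : p.1.toClStr.carrier ↪[L] q.1.toClStr.carrier,
      ClEmb p.1.toClStr q.1.toClStr e ∧ ∀ x, ι q (e x) = ι p x) ∨
      (∃ e : q.1.toClStr.carrier ↪[L] p.1.toClStr.carrier,
      ClEmb q.1.toClStr p.1.toClStr e ∧ ∀ x, ι p (e x) = ι q x) := by
    intro p q
    rcases hc p.1 p.2 q.1 q.2 with ⟨e, he, hx⟩ | ⟨e, he, hx⟩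
    · exact Or.inl ⟨e, he, fun x => Subtype.ext (hx x)⟩
    · exact Or.inr ⟨e, he, fun x => Subtype.ext (hx x)⟩
  have hfin : ∀ F : Set V, F.Finite → ∃ p : c, F ⊆ Set.range (ι p) := by
    intro F hF
    induction F, hF using Set.Finite.induction_on with
    | empty => exact ⟨⟨hne.some, hne.some_mem⟩, Set.empty_subset _⟩
    | @insert a F _ _ ih =>
      obtain ⟨p, hp⟩ := ih
      obtain ⟨a, q, hq, y, rfl⟩ := a
      rcases hle p ⟨q, hq⟩ with ⟨e, _, he⟩ | ⟨e, _, he⟩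
      · refine ⟨⟨q, hq⟩, Set.insert_subset ⟨y, rfl⟩ (hp.trans ?_)⟩
        rintro _ ⟨x, rfl⟩
        exact ⟨e x, he x⟩
      · refine ⟨p, Set.insert_subset ⟨e y, (he y).trans rfl⟩ hp⟩
  have htup : ∀ {n : ℕ} (x : Fin n → V), ∃ (p : c) (y : Fin n → p.1.toClStr.carrier),
      ι p ∘ y = x := by
    intro n x
    obtain ⟨p, hp⟩ := hfin (Set.range x) (Set.finite_range x)
    choose y hy using fun i => hp ⟨i, rfl⟩
    exact ⟨p, y, funext hy⟩
  -- Each tuple is assigned an arbitrary stage `P x` that contains it, and functions and relations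
  -- are computed there. Comparing two stages of the chain shows that the choice is immaterial.
  choose P Y hPY using @htup
  let str : L.Structure V :=
    { funMap := fun f x => ι (P x) (Structure.funMap f (Y x))
      RelMap := fun R x => Structure.RelMap R (Y x) }
  have hfun : ∀ (p : c) {n : ℕ} (f : L.Functions n) (y : Fin n → p.1.toClStr.carrier),
      ι p (Structure.funMap f y) = Structure.funMap f (ι p ∘ y) := by
    intro p n f y
    change _ = ι (P (ι p ∘ y)) (Structure.funMap f (Y (ι p ∘ y)))
    have h := hPY (ι p ∘ y)
    generalize Y (ι p ∘ y) = z at h ⊢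
    generalize P (ι p ∘ y) = q at z h ⊢
    rcases hle p q with ⟨e, _, he⟩ | ⟨e, _, he⟩
    · have : z = e ∘ y := funext fun k => hι q ((congrFun h k).trans (he _).symm)
      rw [this, ← e.map_fun, he]
    · have : y = e ∘ z := funext fun k => hι p ((congrFun h k).symm.trans (he _).symm)
      rw [this, ← e.map_fun, he]
  have hrel : ∀ (p : c) {n : ℕ} (R : L.Relations n) (y : Fin n → p.1.toClStr.carrier),
      Structure.RelMap R (ι p ∘ y) ↔ Structure.RelMap R y := by
    intro p n R y
    change Structure.RelMap R (Y (ι p ∘ y)) ↔ _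
    have h := hPY (ι p ∘ y)
    generalize Y (ι p ∘ y) = z at h ⊢
    generalize P (ι p ∘ y) = q at z h ⊢
    rcases hle p q with ⟨e, _, he⟩ | ⟨e, _, he⟩
    · have : z = e ∘ y := funext fun k => hι q ((congrFun h k).trans (he _).symm)
      rw [this, e.map_rel]
    · have : y = e ∘ z := funext fun k => hι p ((congrFun h k).symm.trans (he _).symm)
      rw [this, e.map_rel]
  let clV : Set V → Set V := fun X =>
    {v | ∃ (p : c) (Z : Set p.1.toClStr.carrier), ι p '' Z ⊆ X ∧ v ∈ ι p '' p.1.toClStr.cl Z}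
  let W : ClStr.{u} L := ⟨V, str, clV⟩
  let j : ∀ p : c, p.1.toClStr.carrier ↪[L] W.carrier := fun p =>
    ⟨⟨ι p, hι p⟩, fun f x => hfun p f x, fun R x => hrel p R x⟩
  have hj : ∀ p : c, ClEmb p.1.toClStr W (j p) := by
    intro p Z
    apply Set.Subset.antisymm
    · intro v hv
      exact ⟨p, Z, subset_rfl, hv⟩
    · rintro v ⟨q, Z', hZ, v, hv, rfl⟩
      rcases hle p q with ⟨e, hecl, he⟩ | ⟨e, hecl, he⟩
      · have h1 : Z' ⊆ e '' Z := by
          intro z hz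
          obtain ⟨x, hx, hxz⟩ := hZ ⟨z, hz, rfl⟩
          exact ⟨x, hx, hι q ((he x).trans hxz)⟩
        have h2 := (hp q.1 q.2).mono _ _ h1 hv
        rw [← hecl] at h2
        obtain ⟨x, hx, rfl⟩ := h2
        exact ⟨x, hx, (he x).symm⟩
      · refine ⟨e v, ?_, he v⟩
        have h2 : e v ∈ e '' q.1.toClStr.cl Z' := ⟨v, hv, rfl⟩
        rw [hecl] at h2
        refine (hp p.1 p.2).mono _ _ ?_ h2
        rintro _ ⟨z, hz, rfl⟩
        obtain ⟨x, hx, hxz⟩ := hZ ⟨z, hz, rfl⟩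
        have : e z = x := hι p ((he z).trans hxz.symm)
        rwa [this]
  refine ⟨⟨W, Subtype.val, Subtype.val_injective⟩, ?_, fun p hpc => ⟨j ⟨p, hpc⟩, hj ⟨p, hpc⟩,
    fun _ => rfl⟩, fun F hF => ?_⟩
  · refine IsPregeometry.of_local ?_ ?_ ?_
    · rintro X Y hXY v ⟨p, Z, hZ, hv⟩
      exact ⟨p, Z, hZ.trans hXY, hv⟩
    · rintro X v ⟨p, Z, hZ, v, hv, rfl⟩
      obtain ⟨T, hT, hTZ, hvT⟩ := (hp p.1 p.2).finite_char _ _ hv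
      exact ⟨ι p '' T, hT.image _, (Set.image_mono hTZ).trans hZ, p, T, subset_rfl, v, hvT, rfl⟩
    · intro F hF
      obtain ⟨p, hpF⟩ := hfin F hF
      choose φ hφ using fun x : F => hpF x.2
      refine ⟨p.1.toClStr.carrier, p.1.toClStr.cl, φ, hp p.1 p.2, fun X y => ?_⟩
      rw [← (hj p).mem_cl_iff]
      have h1 : (j p) '' (φ '' X) = Subtype.val '' X := by
        rw [Set.image_image]
        exact Set.image_congr fun x _ => hφ x
      have h2 : (j p) (φ y) = y := hφ y
      rw [h1, h2]
  · obtain ⟨p, hpF⟩ := hfin F hF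
    exact ⟨p.1, p.2, j p, hj p, hpF⟩

end PlacedStr

end Unions


/-! ### Members of every dimension -/

section Existence

variable {L : FirstOrder.Language.{v, w}} {C : Set (ClStr.{u} L)}

theorem Covered.image {P W : ClStr.{u} L} {e : P.carrier ↪[L] W.carrier} (he : ClEmb P W e)
    {Y : Set P.carrier} (h : Covered C P Y) : Covered C W (e '' Y) := by
  obtain ⟨N, hN, i, hi, hir⟩ := h
  refine ⟨N, hN, e.comp i, he.comp hi, ?_⟩
  have : Set.range (e.comp i) = e '' Set.range i := by
    rw [← Set.range_comp]; rfl
  rw [this, hir, he]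

/-- `H` is not the closure of a finite set. -/
def InfDim (H : ClStr.{u} L) : Prop := ∀ X : Set H.carrier, X.Finite → H.cl X ≠ Set.univ

theorem infDim_of_hasDim {H : ClStr.{u} L} (pH : IsPregeometry H.cl) {κ : Cardinal.{u}}
    (hκ : ℵ₀ ≤ κ) (h : HasDim H.cl κ) : InfDim H := by
  obtain ⟨B, hB, _, rfl⟩ := h
  intro X hX hXu
  have hBi : B.Infinite := by rwa [← Set.infinite_coe_iff, Cardinal.infinite_iff]
  lift X to Finset H.carrier using hX
  obtain ⟨J, hJ, hJc⟩ := hBi.exists_subset_card_eq (X.card + 1)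
  have := (hB.subset pH hJ).card_le pH (hXu ▸ Set.subset_univ _)
  omega

theorem exists_basis {M : Type u} {cl : Set M → Set M} (h : IsPregeometry cl) :
    ∃ B, Indep cl B ∧ cl B = Set.univ := by
  obtain ⟨B, _, _, hB, hBc⟩ := (indep_empty cl).exists_basis h (Set.empty_subset Set.univ)
  exact ⟨B, hB, hBc.trans (Set.univ_subset_iff.1 (h.subset_cl _))⟩

/-- An infinite-dimensional member of a quasiminimal excellent class is isomorphic to a proper
closed substructure. -/
theorem QME.exists_proper_clEmb (hC : QME C) {H : ClStr.{u} L} (hH : H ∈ C) (hi : InfDim H) :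
    ∃ e : H.carrier ↪[L] H.carrier, ClEmb H H e ∧ ¬ Function.Surjective e := by
  have pH := hC.pregeometry H hH
  obtain ⟨B, hB, hBs⟩ := exists_basis pH
  have hBi : B.Infinite := fun hf => hi B hf hBs
  obtain ⟨b, hb⟩ := hBi.nonempty
  -- An infinite basis keeps its cardinality when a point is removed, so by categoricity the closure
  -- of the rest is a copy of H that omits b.
  have hcard : #(B \ {b} : Set H.carrier) = #B := by
    have := hBi.to_subtype
    have h1 : #(B \ {b} : Set H.carrier) + 1 = #B := by
      rw [← Cardinal.mk_singleton b,
        Cardinal.mk_sdiff_add_mk (Set.singleton_subset_iff.2 hb)]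
    have h2 : ℵ₀ ≤ #(B \ {b} : Set H.carrier) := by
      rw [← Cardinal.infinite_iff, Set.infinite_coe_iff]
      exact hBi.sdiff (Set.finite_singleton b)
    rwa [Cardinal.add_one_of_aleph0_le h2] at h1
  obtain ⟨N, hN, i, hi', hir⟩ := hC.covered hH (B \ {b})
  have hNd := hi'.hasDim pH (hB.subset pH Set.sdiff_subset) hir
  rw [hcard] at hNd
  obtain ⟨e, he, _⟩ := (hC.iso_of_hasDim hH hN ⟨B, hB, hBs, rfl⟩ hNd).exists_clEmb
  refine ⟨i.comp e, hi'.comp he, fun hs => ?_⟩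
  obtain ⟨x, hx⟩ := hs b
  exact hB b hb (hir ▸ ⟨e x, hx⟩)

/-- Zorn's lemma is applied to infinite-dimensional structures in the local class placed in a set U
of size κ; the placement makes the collection a set and bounds cardinalities by κ. A maximal
structure of size below κ is a proper closed substructure of a copy of itself, and that copy still
fits into U. -/
theorem exists_mk_eq (hC : QME C) {M : ClStr.{u} L} (hM : M ∈ C) (hMd : HasDim M.cl ℵ₀)
    {κ : Cardinal.{u}} (hκ : ℵ₀ < κ) : ∃ H ∈ localClass C, #H.carrier = κ := by
  classical
  have hĈ := hC.localClass hM hMd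
  let U : Type u := κ.out
  have hU : #U = κ := Cardinal.mk_out κ
  have : Infinite U := Cardinal.infinite_iff.2 (hU ▸ hκ.le)
  have pM := hC.pregeometry M hM
  have hMc : #M.carrier ≤ #U := by
    obtain ⟨B, _, hBs, hBc⟩ := hMd
    have : (Set.univ : Set M.carrier).Countable :=
      hBs ▸ hC.homogeneous.countable_cl hM (Cardinal.mk_le_aleph0_iff.1 hBc.le).to_set
    rw [hU, ← Cardinal.mk_univ]
    exact this.le_aleph0.trans hκ.le
  let α := {p : PlacedStr.{u} L U // p.toClStr ∈ localClass C ∧ InfDim p.toClStr}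
  obtain ⟨f⟩ := hMc
  obtain ⟨⟨m, hm, hmi⟩, hmax⟩ := exists_maximal_of_chains_bounded (α := α)
    (r := fun p q => p.1.LE q.1) (by
      intro c hc
      rcases c.eq_empty_or_nonempty with rfl | hne
      · exact ⟨⟨⟨M, f, f.injective⟩, hC.subset_localClass hM,
          infDim_of_hasDim pM le_rfl hMd⟩, by simp⟩
      · obtain ⟨m, pm, hpm, hfin⟩ := PlacedStr.exists_union (Subtype.val '' c) (by
          rintro _ ⟨p, hp, rfl⟩ _ ⟨q, hq, rfl⟩
          by_cases h : p = q
          · subst h; exact Or.inl (PlacedStr.LE.refl _)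
          · exact hc hp hq h) (hne.image _) (by
          rintro _ ⟨p, _, rfl⟩
          exact p.2.1.1)
        refine ⟨⟨m, ⟨pm, fun X hX => ?_⟩, fun X hX hXu => ?_⟩, fun p hp => hpm _ ⟨p, hp, rfl⟩⟩
        · obtain ⟨_, ⟨p, _, rfl⟩, e, he, hXe⟩ := hfin X hX
          rw [← Set.image_preimage_eq_of_subset hXe]
          exact (p.2.1.2 _ (hX.preimage e.injective.injOn)).image he
        · obtain ⟨_, ⟨p, _, rfl⟩, e, he, hXe⟩ := hfin X hX
          refine p.2.2 (e ⁻¹' X) (hX.preimage e.injective.injOn) ?_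
          rw [← Set.image_preimage_eq_of_subset hXe, ← he] at hXu
          refine Set.eq_univ_of_forall fun x => ?_
          have : e x ∈ e '' p.1.toClStr.cl (e ⁻¹' X) := hXu ▸ Set.mem_univ _
          exact e.injective.mem_set_image.1 this) (fun h h' => h.trans h')
  refine ⟨m.toClStr, hm, le_antisymm ?_ ?_⟩
  · rw [← hU]
    exact ⟨⟨m.place, m.place_injective⟩⟩
  · by_contra hlt
    push Not at hlt
    obtain ⟨e, he, hes⟩ := hĈ.exists_proper_clEmb hm hmi
    have hr : #(Set.range m.place) < #U := by
      rw [Cardinal.mk_range_eq _ m.place_injective, hU]; exact hlt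
    have hc : #m.toClStr.carrier ≤ #((Set.range m.place)ᶜ : Set U) := by
      rw [Cardinal.mk_compl_of_infinite _ hr, hU]; exact hlt.le
    obtain ⟨k⟩ := hc
    -- In the new placement the image of e sits where the whole structure sat before, and the other
    -- points go to the unused part of U. Maximality would put their places back in the old range.
    let j : m.toClStr.carrier → U := Function.extend e m.place (fun x => (k x : U))
    have hje : ∀ x, j (e x) = m.place x := fun x => e.injective.extend_apply _ _ x
    have hjn : ∀ x, (¬ ∃ y, e y = x) → j x = k x := fun x hx =>
      Function.extend_apply' _ _ _ hx
    have hj : Function.Injective j := by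
      intro x y hxy
      by_cases hx : ∃ z, e z = x <;> by_cases hy : ∃ z, e z = y
      · obtain ⟨x, rfl⟩ := hx
        obtain ⟨y, rfl⟩ := hy
        rw [hje, hje] at hxy
        rw [m.place_injective hxy]
      · obtain ⟨x, rfl⟩ := hx
        rw [hje, hjn y hy] at hxy
        exact ((k y).2 ⟨x, hxy⟩).elim
      · obtain ⟨y, rfl⟩ := hy
        rw [hje, hjn x hx] at hxy
        exact ((k x).2 ⟨y, hxy.symm⟩).elim
      · rw [hjn x hx, hjn y hy] at hxy
        exact k.injective (Subtype.ext hxy)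
    obtain ⟨e', _, he'⟩ := hmax ⟨⟨m.toClStr, j, hj⟩, hm, hmi⟩ ⟨e, he, hje⟩
    refine hes fun x => ?_
    by_contra hx
    have h1 := he' x
    change m.place (e' x) = j x at h1
    rw [hjn x hx] at h1
    exact (k x).2 ⟨_, h1⟩

/-- The class has members of every dimension. -/
def Full (C : Set (ClStr.{u} L)) : Prop := ∀ κ : Cardinal.{u}, ∃ H ∈ C, HasDim H.cl κ

theorem QME.full_of_mk (hC : QME C) (h : ∀ κ : Cardinal.{u}, ℵ₀ < κ → ∃ H ∈ C, #H.carrier = κ) :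
    Full C := by
  have key : ∀ κ : Cardinal.{u}, ℵ₀ < κ → ∃ H ∈ C, HasDim H.cl κ := by
    intro κ hκ
    obtain ⟨H, hH, hHκ⟩ := h κ hκ
    obtain ⟨B, hB, hBs⟩ := exists_basis (hC.pregeometry H hH)
    exact ⟨H, hH, B, hB, hBs, (mk_basis_eq (hC.pregeometry H hH) (hC.ccp H hH) hBs
      (hHκ ▸ hκ)).trans hHκ⟩
  intro κ
  -- Every dimension κ, finite ones included, is found as the closure of part of a basis of a member
  -- of a larger uncountable dimension.
  obtain ⟨H, hH, hHd⟩ := key (Order.succ (max ℵ₀ κ))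
    ((le_max_left _ _).trans_lt (Order.lt_succ _))
  exact hC.exists_hasDim_of_le hH hHd ((le_max_right _ _).trans (Order.le_succ _))

/-- A member of a larger class has the dimension of some member of C, and is isomorphic to it by
categoricity in the larger class. -/
theorem QME.eq_of_full (hC : QME C) (hf : Full C) {E : Set (ClStr.{u} L)} (hE : QME E)
    (hCE : C ⊆ E) : C = E := by
  refine hCE.antisymm fun H hH => ?_
  obtain ⟨B, hB, hBs⟩ := exists_basis (hE.pregeometry H hH)
  obtain ⟨K, hK, hKd⟩ := hf #B
  exact hC.iso_closed K hK H (hE.iso_of_hasDim (hCE hK) hH hKd ⟨B, hB, hBs, rfl⟩)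

theorem QME.uncountablyCategorical (hC : QME C) (hf : Full C) : UncountablyCategorical C := by
  have hdim : ∀ H ∈ C, ∀ κ : Cardinal.{u}, ℵ₀ < κ → #H.carrier = κ → HasDim H.cl κ := by
    intro H hH κ hκ hHκ
    obtain ⟨B, hB, hBs⟩ := exists_basis (hC.pregeometry H hH)
    exact ⟨B, hB, hBs, (mk_basis_eq (hC.pregeometry H hH) (hC.ccp H hH) hBs
      (hHκ ▸ hκ)).trans hHκ⟩
  intro κ hκ
  refine ⟨?_, fun H hH K hK h1 h2 => ?_⟩
  · obtain ⟨H, hH, B, hB, hBs, hBκ⟩ := hf κ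
    exact ⟨H, hH, (mk_basis_eq (hC.pregeometry H hH) (hC.ccp H hH) hBs
      (hκ.trans_le (hBκ ▸ Cardinal.mk_set_le B))).symm.trans hBκ⟩
  · obtain ⟨e, _⟩ := hC.iso_of_hasDim hH hK (hdim H hH κ hκ h1) (hdim K hK κ hκ h2)
    exact ⟨e⟩

theorem QME.full_localClass (hC : QME C) {M : ClStr.{u} L} (hM : M ∈ C)
    (hMd : HasDim M.cl ℵ₀) : Full (QMEC.localClass C) :=
  (hC.localClass hM hMd).full_of_mk fun _ hκ => exists_mk_eq hC hM hMd hκ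

/-- Finite-dimensional closed sets in a larger class have the same dimension as members of C
obtained inside M, and categoricity in the larger class identifies them. -/
theorem QME.subset_localClass_of_subset (hC : QME C) {M : ClStr.{u} L} (hM : M ∈ C)
    (hMd : HasDim M.cl ℵ₀) {E : Set (ClStr.{u} L)} (hE : QME E) (hCE : C ⊆ E) :
    E ⊆ QMEC.localClass C := by
  intro H hH
  have pH := hE.pregeometry H hH
  refine ⟨pH, fun X hX => ?_⟩
  obtain ⟨A, _, hAX, hA, hAc⟩ := (indep_empty H.cl).exists_basis pH (Set.empty_subset X)
  obtain ⟨N, hN, i, hi, hir⟩ := hE.covered hH X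
  have hNd := hi.hasDim pH hA (hir.trans hAc.symm)
  obtain ⟨N', hN', hNd'⟩ := hC.exists_hasDim_of_le hM hMd (hX.countable.mono hAX).le_aleph0
  exact ⟨N, hC.iso_closed N' hN' N (hE.iso_of_hasDim (hCE hN') hN hNd' hNd), i, hi, hir⟩

theorem QME.existsUnique_uncountablyCategorical (hC : QME C) {M : ClStr.{u} L} (hM : M ∈ C)
    (hMd : HasDim M.cl ℵ₀) :
    ∃! C' : Set (ClStr.{u} L), QME C' ∧ C ⊆ C' ∧ UncountablyCategorical C' := by
  have hĈ := hC.localClass hM hMd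
  refine ⟨QMEC.localClass C, ⟨hĈ, hC.subset_localClass,
    hĈ.uncountablyCategorical (hC.full_localClass hM hMd)⟩, ?_⟩
  rintro E ⟨hE, hCE, hEu⟩
  exact hE.eq_of_full (hE.full_of_mk fun κ hκ => (hEu κ hκ).1) hĈ
    (hC.subset_localClass_of_subset hM hMd hE hCE)

theorem QME.full_of_nondegenerate (hC : QME C) (h : Nondegenerate C) : Full C := by
  obtain ⟨⟨H, hH, κ, hκ, hHd⟩, hmax⟩ := h
  obtain ⟨M, hM, hMd⟩ := hC.exists_hasDim_of_le hH hHd hκ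
  have : C = QMEC.localClass C := by
    by_contra hne
    exact hmax ⟨_, hC.localClass hM hMd, hC.subset_localClass.ssubset_of_ne hne⟩
  rw [this]
  exact hC.full_localClass hM hMd

theorem QME.localClass_eq (hC : QME C) (hf : Full C) : QMEC.localClass C = C := by
  obtain ⟨M, hM, hMd⟩ := hf ℵ₀
  exact (hC.eq_of_full hf (hC.localClass hM hMd) hC.subset_localClass).symm

end Existence


/-! ### Infinitary formulas -/

namespace LQ

variable {L : FirstOrder.Language.{v, w}} {n : ℕ}

theorem QF.noUnc : ∀ {n : ℕ} {φ : LQ L n}, φ.QF → φ.NoUnc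
  | _, falsum, _ => trivial
  | _, equal _ _, _ => trivial
  | _, rel _ _, _ => trivial
  | _, neg φ, h => QF.noUnc (φ := φ) h
  | _, conj φ, h => fun i => QF.noUnc (φ := φ i) (h i)

theorem QF.realize_iff {M N : Type*} [L.Structure M] [L.Structure N] {a : Fin n → M}
    {b : Fin n → N} (hab : SameAtomic L a b) : ∀ {φ : LQ L n}, φ.QF →
    (φ.Realize M a ↔ φ.Realize N b)
  | falsum, _ => Iff.rfl
  | equal s t, _ => hab.1 s t
  | rel R t, _ => hab.2 _ R t
  | neg φ, h => not_congr (QF.realize_iff hab (φ := φ) h)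
  | conj φ, h => forall_congr' fun i => QF.realize_iff hab (φ := φ i) (h i)

open Classical in
/-- The conjunction of a countable family. -/
noncomputable def bigConj {ι : Type*} [Countable ι] (φ : ι → LQ L n) : LQ L n :=
  -- Indices outside the range of the injection into ℕ receive a true formula.
  conj fun k => if h : ∃ i, (exists_injective_nat ι).choose i = k then φ h.choose else neg falsum

theorem realize_bigConj {ι : Type*} [Countable ι] {φ : ι → LQ L n} {M : Type u} [L.Structure M]
    {a : Fin n → M} : (bigConj φ).Realize M a ↔ ∀ i, (φ i).Realize M a := by
  have hf := (exists_injective_nat ι).choose_spec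
  constructor
  · intro h i
    have hi : ∃ j, (exists_injective_nat ι).choose j = (exists_injective_nat ι).choose i := ⟨i, rfl⟩
    have h1 := h ((exists_injective_nat ι).choose i)
    dsimp only at h1
    rw [dif_pos hi, hf hi.choose_spec] at h1
    exact h1
  · intro h k
    dsimp only
    split_ifs with hk
    · exact h _
    · exact id

theorem noUnc_bigConj {ι : Type*} [Countable ι] {φ : ι → LQ L n} (h : ∀ i, (φ i).NoUnc) :
    (bigConj φ).NoUnc := by
  intro k
  dsimp only
  split_ifs
  · exact h _
  · trivial

theorem qf_bigConj {ι : Type*} [Countable ι] {φ : ι → LQ L n} (h : ∀ i, (φ i).QF) :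
    (bigConj φ).QF := by
  intro k
  dsimp only
  split_ifs
  · exact h _
  · trivial

/-- The disjunction of a countable family. -/
noncomputable def bigDisj {ι : Type*} [Countable ι] (φ : ι → LQ L n) : LQ L n :=
  neg (bigConj fun i => neg (φ i))

theorem realize_bigDisj {ι : Type*} [Countable ι] {φ : ι → LQ L n} {M : Type u} [L.Structure M]
    {a : Fin n → M} : (bigDisj φ).Realize M a ↔ ∃ i, (φ i).Realize M a := by
  change ¬ (bigConj fun i => neg (φ i)).Realize M a ↔ _
  rw [realize_bigConj]
  change (¬ ∀ i, ¬ (φ i).Realize M a) ↔ _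
  push Not
  rfl

theorem realize_and {φ ψ : LQ L n} {M : Type u} [L.Structure M] {a : Fin n → M} :
    (and φ ψ).Realize M a ↔ φ.Realize M a ∧ ψ.Realize M a := by
  constructor
  · intro h
    exact ⟨by simpa using h 0, by simpa using h 1⟩
  · rintro ⟨h1, h2⟩ i
    change LQ.Realize M (ite _ _ _) a
    split_ifs <;> assumption

theorem noUnc_and {φ ψ : LQ L n} (h1 : φ.NoUnc) (h2 : ψ.NoUnc) : (and φ ψ).NoUnc := by
  intro i
  dsimp only
  split_ifs <;> assumption

theorem realize_or {φ ψ : LQ L n} {M : Type u} [L.Structure M] {a : Fin n → M} :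
    (or φ ψ).Realize M a ↔ φ.Realize M a ∨ ψ.Realize M a := by
  change ¬ (and (neg φ) (neg ψ)).Realize M a ↔ _
  rw [realize_and]
  change ¬ (¬ φ.Realize M a ∧ ¬ ψ.Realize M a) ↔ _
  tauto

theorem realize_disj {φ : ℕ → LQ L n} {M : Type u} [L.Structure M] {a : Fin n → M} :
    (disj φ).Realize M a ↔ ∃ i, (φ i).Realize M a := by
  change (¬ ∀ i, ¬ (φ i).Realize M a) ↔ _
  push Not
  rfl

theorem realize_univClosure {M : Type u} [L.Structure M] {a₀ : Fin 0 → M} :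
    ∀ {n : ℕ} {φ : LQ L n}, φ.univClosure.Realize M a₀ ↔ ∀ a, φ.Realize M a
  | 0, φ => by
    constructor
    · intro h a
      rwa [Subsingleton.elim a a₀]
    · exact fun h => h a₀
  | n + 1, φ => by
    change (all φ).univClosure.Realize M a₀ ↔ _
    rw [realize_univClosure]
    constructor
    · intro h a
      have := h (Fin.init a) (a (Fin.last n))
      rwa [Fin.snoc_init_self] at this
    · exact fun h a x => h _

theorem noUnc_univClosure : ∀ {n : ℕ} {φ : LQ L n}, φ.NoUnc → φ.univClosure.NoUnc
  | 0, _, h => h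
  | _ + 1, φ, h => noUnc_univClosure (φ := all φ) h

theorem countable_relations [Countable L.Symbols] (k : ℕ) : Countable (L.Relations k) :=
  Function.Injective.countable (f := fun R => (Sum.inr ⟨k, R⟩ : L.Symbols))
    (fun R S h => by simpa using h)

/-- The atomic formulas and their negations that hold at `a`. -/
noncomputable def atomType [Countable L.Symbols] {M : Type u} [L.Structure M] (a : Fin n → M) :
    LQ L n :=
  open Classical in
  and
    (bigConj fun p : L.Term (Fin n) × L.Term (Fin n) =>
      if p.1.realize a = p.2.realize a then equal p.1 p.2 else neg (equal p.1 p.2))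
    (bigConj fun k : ℕ =>
      haveI := countable_relations (L := L) k
      bigConj fun p : L.Relations k × (Fin k → L.Term (Fin n)) =>
        if Structure.RelMap p.1 (fun i => (p.2 i).realize a) then rel p.1 p.2
        else neg (rel p.1 p.2))

variable [Countable L.Symbols]

theorem realize_atomType {M N : Type u} [L.Structure M] [L.Structure N] {a : Fin n → M}
    {b : Fin n → N} : (atomType (L := L) a).Realize N b ↔ SameAtomic L a b := by
  classical
  rw [atomType, realize_and, realize_bigConj, realize_bigConj]
  refine and_congr ?_ ?_
  · rw [Prod.forall]
    refine forall_congr' fun s => forall_congr' fun t => ?_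
    dsimp only
    split_ifs with h
    · exact (iff_true_left h).symm
    · exact (iff_false_left h).symm
  · refine forall_congr' fun k => ?_
    have := countable_relations (L := L) k
    rw [realize_bigConj, Prod.forall]
    refine forall_congr' fun R => forall_congr' fun t => ?_
    dsimp only
    split_ifs with h
    · exact (iff_true_left h).symm
    · exact (iff_false_left h).symm

theorem qf_atomType {M : Type u} [L.Structure M] (a : Fin n → M) :
    (atomType (L := L) a).QF := by
  classical
  intro i
  dsimp only
  split_ifs
  · refine qf_bigConj fun p => ?_
    split_ifs <;> trivial
  · refine qf_bigConj fun k => ?_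
    have := countable_relations (L := L) k
    refine qf_bigConj fun p => ?_
    split_ifs <;> trivial

/-- The back-and-forth conditions over `M` for atomic types. -/
noncomputable def backForth (L : FirstOrder.Language.{v, w}) [Countable L.Symbols] (M : Type u)
    [L.Structure M] [Countable M] : LQ L 0 :=
  and (atomType (Fin.elim0 : Fin 0 → M))
    (bigConj fun n : ℕ => bigConj fun a : Fin n → M => univClosure
      (or (neg (atomType a))
        (and (bigConj fun c : M => neg (all (neg (atomType (Fin.snoc a c : Fin (n + 1) → M)))))
          (all (bigDisj fun c : M => atomType (Fin.snoc a c : Fin (n + 1) → M))))))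

theorem noUnc_backForth (M : Type u) [L.Structure M] [Countable M] :
    (backForth L M).NoUnc := by
  refine noUnc_and (qf_atomType _).noUnc (noUnc_bigConj fun n => noUnc_bigConj fun a =>
    noUnc_univClosure (noUnc_and (qf_atomType _).noUnc (noUnc_and ?_ ?_)))
  · exact noUnc_bigConj fun c => (qf_atomType _).noUnc
  · exact noUnc_bigConj fun c => (qf_atomType _).noUnc

end LQ

/-- The back-and-forth property for atomic types of finite tuples. -/
def BackForth (L : FirstOrder.Language.{v, w}) (M N : Type u) [L.Structure M] [L.Structure N] :
    Prop :=
  SameAtomic L (Fin.elim0 : Fin 0 → M) (Fin.elim0 : Fin 0 → N) ∧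
  ∀ (n : ℕ) (a : Fin n → M) (b : Fin n → N), SameAtomic L a b →
    (∀ c : M, ∃ d : N, SameAtomic L (Fin.snoc a c : Fin (n + 1) → M)
      (Fin.snoc b d : Fin (n + 1) → N)) ∧
    ∀ d : N, ∃ c : M, SameAtomic L (Fin.snoc a c : Fin (n + 1) → M)
      (Fin.snoc b d : Fin (n + 1) → N)

/-! ### Back-and-forth systems and Scott sentences -/

section ScottSentences

variable {L : FirstOrder.Language.{v, w}}

theorem LQ.realize_backForth [Countable L.Symbols] {M N : Type u} [L.Structure M]
    [L.Structure N] [Countable M] :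
    (LQ.backForth L M).Realize N Fin.elim0 ↔ BackForth L M N := by
  rw [LQ.backForth, LQ.realize_and, LQ.realize_atomType, LQ.realize_bigConj]
  refine and_congr Iff.rfl (forall_congr' fun n => ?_)
  rw [LQ.realize_bigConj]
  refine forall_congr' fun a => ?_
  rw [LQ.realize_univClosure]
  refine forall_congr' fun b => ?_
  rw [LQ.realize_or, LQ.realize_and, LQ.realize_bigConj]
  have h1 : (LQ.neg (LQ.atomType (L := L) a)).Realize N b ↔ ¬ SameAtomic L a b :=
    not_congr LQ.realize_atomType
  rw [h1, ← imp_iff_not_or]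
  refine imp_congr Iff.rfl (and_congr (forall_congr' fun c => ?_) (forall_congr' fun d => ?_))
  · change (¬ ∀ d : N, ¬ LQ.Realize N _ _) ↔ _
    push Not
    exact exists_congr fun d => LQ.realize_atomType
  · rw [LQ.realize_bigDisj]
    exact exists_congr fun c => LQ.realize_atomType

theorem SameAtomic.partialEmb {H K : ClStr.{u} L} {ι : Type*} {a : ι → H.carrier}
    {b : ι → K.carrier} (h : SameAtomic L a b) :
    PartialEmb H K (Set.range fun i => (a i, b i)) := by
  refine partialEmb_iff.2 fun n p hp => ?_
  choose e he using hp
  have h1 : (fun i => (p i).1) = a ∘ e := funext fun i => by simp [← he]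
  have h2 : (fun i => (p i).2) = b ∘ e := funext fun i => by simp [← he]
  rw [h1, h2]
  exact h.comp e

theorem range_snoc_pair {α β : Type*} {n : ℕ} (a : Fin n → α) (b : Fin n → β) (c : α) (d : β) :
    (Set.range fun i => ((Fin.snoc a c : Fin (n + 1) → α) i, (Fin.snoc b d : Fin (n + 1) → β) i)) =
      (Set.range fun i => (a i, b i)) ∪ {(c, d)} := by
  ext p
  constructor
  · rintro ⟨i, rfl⟩
    refine Fin.lastCases ?_ (fun i => ?_) i
    · exact Or.inr (by simp)
    · exact Or.inl ⟨i, by simp⟩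
  · rintro (⟨i, rfl⟩ | h)
    · exact ⟨i.castSucc, by simp⟩
    · exact ⟨Fin.last n, by simpa using h.symm⟩

theorem exists_fin_range {α : Type*} {s : Set α} (hs : s.Finite) :
    ∃ (n : ℕ) (p : Fin n → α), Set.range p = s := by
  have := hs.to_subtype
  obtain ⟨n, ⟨e⟩⟩ := Finite.exists_equiv_fin s
  refine ⟨n, fun i => e.symm i, ?_⟩
  have : (fun i => (e.symm i : α)) = Subtype.val ∘ e.symm := rfl
  rw [this, Set.range_comp, e.symm.surjective.range_eq, Set.image_univ, Subtype.range_coe]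

namespace BackForth

variable {M H : ClStr.{u} L} (h : BackForth L M.carrier H.carrier)
include h

theorem empty : PartialEmb M H ∅ := by
  simpa using h.1.partialEmb

theorem forth {r : SetRel M.carrier H.carrier} (hr : r.Finite) (hre : PartialEmb M H r)
    (c : M.carrier) : ∃ d, PartialEmb M H (r ∪ {(c, d)}) := by
  obtain ⟨n, p, rfl⟩ := exists_fin_range hr
  obtain ⟨d, hd⟩ := (h.2 n _ _ (partialEmb_iff.1 hre n p fun i => ⟨i, rfl⟩)).1 c
  refine ⟨d, ?_⟩
  have := hd.partialEmb
  rwa [range_snoc_pair] at this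

theorem back {r : SetRel M.carrier H.carrier} (hr : r.Finite) (hre : PartialEmb M H r)
    (d : H.carrier) : ∃ c, PartialEmb M H (r ∪ {(c, d)}) := by
  obtain ⟨n, p, rfl⟩ := exists_fin_range hr
  obtain ⟨c, hc⟩ := (h.2 n _ _ (partialEmb_iff.1 hre n p fun i => ⟨i, rfl⟩)).2 d
  refine ⟨c, ?_⟩
  have := hc.partialEmb
  rwa [range_snoc_pair] at this

theorem exists_finite {F : Set H.carrier} (hF : F.Finite) :
    ∃ r : SetRel M.carrier H.carrier, r.Finite ∧ PartialEmb M H r ∧ F ⊆ r.cod := by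
  induction F, hF using Set.Finite.induction_on with
  | empty => exact ⟨∅, Set.finite_empty, h.empty, Set.empty_subset _⟩
  | @insert d F _ _ ih =>
    obtain ⟨r, hr, hre, hFr⟩ := ih
    obtain ⟨c, hc⟩ := h.back hr hre d
    refine ⟨_, hr.union (Set.finite_singleton _), hc, Set.insert_subset ⟨c, Or.inr rfl⟩ ?_⟩
    exact hFr.trans (SetRel.cod_mono Set.subset_union_left)

/-- Countable parts are matched by a back-and-forth. -/
theorem exists_extension {r : SetRel M.carrier H.carrier} (hr : r.Finite)
    (hre : PartialEmb M H r) {S : Set M.carrier} {T : Set H.carrier} (hS : S.Countable)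
    (hT : T.Countable) : ∃ F : SetRel M.carrier H.carrier, r ⊆ F ∧ PartialEmb M H F ∧
      S ⊆ F.dom ∧ T ⊆ F.cod := by
  obtain ⟨c, hmono, h0, hP, hS, hT⟩ := exists_back_and_forth hS hT
    (fun r : SetRel M.carrier H.carrier => r.Finite ∧ PartialEmb M H r) r ⟨hr, hre⟩
    (fun s hs x _ => by
      obtain ⟨d, hd⟩ := h.forth hs.1 hs.2 x
      exact ⟨d, hs.1.union (Set.finite_singleton _), hd⟩)
    (fun s hs y _ => by
      obtain ⟨d, hd⟩ := h.back hs.1 hs.2 y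
      exact ⟨d, hs.1.union (Set.finite_singleton _), hd⟩)
  exact ⟨⋃ n, c n, h0 ▸ Set.subset_iUnion c 0, PartialEmb.iUnion_nat hmono fun n => (hP n).2,
    hS, hT⟩

end BackForth

/-- Atomic types suffice: a point in the closure of a tuple is matched by homogeneity over ∅, a
point outside it by a generic point, which exists by the assumption on dimensions. -/
theorem BackForth.of_homogeneous {C : Set (ClStr.{u} L)} (hC : Homogeneous C)
    {M H : ClStr.{u} L} (hM : M ∈ C) (hH : H ∈ C) (h1 : DimLE M H) (h2 : DimLE H M) :
    BackForth L M.carrier H.carrier := by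
  refine ⟨(hC.empty_map M hM H hH).sameAtomic fun i => i.elim0, fun n a b hab =>
    ⟨fun c => ?_, fun d => ?_⟩⟩
  · obtain ⟨d, hd⟩ := hC.exists_forth hM hH h1 (Set.finite_range _) hab.partialEmb c
    rw [← range_snoc_pair] at hd
    exact ⟨d, hd.sameAtomic fun i => ⟨i, rfl⟩⟩
  · obtain ⟨c, hc⟩ := hC.exists_forth hH hM h2 (Set.finite_range _) hab.symm.partialEmb d
    rw [← range_snoc_pair] at hc
    exact ⟨c, (hc.sameAtomic fun i => ⟨i, rfl⟩).symm⟩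

theorem BackForth.of_equiv {M N N' : Type u} [L.Structure M] [L.Structure N] [L.Structure N']
    (h : BackForth L M N) (e : N ≃[L] N') : BackForth L M N' := by
  have he : ∀ {n : ℕ} (b : Fin n → N), SameAtomic L b (e ∘ b) := fun b =>
    SameAtomic.of_embedding e.toEmbedding b
  have he' : ∀ {n : ℕ} (b : Fin n → N'), ∃ b₀ : Fin n → N, b = e ∘ b₀ := fun b =>
    ⟨e.symm ∘ b, by funext i; simp⟩
  have hs : ∀ {n : ℕ} (b : Fin n → N) (d : N), (Fin.snoc (e ∘ b) (e d) : Fin (n + 1) → N') =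
      e ∘ (Fin.snoc b d : Fin (n + 1) → N) := fun b d => (Fin.comp_snoc e b d).symm
  refine ⟨h.1.trans ?_, fun n a b hab => ?_⟩
  · have := he (Fin.elim0 : Fin 0 → N)
    rwa [Subsingleton.elim (e ∘ (Fin.elim0 : Fin 0 → N)) Fin.elim0] at this
  · obtain ⟨b, rfl⟩ := he' b
    obtain ⟨h1, h2⟩ := h.2 n a b (hab.trans (he b).symm)
    refine ⟨fun c => ?_, fun d => ?_⟩
    · obtain ⟨d, hd⟩ := h1 c
      exact ⟨e d, by rw [hs]; exact hd.trans (he _)⟩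
    · obtain ⟨d, rfl⟩ := e.surjective d
      obtain ⟨c, hc⟩ := h2 d
      exact ⟨c, by rw [hs]; exact hc.trans (he _)⟩

theorem isScottSentence_backForth [Countable L.Symbols] {C : Set (ClStr.{u} L)}
    (hC : Homogeneous C) {M : ClStr.{u} L} (hM : M ∈ C) [Countable M.carrier] :
    (LQ.backForth L M.carrier).IsScottSentence M.carrier := by
  have hMM : BackForth L M.carrier M.carrier := .of_homogeneous hC hM hM
    (fun I hI => ⟨I, hI, rfl⟩) (fun I hI => ⟨I, hI, rfl⟩)
  refine ⟨LQ.noUnc_backForth _, fun N _ hN => ?_⟩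
  rw [LQ.realize_backForth]
  constructor
  · intro h
    -- The closure operator `id` is a dummy; partial embeddings do not depend on it.
    let N' : ClStr.{u} L := ⟨N, inferInstance, id⟩
    have h' : BackForth L M.carrier N'.carrier := h
    have : Countable N'.carrier := hN
    obtain ⟨F, _, hF, hd, hc⟩ := h'.exists_extension Set.finite_empty h'.empty
      (S := Set.univ) (T := Set.univ) Set.countable_univ Set.countable_univ
    obtain ⟨e, _⟩ := hF.exists_equiv (Set.univ_subset_iff.1 hd) (Set.univ_subset_iff.1 hc)
    exact ⟨e.symm⟩
  · rintro ⟨e⟩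
    exact hMM.of_equiv e.symm

end ScottSentences


/-! ### Definability of classes by Scott sentences -/

section Definability

variable {L : FirstOrder.Language.{v, w}} {C : Set (ClStr.{u} L)}

theorem Homogeneous.countable_of_hasDim (hC : Homogeneous C) {M : ClStr.{u} L} (hM : M ∈ C)
    {κ : Cardinal.{u}} (hκ : κ ≤ ℵ₀) (h : HasDim M.cl κ) : Countable M.carrier := by
  obtain ⟨B, _, hB, rfl⟩ := h
  rw [← Set.countable_univ_iff, ← hB]
  exact hC.countable_cl hM (Cardinal.le_aleph0_iff_set_countable.1 hκ)

/-- Repeated extension by one point copies any finite tuple of H into M; with M of dimension ℵ₀ this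
makes every atomic type occurring in the class occur in one countable structure. -/
theorem Homogeneous.exists_sameAtomic (hC : Homogeneous C) {H M : ClStr.{u} L} (hH : H ∈ C)
    (hM : M ∈ C) (hd : DimLE H M) : ∀ {n : ℕ} (b : Fin n → H.carrier),
    ∃ a : Fin n → M.carrier, SameAtomic L b a
  | 0, _ => ⟨Fin.elim0, (hC.empty_map H hH M hM).sameAtomic fun i => i.elim0⟩
  | n + 1, b => by
    obtain ⟨a, ha⟩ := hC.exists_sameAtomic hH hM hd (Fin.init b)
    obtain ⟨c, hc⟩ := hC.exists_forth hH hM hd (Set.finite_range _) ha.partialEmb (b (Fin.last n))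
    rw [← range_snoc_pair, Fin.snoc_init_self] at hc
    exact ⟨_, hc.sameAtomic fun i => ⟨i, rfl⟩⟩

theorem Homogeneous.mem_cl_of_sameAtomic (hC : Homogeneous C) {H K : ClStr.{u} L} (hH : H ∈ C)
    (hK : K ∈ C) {n : ℕ} {a : Fin n → H.carrier} {b : Fin n → K.carrier} {c : H.carrier}
    {d : K.carrier} (h : SameAtomic L (Fin.snoc a c : Fin (n + 1) → H.carrier)
      (Fin.snoc b d : Fin (n + 1) → K.carrier)) (hc : c ∈ H.cl (Set.range a)) :
    d ∈ K.cl (Set.range b) := by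
  have hp := h.partialEmb
  rw [range_snoc_pair] at hp
  refine hC.mem_cl_of_mem hH hK hp ?_ hc (Or.inr rfl)
  rintro _ ⟨i, rfl⟩
  exact ⟨b i, (hC.pregeometry K hK).subset_cl _ ⟨i, rfl⟩, Or.inl ⟨i, rfl⟩⟩

/-- The formula that defines the closure of `n` points, the last variable being the point in the
closure. -/
noncomputable def closureFormula [Countable L.Symbols] (M : ClStr.{u} L) [Countable M.carrier]
    (n : ℕ) : LQ L (n + 1) :=
  LQ.bigDisj fun p : {p : (Fin n → M.carrier) × M.carrier // p.2 ∈ M.cl (Set.range p.1)} =>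
    LQ.atomType (Fin.snoc p.1.1 p.1.2 : Fin (n + 1) → M.carrier)

theorem qf_closureFormula [Countable L.Symbols] (M : ClStr.{u} L) [Countable M.carrier]
    (n : ℕ) : (closureFormula M n).QF :=
  LQ.qf_bigConj fun _ => LQ.qf_atomType _

theorem Homogeneous.realize_closureFormula [Countable L.Symbols] (hC : Homogeneous C)
    {M H : ClStr.{u} L} [Countable M.carrier] (hM : M ∈ C) (hH : H ∈ C) (hd : DimLE H M) {n : ℕ}
    (b : Fin n → H.carrier) (a : H.carrier) :
    a ∈ H.cl (Set.range b) ↔ (closureFormula M n).Realize H.carrier (Fin.snoc b a) := by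
  rw [closureFormula, LQ.realize_bigDisj]
  constructor
  · intro ha
    obtain ⟨c, hc⟩ := hC.exists_sameAtomic hH hM hd (Fin.snoc b a : Fin (n + 1) → H.carrier)
    rw [← Fin.snoc_init_self c] at hc
    exact ⟨⟨⟨Fin.init c, c (Fin.last n)⟩, hC.mem_cl_of_sameAtomic hH hM hc ha⟩,
      LQ.realize_atomType.2 hc.symm⟩
  · rintro ⟨⟨⟨b', a'⟩, h⟩, hr⟩
    exact hC.mem_cl_of_sameAtomic hM hH (LQ.realize_atomType.1 hr) h

theorem LQ.realize_scottForm {σω : LQ L 0} {σ : ℕ → LQ L 0} {π : ∀ n, LQ L (n + 1)} {M : Type u}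
    [L.Structure M] : (LQ.scottForm σω σ π).Realize M Fin.elim0 ↔
      (σω.Realize M Fin.elim0 ∨ ∃ n, (σ n).Realize M Fin.elim0) ∧
      ∀ (n : ℕ) (b : Fin n → M), {x | (π n).Realize M (Fin.snoc b x)}.Countable := by
  rw [LQ.scottForm, LQ.realize_and, LQ.realize_or, LQ.realize_disj]
  refine and_congr Iff.rfl (forall_congr' fun n => ?_)
  rw [LQ.realize_univClosure]
  exact forall_congr' fun b => not_not

/-- The closure operator of `H` is defined by the formulas `π`. -/
def ClDefinedBy (H : ClStr.{u} L) (π : ∀ n, LQ L (n + 1)) : Prop :=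
  ∀ (X : Set H.carrier) (a : H.carrier), a ∈ H.cl X ↔
    ∃ (n : ℕ) (b : Fin n → H.carrier), (∀ i, b i ∈ X) ∧ (π n).Realize H.carrier (Fin.snoc b a)

theorem IsPregeometry.clDefinedBy {H : ClStr.{u} L} (pH : IsPregeometry H.cl)
    {π : ∀ n, LQ L (n + 1)} (h : ∀ (n : ℕ) (b : Fin n → H.carrier) (a : H.carrier),
      a ∈ H.cl (Set.range b) ↔ (π n).Realize H.carrier (Fin.snoc b a)) : ClDefinedBy H π := by
  intro X a
  constructor
  · intro ha
    obtain ⟨Y, hY, hYX, haY⟩ := pH.finite_char X a ha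
    obtain ⟨n, b, rfl⟩ := exists_fin_range hY
    exact ⟨n, b, fun i => hYX ⟨i, rfl⟩, (h n b a).1 haY⟩
  · rintro ⟨n, b, hb, ha⟩
    exact pH.mono _ _ (Set.range_subset_iff.2 hb) ((h n b a).2 ha)

/-- Partial embeddings preserve closure operators defined by the same formulas. -/
theorem ClDefinedBy.mem_cl_iff {M H : ClStr.{u} L} {π : ∀ n, LQ L (n + 1)} (hπ : ∀ n, (π n).QF)
    (hM : ClDefinedBy M π) (hH : ClDefinedBy H π) {r : SetRel M.carrier H.carrier}
    (hr : PartialEmb M H r) {X : Set H.carrier} (hX : X ⊆ r.cod) {c : M.carrier} {d : H.carrier}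
    (hcd : (c, d) ∈ r) : d ∈ H.cl X ↔ c ∈ M.cl (r.preimage X) := by
  have key : ∀ {n : ℕ} (a : Fin n → M.carrier) (b : Fin n → H.carrier),
      (∀ i, (a i, b i) ∈ r) → ((π n).Realize M.carrier (Fin.snoc a c) ↔
        (π n).Realize H.carrier (Fin.snoc b d)) := by
    intro n a b hab
    refine LQ.QF.realize_iff (hr.sameAtomic fun i => ?_) (hπ n)
    refine Fin.lastCases ?_ (fun i => ?_) i
    · simpa using hcd
    · simpa using hab i
  rw [hM, hH]
  constructor
  · rintro ⟨n, b, hb, h⟩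
    choose a ha using fun i => hX (hb i)
    exact ⟨n, a, fun i => ⟨b i, hb i, ha i⟩, (key a b ha).2 h⟩
  · rintro ⟨n, a, ha, h⟩
    choose b hb hab using ha
    exact ⟨n, b, hb, (key a b hab).1 h⟩

/-- Closure is defined by quantifier-free formulas, so matched finite tuples transfer the
pregeometry axioms from M to H. For finite X the closure in H is countable by the Q-clause, so a
full back-and-forth identifies it with the closure of a matching finite set in M, which is covered
by a member of C. -/
theorem mem_localClass_of_backForth (hC : QME C) {M H : ClStr.{u} L} (hM : M ∈ C)
    (h : BackForth L M.carrier H.carrier) {π : ∀ n, LQ L (n + 1)} (hπ : ∀ n, (π n).QF)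
    (hMπ : ClDefinedBy M π) (hHπ : ClDefinedBy H π)
    (hQ : ∀ (n : ℕ) (b : Fin n → H.carrier),
      {x | (π n).Realize H.carrier (Fin.snoc b x)}.Countable) : H ∈ localClass C := by
  have pM := hC.pregeometry M hM
  have pre : ∀ {r : SetRel M.carrier H.carrier} (_ : PartialEmb M H r) {ι : Type u}
      (a : ι → M.carrier) (b : ι → H.carrier) (_ : ∀ i, (a i, b i) ∈ r) (Y : Set ι),
      r.preimage (b '' Y) = a '' Y := by
    intro r hr ι a b hab Y
    ext x
    constructor
    · rintro ⟨_, ⟨i, hi, rfl⟩, hx⟩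
      exact ⟨i, hi, hr.left_unique (hab i) hx⟩
    · rintro ⟨i, hi, rfl⟩
      exact ⟨b i, ⟨i, hi, rfl⟩, hab i⟩
  have pH : IsPregeometry H.cl := by
    refine .of_local (fun X Y hXY a ha => ?_) (fun X a ha => ?_) fun F hF => ?_
    · rw [hHπ] at ha ⊢
      obtain ⟨n, b, hb, h⟩ := ha
      exact ⟨n, b, fun i => hXY (hb i), h⟩
    · obtain ⟨n, b, hb, h⟩ := (hHπ X a).1 ha
      exact ⟨_, Set.finite_range b, Set.range_subset_iff.2 hb,
        (hHπ _ a).2 ⟨n, b, fun i => ⟨i, rfl⟩, h⟩⟩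
    · obtain ⟨r, _, hr, hFr⟩ := h.exists_finite hF
      choose φ hφ using fun x : F => hFr x.2
      refine ⟨M.carrier, M.cl, φ, pM, fun X y => ?_⟩
      rw [hMπ.mem_cl_iff hπ hHπ hr ((Subtype.coe_image_subset F X).trans hFr) (hφ y),
        pre hr φ Subtype.val hφ]
  refine ⟨pH, fun X hX => ?_⟩
  obtain ⟨r, hrf, hr, hXr⟩ := h.exists_finite hX
  have hXc : (H.cl X).Countable := by
    have := hX.to_subtype
    refine (Set.countable_iUnion fun n => Set.countable_iUnion fun b : Fin n → X =>
      hQ n (Subtype.val ∘ b)).mono fun a ha => ?_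
    obtain ⟨n, b, hb, h⟩ := (hHπ X a).1 ha
    exact Set.mem_iUnion.2 ⟨n, Set.mem_iUnion.2 ⟨fun i => ⟨b i, hb i⟩, h⟩⟩
  have hX' : (r.preimage X).Finite := (SetRel.dom_finite hrf).subset
    fun a ⟨b, _, hab⟩ => ⟨b, hab⟩
  obtain ⟨F, hrF, hF, hFd, hFc⟩ := h.exists_extension hrf hr (hC.ccp M hM _ hX') hXc
  have hFX : F.preimage X = r.preimage X := by
    ext a
    constructor
    · rintro ⟨b, hb, hab⟩
      obtain ⟨a', ha'⟩ := hXr hb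
      rw [hF.left_unique hab (hrF ha')]
      exact ⟨b, hb, ha'⟩
    · rintro ⟨b, hb, hab⟩
      exact ⟨b, hb, hrF hab⟩
  have hXF : X ⊆ F.cod := hXr.trans (SetRel.cod_mono hrF)
  obtain ⟨N, hN, i, hi, hir⟩ := hC.covered hM (r.preimage X)
  -- The required embedding into H is the cover of the closure in M followed by the matching F.
  obtain ⟨f, hf⟩ := ((PartialEmb.graph i).comp hF).exists_embedding (by
    refine Set.eq_univ_of_forall fun x => ?_
    obtain ⟨y, hy⟩ := hFd (hir ▸ Set.mem_range_self x : i x ∈ M.cl (r.preimage X))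
    exact ⟨y, i x, rfl, hy⟩)
  replace hf : ∀ x, (i x, f x) ∈ F := fun x => by
    obtain ⟨y, hy, h⟩ := hf x
    change i x = y at hy
    rwa [hy]
  have hfr : Set.range f = H.cl X := by
    ext y
    constructor
    · rintro ⟨x, rfl⟩
      rw [hMπ.mem_cl_iff hπ hHπ hF hXF (hf x), hFX, ← hir]
      exact ⟨x, rfl⟩
    · intro hy
      obtain ⟨x, hx⟩ := hFc hy
      rw [hMπ.mem_cl_iff hπ hHπ hF hXF hx, hFX, ← hir] at hy
      obtain ⟨a, rfl⟩ := hy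
      exact ⟨a, hF.right_unique (hf a) hx⟩
  refine ⟨N, hN, f, fun Y => ?_, hfr⟩
  have hYF : f '' Y ⊆ F.cod := by
    rintro _ ⟨x, _, rfl⟩
    exact ⟨i x, hf x⟩
  have hiff : ∀ x, f x ∈ H.cl (f '' Y) ↔ x ∈ N.cl Y := fun x => by
    rw [hMπ.mem_cl_iff hπ hHπ hF hYF (hf x), pre hF i f hf, hi.mem_cl_iff]
  ext y
  constructor
  · rintro ⟨x, hx, rfl⟩
    exact (hiff x).2 hx
  · intro hy
    have hyr : y ∈ Set.range f := by
      rw [hfr]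
      exact pH.cl_subset (hfr ▸ Set.image_subset_range f Y) hy
    obtain ⟨x, rfl⟩ := hyr
    exact ⟨x, (hiff x).1 hy, rfl⟩

theorem QME.scottDefinable [Countable L.Symbols] (hC : QME C) (hf : Full C) :
    ScottDefinable C := by
  have hh := hC.homogeneous
  obtain ⟨M, hM, hMd⟩ := hf ℵ₀
  choose N hN hNd using fun n : ℕ => hf n
  have pM := hC.pregeometry M hM
  have : Countable M.carrier := hh.countable_of_hasDim hM le_rfl hMd
  have : ∀ n, Countable (N n).carrier := fun n =>
    hh.countable_of_hasDim (hN n) Cardinal.natCast_le_aleph0 (hNd n)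
  have hdM : ∀ H, DimLE H M := fun H => dimLE_of_hasDim_infinite pM le_rfl hMd
  have hcl : ∀ H ∈ C, ∀ (n : ℕ) (b : Fin n → H.carrier) (a : H.carrier), a ∈ H.cl (Set.range b) ↔
      (closureFormula M n).Realize H.carrier (Fin.snoc b a) :=
    fun H hH n b a => hh.realize_closureFormula hM hH (hdM H) b a
  have hdef : ∀ H ∈ C, ClDefinedBy H (closureFormula M) := fun H hH =>
    (hC.pregeometry H hH).clDefinedBy (hcl H hH)
  refine ⟨LQ.backForth L M.carrier, fun n => LQ.backForth L (N n).carrier, closureFormula M,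
    ⟨M, hM, hMd, isScottSentence_backForth hh hM⟩,
    fun n => ⟨N n, hN n, hNd n, isScottSentence_backForth hh (hN n)⟩,
    qf_closureFormula M, hcl, fun H => ?_⟩
  rw [LQ.realize_scottForm]
  simp only [LQ.realize_backForth]
  constructor
  · intro hH
    have pH := hC.pregeometry H hH
    refine ⟨⟨?_, fun n b => ?_⟩, hdef H hH⟩
    · obtain ⟨B, hB, hBs⟩ := exists_basis pH
      rcases lt_or_ge #B ℵ₀ with hlt | hge
      · obtain ⟨n, hn⟩ := Cardinal.lt_aleph0.1 hlt
        have hHd : HasDim H.cl n := ⟨B, hB, hBs, hn⟩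
        have pN := hC.pregeometry (N n) (hN n)
        exact Or.inr ⟨n, .of_homogeneous hh (hN n) hH (dimLE_of_hasDim_nat pN pH (hNd n) hHd)
          (dimLE_of_hasDim_nat pH pN hHd (hNd n))⟩
      · exact Or.inl (.of_homogeneous hh hM hH
          (dimLE_of_hasDim_infinite pH hge ⟨B, hB, hBs, rfl⟩) (hdM H))
    · refine (hC.ccp H hH _ (Set.finite_range b)).mono fun x hx => ?_
      exact (hcl H hH n b x).2 hx
  · rintro ⟨⟨h, hQ⟩, hHπ⟩
    -- Since a class with all dimensions equals its local class, only finite-dimensional pieces of H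
    -- need to be recognized.
    rw [← hC.localClass_eq hf]
    rcases h with h | ⟨n, h⟩
    · exact mem_localClass_of_backForth hC hM h (qf_closureFormula M) (hdef M hM) hHπ hQ
    · exact mem_localClass_of_backForth hC (hN n) h (qf_closureFormula M) (hdef _ (hN n)) hHπ hQ

end Definability


/-! ### Reducts -/

section Reducts

variable {L₀ : FirstOrder.Language.{v', w'}} {L : FirstOrder.Language.{v, w}} (φ : L₀ →ᴸ L)

theorem ClStr.realize_onTerm {ι : Type*} (H : ClStr.{u} L) (a : ι → H.carrier) (t : L₀.Term ι) :
    (φ.onTerm t).realize a = t.realize (M := (H.reduct φ).carrier) a := by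
  induction t with
  | var i => rfl
  | func f ts ih =>
    simp only [LHom.onTerm, Term.realize, ih]
    rfl

theorem SameAtomic.reduct {H K : ClStr.{u} L} {ι : Type*} {a : ι → H.carrier}
    {b : ι → K.carrier} (h : SameAtomic L a b) :
    SameAtomic L₀ (M := (H.reduct φ).carrier) (N := (K.reduct φ).carrier) a b := by
  refine ⟨fun s t => ?_, fun k R t => ?_⟩
  · have := h.1 (φ.onTerm s) (φ.onTerm t)
    simp only [ClStr.realize_onTerm] at this
    exact this
  · have := h.2 k (φ.onRelation R) fun i => φ.onTerm (t i)
    simp only [ClStr.realize_onTerm] at this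
    exact this

theorem PartialEmb.reduct {H K : ClStr.{u} L} {r : SetRel H.carrier K.carrier}
    (h : PartialEmb H K r) : PartialEmb (H.reduct φ) (K.reduct φ) r :=
  partialEmb_iff.2 fun n p hp => (partialEmb_iff.1 h n p hp).reduct φ

variable {C : Set (ClStr.{u} L)}

/-- Tuples of H and K are copied into M with their full atomic types, so it is enough that the
smaller language separates atomic types within M. -/
theorem Homogeneous.partialEmb_of_reduct (hC : Homogeneous C) {M : ClStr.{u} L} (hM : M ∈ C)
    (hd : ∀ H, DimLE H M) (hφ : ∀ (n : ℕ) (a b : Fin n → M.carrier),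
      SameAtomic L₀ (M := (M.reduct φ).carrier) (N := (M.reduct φ).carrier) a b →
        SameAtomic L a b) {H K : ClStr.{u} L} (hH : H ∈ C) (hK : K ∈ C)
    (r : SetRel H.carrier K.carrier) (h : PartialEmb (H.reduct φ) (K.reduct φ) r) :
    PartialEmb H K r := by
  refine partialEmb_iff.2 fun n p hp => ?_
  obtain ⟨a, ha⟩ := hC.exists_sameAtomic hH hM (hd H) fun i => (p i).1
  obtain ⟨b, hb⟩ := hC.exists_sameAtomic hK hM (hd K) fun i => (p i).2
  have h1 := partialEmb_iff.1 h n p hp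
  exact (ha.trans (hφ n a b (((ha.reduct φ).symm.trans h1).trans (hb.reduct φ)))).trans hb.symm

variable (hφ : ∀ H ∈ C, ∀ K ∈ C, ∀ r : SetRel H.carrier K.carrier,
  PartialEmb (H.reduct φ) (K.reduct φ) r → PartialEmb H K r)

/-- The L-structure is transported along the bijection; this makes the class of reducts closed under
isomorphism. -/
theorem ClStr.Iso.exists_reduct_eq {H : ClStr.{u} L} {K : ClStr.{u} L₀}
    (h : (H.reduct φ).Iso K) : ∃ K' : ClStr.{u} L, H.Iso K' ∧ K'.reduct φ = K := by
  obtain ⟨e, he⟩ := h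
  obtain ⟨A, s, c⟩ := K
  let e' : H.carrier ≃ A := e.toEquiv
  let K' : ClStr.{u} L := ⟨A, e'.inducedStructure, c⟩
  refine ⟨K', ⟨e'.inducedStructureEquiv, he⟩, ?_⟩
  have : @LHom.reduct _ _ φ A K'.str = s := by
    ext n f x
    · refine (e.map_fun f (e.symm ∘ x)).trans ?_
      congr 1
      funext i
      exact e.apply_symm_apply (x i)
    · refine Iff.trans (e.map_rel f (e.symm ∘ x)).symm ?_
      have : e ∘ e.symm ∘ x = x := funext fun i => e.apply_symm_apply (x i)
      rw [this]
  change ClStr.mk A (@LHom.reduct _ _ φ A K'.str) c = _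
  rw [this]

include hφ

/-- Both languages have the same partial embeddings between members of C, and all axioms but closure
under isomorphism and (I.2) involve the language only through these. -/
theorem QME.reduct (hC : QME C) : QME (ClStr.reduct φ '' C) where
  iso_closed := by
    rintro _ ⟨H, hH, rfl⟩ K h
    obtain ⟨K', hK', rfl⟩ := h.exists_reduct_eq φ
    exact ⟨K', hC.iso_closed H hH K' hK', rfl⟩
  empty_map := by
    rintro _ ⟨H, hH, rfl⟩ _ ⟨K, hK, rfl⟩
    exact (hC.empty_map H hH K hK).reduct φ
  pregeometry := by
    rintro _ ⟨H, hH, rfl⟩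
    exact hC.pregeometry H hH
  ccp := by
    rintro _ ⟨H, hH, rfl⟩
    exact hC.ccp H hH
  closure_mem := by
    rintro _ ⟨H, hH, rfl⟩ X
    obtain ⟨S, hS, hSC⟩ := hC.closure_mem H hH X
    exact ⟨⟨(S : Set H.carrier), fun f x hx => S.fun_mem (φ.onFunction f) x hx⟩, hS, H.sub S, hSC, rfl⟩
  closure_preserved := by
    rintro _ ⟨H, hH, rfl⟩ _ ⟨K, hK, rfl⟩ X y hy f hf
    exact hC.closure_preserved H hH K hK X y hy f (hφ H hH K hK f hf)
  homogeneity_generic := by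
    rintro _ ⟨H, hH, rfl⟩ _ ⟨K, hK, rfl⟩ G G' hG hG' g hg h1 h2 x x' hx hx'
    exact (hC.homogeneity_generic H hH K hK G G' hG hG' g (hφ H hH K hK g hg) h1 h2 x x' hx
      hx').reduct φ
  homogeneity_closure := by
    rintro _ ⟨H, hH, rfl⟩ _ ⟨K, hK, rfl⟩ G G' hG hG' g hg h1 h2 f hf hgf y hy
    obtain ⟨y', hy'⟩ := hC.homogeneity_closure H hH K hK G G' hG hG' g (hφ H hH K hK g hg) h1 h2 f
      hf (hφ H hH K hK _ hgf) y hy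
    exact ⟨y', hy'.reduct φ⟩
  excellence := by
    rintro _ ⟨H, hH, rfl⟩ _ ⟨K, hK, rfl⟩ D hD hcr g hg hgD X hX hXD
    obtain ⟨D₀, h1, h2, h3⟩ := hC.excellence H hH K hK D hD hcr g ⟨hφ H hH K hK g hg.1, hg.2⟩ hgD X
      hX hXD
    exact ⟨D₀, h1, h2, fun f hfX hf => (h3 f hfX (hφ H hH K hK _ hf)).reduct φ⟩

theorem reductIso_of_partialEmb : ReductIso φ C := by
  constructor
  · have key : ∀ H K : ClStr.{u} L₀, H = K →
        PartialEmb H K {p : H.carrier × K.carrier | HEq p.1 p.2} := by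
      rintro H _ rfl
      exact (PartialEmb.id_rel H Set.univ).mono fun p hp => ⟨trivial, eq_of_heq hp⟩
    rintro H hH K hK h
    have h1 := hφ H hH K hK _ (key _ _ h)
    obtain ⟨A, s, c⟩ := H
    obtain ⟨B, t, d⟩ := K
    obtain ⟨rfl, _, hcd⟩ := ClStr.mk.inj h
    obtain rfl := eq_of_heq hcd
    obtain ⟨f, hf⟩ := h1.exists_embedding (Set.eq_univ_of_forall fun x => ⟨x, HEq.rfl⟩)
    have hf' : ∀ {n : ℕ} (x : Fin n → A), f ∘ x = x := fun x =>
      funext fun i => (eq_of_heq (hf (x i))).symm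
    have : s = t := by
      refine Structure.ext ?_ ?_
      · funext n g x
        have h2 := @Embedding.map_fun' L A A s t f n g x
        change f (s.funMap g x) = t.funMap g (f ∘ x) at h2
        rw [hf'] at h2
        exact (eq_of_heq (hf _)).trans h2
      · funext n g x
        have h2 := @Embedding.map_rel' L A A s t f n g x
        change t.RelMap g (f ∘ x) ↔ s.RelMap g x at h2
        rw [hf'] at h2
        exact propext h2.symm
    rw [this]
  · intro H hH K hK f
    refine and_congr ⟨?_, ?_⟩ Iff.rfl
    · rintro ⟨e, rfl⟩
      obtain ⟨f, hf⟩ := (hφ H hH K hK _ (PartialEmb.graph e)).exists_embedding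
        (Set.eq_univ_of_forall fun x => ⟨e x, rfl⟩)
      exact ⟨f, funext fun x => (hf x).symm⟩
    · rintro ⟨e, rfl⟩
      obtain ⟨f, hf⟩ := ((PartialEmb.graph e).reduct φ).exists_embedding
        (Set.eq_univ_of_forall fun x => ⟨e x, rfl⟩)
      exact ⟨f, funext fun x => (hf x).symm⟩

end Reducts

/-! ### Countable sublanguages -/

section Sublanguages

variable {L : FirstOrder.Language.{v, w}}

/-- The language with the symbols in `S`. -/
def sublanguage (S : Set L.Symbols) : FirstOrder.Language.{v, w} where
  Functions n := {f : L.Functions n // (Sum.inl ⟨n, f⟩ : L.Symbols) ∈ S}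
  Relations n := {R : L.Relations n // (Sum.inr ⟨n, R⟩ : L.Symbols) ∈ S}

/-- The inclusion of a sublanguage. -/
def sublanguageHom (S : Set L.Symbols) : sublanguage S →ᴸ L where
  onFunction _ f := f.1
  onRelation _ R := R.1

theorem sublanguageHom_injective (S : Set L.Symbols) : (sublanguageHom S).Injective :=
  ⟨fun h => Subtype.ext h, fun h => Subtype.ext h⟩

theorem countable_sublanguage {S : Set L.Symbols} (hS : S.Countable) :
    Countable (sublanguage S).Symbols := by
  have := hS.to_subtype
  refine Function.Injective.countable (β := S) (f := fun x => match x with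
    | Sum.inl ⟨n, f⟩ => ⟨Sum.inl ⟨n, f.1⟩, f.2⟩
    | Sum.inr ⟨n, R⟩ => ⟨Sum.inr ⟨n, R.1⟩, R.2⟩) ?_
  rintro (⟨n, f, hf⟩ | ⟨n, f, hf⟩) (⟨m, g, hg⟩ | ⟨m, g, hg⟩) h
  · obtain ⟨rfl, h⟩ := Sigma.mk.inj (Sum.inl.inj (Subtype.mk.inj h))
    obtain rfl := eq_of_heq h
    rfl
  · cases Subtype.mk.inj h
  · cases Subtype.mk.inj h
  · obtain ⟨rfl, h⟩ := Sigma.mk.inj (Sum.inr.inj (Subtype.mk.inj h))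
    obtain rfl := eq_of_heq h
    rfl

theorem exists_onTerm_eq {ι : Type*} (t : L.Term ι) : ∃ S : Set L.Symbols, S.Countable ∧
    ∀ T, S ⊆ T → ∃ t₀ : (sublanguage T).Term ι, (sublanguageHom T).onTerm t₀ = t := by
  induction t with
  | var i => exact ⟨∅, Set.countable_empty, fun T _ => ⟨Term.var i, rfl⟩⟩
  | @func n f ts ih =>
    choose S hS h using ih
    refine ⟨insert (Sum.inl ⟨n, f⟩) (⋃ i, S i), (Set.countable_iUnion hS).insert _,
      fun T hT => ?_⟩
    choose t₀ ht₀ using fun i => h i T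
      (((Set.subset_iUnion S i).trans (Set.subset_insert _ _)).trans hT)
    refine ⟨Term.func ⟨f, hT (Set.mem_insert _ _)⟩ t₀, ?_⟩
    simp only [LHom.onTerm, ht₀]
    rfl

/-- A single atomic formula witnesses that two atomic types differ, and it survives in every
sublanguage containing its symbols. -/
theorem exists_not_sameAtomic_sublanguage {H K : ClStr.{u} L} {ι : Type*} {a : ι → H.carrier}
    {b : ι → K.carrier} (h : ¬ SameAtomic L a b) : ∃ S : Set L.Symbols, S.Countable ∧ ∀ T, S ⊆ T →
      ¬ SameAtomic (sublanguage T) (M := (H.reduct (sublanguageHom T)).carrier)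
        (N := (K.reduct (sublanguageHom T)).carrier) a b := by
  by_cases h1 : ∀ s t : L.Term ι, s.realize a = t.realize a ↔ s.realize b = t.realize b
  · have h2 := mt (And.intro h1) h
    simp only [not_forall] at h2
    obtain ⟨k, R, t, h2⟩ := h2
    choose S hS h using fun i => exists_onTerm_eq (t i)
    refine ⟨insert (Sum.inr ⟨k, R⟩) (⋃ i, S i), (Set.countable_iUnion hS).insert _,
      fun T hT hcon => ?_⟩
    choose t₀ ht₀ using fun i => h i T
      (((Set.subset_iUnion S i).trans (Set.subset_insert _ _)).trans hT)
    have h3 := hcon.2 k ⟨R, hT (Set.mem_insert _ _)⟩ t₀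
    simp only [← ClStr.realize_onTerm, ht₀] at h3
    have h4 : Structure.RelMap R (fun i => (t i).realize a) ↔
      Structure.RelMap R (fun i => (t i).realize b) := h3
    tauto
  · push Not at h1
    obtain ⟨s, t, h1⟩ := h1
    obtain ⟨S, hS, hs⟩ := exists_onTerm_eq s
    obtain ⟨S', hS', ht⟩ := exists_onTerm_eq t
    refine ⟨S ∪ S', hS.union hS', fun T hT hcon => ?_⟩
    obtain ⟨s₀, hs₀⟩ := hs T (Set.subset_union_left.trans hT)
    obtain ⟨t₀, ht₀⟩ := ht T (Set.subset_union_right.trans hT)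
    have h3 := hcon.1 s₀ t₀
    simp only [← ClStr.realize_onTerm, hs₀, ht₀] at h3
    tauto

/-- A countable structure has a countable sublanguage with the same equality of atomic types. -/
theorem exists_countable_sublanguage (M : ClStr.{u} L) [Countable M.carrier] :
    ∃ S : Set L.Symbols, S.Countable ∧ ∀ (n : ℕ) (a b : Fin n → M.carrier),
      SameAtomic (sublanguage S) (M := (M.reduct (sublanguageHom S)).carrier)
        (N := (M.reduct (sublanguageHom S)).carrier) a b → SameAtomic L a b := by
  classical
  -- There are countably many pairs of finite tuples in M, so the symbols needed to separate all
  -- pairs of different types form a countable set.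
  let I := {p : Σ n, (Fin n → M.carrier) × (Fin n → M.carrier) // ¬ SameAtomic L p.2.1 p.2.2}
  choose S hS h using fun p : I => exists_not_sameAtomic_sublanguage p.2
  refine ⟨⋃ p, S p, Set.countable_iUnion hS, fun n a b hab => ?_⟩
  by_contra hcon
  exact h ⟨⟨n, a, b⟩, hcon⟩ _ (Set.subset_iUnion S _) hab

theorem QME.exists_reduct_scottDefinable {C : Set (ClStr.{u} L)} (hC : QME C) (hf : Full C) :
    ∃ (L₀ : FirstOrder.Language.{v, w}) (φ : L₀ →ᴸ L), φ.Injective ∧ Countable L₀.Symbols ∧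
      QME (ClStr.reduct φ '' C) ∧ ReductIso φ C ∧ ScottDefinable (ClStr.reduct φ '' C) := by
  have hh := hC.homogeneous
  obtain ⟨M, hM, hMd⟩ := hf ℵ₀
  have : Countable M.carrier := hh.countable_of_hasDim hM le_rfl hMd
  obtain ⟨S, hS, h⟩ := exists_countable_sublanguage M
  have hφ : ∀ H ∈ C, ∀ K ∈ C, ∀ r : SetRel H.carrier K.carrier,
      PartialEmb (H.reduct (sublanguageHom S)) (K.reduct (sublanguageHom S)) r →
        PartialEmb H K r := fun H hH K hK r hr =>
    hh.partialEmb_of_reduct _ hM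
      (fun H => dimLE_of_hasDim_infinite (hC.pregeometry M hM) le_rfl hMd) h hH hK r hr
  have hred := hC.reduct _ hφ
  have := countable_sublanguage hS
  refine ⟨sublanguage S, sublanguageHom S, sublanguageHom_injective S, this, hred,
    reductIso_of_partialEmb _ hφ, hred.scottDefinable fun κ => ?_⟩
  obtain ⟨H, hH, hHd⟩ := hf κ
  exact ⟨_, ⟨H, hH, rfl⟩, hHd⟩

end Sublanguages

end QMEC

open QMEC
theorem mainTheorem2 (L : FirstOrder.Language.{v, w})
    (C : Set (ClStr.{u, v, w} L)) (hC : QME C) :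
    ((∃ H ∈ C, HasDim H.cl ℵ₀) →
      ∃! C' : Set (ClStr.{u, v, w} L), QME C' ∧ C ⊆ C' ∧ UncountablyCategorical C') ∧
    (Nondegenerate C →
      UncountablyCategorical C ∧
      (Countable L.Symbols → ScottDefinable C) ∧
      ∃ (L₀ : FirstOrder.Language.{v, w}) (φ : L₀ →ᴸ L), φ.Injective ∧ Countable L₀.Symbols ∧
        QME (ClStr.reduct φ '' C) ∧ ReductIso φ C ∧ ScottDefinable (ClStr.reduct φ '' C)) := by
  refine ⟨fun ⟨M, hM, hMd⟩ => hC.existsUnique_uncountablyCategorical hM hMd, fun h => ?_⟩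
  have hf := hC.full_of_nondegenerate h
  exact ⟨hC.uncountablyCategorical hf, fun _ => hC.scottDefinable hf,
    hC.exists_reduct_scottDefinable hf⟩
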